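/- **Setting.** Let $g\in L^\infty(\mathbb R)$ be real-valued and even with $g\not\equiv 0$, let $\gamma\in\mathbb R\setminus\{0\}$, $\omega>0$ and $T=\frac{2\pi}{\omega}$. Write $\mathbb T_T=\mathbb R/T\mathbb Z$, $D=\mathbb R\times\mathbb T_T$, $\mathbb N_{odd}$ and $\mathbb Z_{odd}$ for the odd positive integers and the odd integers, and $e_k(t)=\frac1{\sqrt T}e^{i\omega kt}$. A *weak solution* of $$g(x)w_{tt}-w_{xx}+\gamma\,\delta_0(x)\,(w_t^3)_t=0\qquad(\ast)$$ is a real-valued $w\in H^1(D)$ with $\partial_tw(0,\cdot)\in L^3(\mathbb T_T)$ such that for all $\psi\in C_c^\infty(D)$ $$\int_D\bigl(-g(x)\,\partial_tw\,\partial_t\psi+\partial_xw\,\partial_x\psi\bigr)\,d(x,t)-\gamma\int_0^T(\partial_tw(0,t))^3\,\partial_t\psi(0,t)\,dt=0 .$$ **Assumptions.** For $k\in\mathbb N_{odd}$ let $L_k=-\frac{d^2}{dx^2}-k^2\omega^2g(x)$ on $L^2(\mathbb R)$ with domain $H^2(\mathbb R)$. Assume: * For every $k\in\mathbb N_{odd}$,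 $0$ lies neither in the essential spectrum of $L_k$ nor in its Dirichlet spectrum, i.e. the spectrum of the restriction of $L_k$ to odd functions. (Then there is a unique real-valued $\Phi_k\in H^2(0,\infty)\subset C^1([0,\infty))$ with $L_k\Phi_k=0$ on $(0,\infty)$ and $\Phi_k(0)=1$. Put $\Phi_{-k}=\Phi_k$.) * There are $\rho,M>0$ with $|\Phi_k(x)|\le Me^{-\rho x}$ for all $k\in\mathbb N_{odd}$ and $x\ge0$. * $\Phi_k'(0)=O(k)$, i.e. there is $K$ with $|\Phi_k'(0)|\le Kk$ for all $k\in\mathbb N_{odd}$. **The functional.** For real sequences on $\mathbb Z$ let $(z*y)_k=\sum_{l}z_ly_{k-l}$. Let $D(J)$ be the space of real sequences $z=(z_k)_{k\in\mathbb Z_{odd}}$ (extended by $0$ to $\mathbb Z$) with $z_{-k}=-z_k$ and $\|z\|_{D(J)}:=\|z*z\|_{\ell^2}^{1/2}<\infty$, and let $$J(z)=\frac14(z*z*z*z)_0+\frac{T}{\gamma\omega^4}\sum_{k\in\mathbb Z_{odd}}\frac{\Phi_k'(0)}{k^2}z_k^2,\qquad z\in D(J).$$ **Theorem.** For every critical point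 $\alpha\in D(J)$ of $J$ (i.e. $J'(\alpha)=0$ in the Fréchet sense), the series $$w(x,t)=\sum_{k\in\mathbb Z_{odd}}\frac{\alpha_k}{k}\,\Phi_k(|x|)\,e_k(t)$$ converges absolutely at every $(x,t)\in\mathbb R^2$ to a real-valued $T$-periodic weak solution of $(\ast)$, which is nontrivial if $\alpha\ne0$ and satisfies $|w(x,t)|\le Ce^{-\rho|x|}$ on $\mathbb R^2$ for some $C>0$. Moreover $$w\in H^{1+\nu}(\mathbb T_T;L^2(\mathbb R))\cap H^{\nu}(\mathbb T_T;H^1(\mathbb R))\qquad\text{for every }\nu\in(0,\tfrac14),$$ where, with $\hat u_k(x)=\frac1T\int_0^Tu(x,t)e^{-i\omega kt}\,dt$ and $X=L^2(\mathbb R)$ or $X=H^1(\mathbb R)$, $u\in H^s(\mathbb T_T;X)$ (for $s\ge0$) means that $u\in L^2(D)$ and $\sum_{k\in\mathbb Z}(1+k^2)^s\|\hat u_k\|_X^2<\infty$. If in addition either (i) $\gamma<0$ and $\Phi_k'(0)>0$ for at least one $k\in\mathbb N_{odd}$, or (ii) $\gamma>0$ and $\Phi_k'(0)<0$ for at least one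 $k\in\mathbb N_{odd}$, then $J$ has a nonzero critical point at which it attains its minimum over $D(J)$; in particular a nontrivial weak solution $w$ as above exists. -/

import Mathlib

open MeasureTheory Filter Topology
open scoped ENNReal

noncomputable section

namespace Breather

/-! ### Sobolev functions of one real variable -/

/-- `v` is the weak derivative of `u` on the open set `U ⊆ ℝ`. -/
def HasWeakDerivOn {E : Type*} [NormedAddCommGroup E] [NormedSpace ℝ E]
    (U : Set ℝ) (u v : ℝ → E) : Prop :=
  ∀ φ : ℝ → ℝ, ContDiff ℝ ((⊤ : ℕ∞) : WithTop ℕ∞) φ → HasCompactSupport φ → tsupport φ ⊆ U →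
    ∫ x in U, deriv φ x • u x = -∫ x in U, φ x • v x

/-! ### The operators `L_k` and their spectra -/

/-- The complex Hilbert space `L²(ℝ)`. -/
abbrev L2R : Type := Lp ℂ 2 (volume : Measure ℝ)

/-- The graph of `-d²/dx² - V` on `L²(ℝ)` with domain `H²(ℝ)`. -/
def schrodingerGraph (V : ℝ → ℝ) : Set (L2R × L2R) :=
  {p | ∃ d₁ d₂ : L2R, HasWeakDerivOn Set.univ (p.1 : ℝ → ℂ) d₁ ∧
      HasWeakDerivOn Set.univ (d₁ : ℝ → ℂ) d₂ ∧
      ∀ᵐ x : ℝ, (p.2 : ℝ → ℂ) x = -(d₂ : ℝ → ℂ) x - (V x : ℂ) * (p.1 : ℝ → ℂ) x}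

/-- The subspace of odd functions in `L²(ℝ)`. -/
def oddL2 : Set L2R := {u | ∀ᵐ x : ℝ, (u : ℝ → ℂ) (-x) = -(u : ℝ → ℂ) x}

/-- `z` lies in the resolvent set of the operator with graph `Γ`, considered as an operator in the
subspace `X` (with domain the elements of the original domain that lie in `X`): `A - z` is a
bijection onto `X` with bounded inverse. -/
def InResolventSet (X : Set L2R) (Γ : Set (L2R × L2R)) (z : ℂ) : Prop :=
  (∀ f ∈ X, ∃! u : L2R, u ∈ X ∧ (u, f + z • u) ∈ Γ) ∧
    ∃ C : ℝ, ∀ u ∈ X, ∀ f : L2R, (u, f) ∈ Γ → ‖u‖ ≤ C * ‖f - z • u‖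

/-- The spectrum of the operator with graph `Γ` in the subspace `X`. -/
def spectrumOn (X : Set L2R) (Γ : Set (L2R × L2R)) : Set ℂ := {z | ¬ InResolventSet X Γ z}

/-- The essential spectrum of a self-adjoint operator on `L²(ℝ)` with graph `Γ`: the spectrum
without the isolated points whose eigenspace is finite dimensional. -/
def essSpectrum (Γ : Set (L2R × L2R)) : Set ℂ :=
  {z | z ∈ spectrumOn Set.univ Γ ∧
    ¬ ((∃ ε > 0, ∀ z' ∈ spectrumOn Set.univ Γ, ‖z' - z‖ < ε → z' = z) ∧
        FiniteDimensional ℂ (Submodule.span ℂ {u : L2R | (u, z • u) ∈ Γ}))}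

/-- The spectrum of `-d²/dx² - V` (`V` even) with an extra Dirichlet condition at `0`, that is, the
spectrum of its restriction to odd functions. -/
def dirichletSpectrum (V : ℝ → ℝ) : Set ℂ := spectrumOn oddL2 (schrodingerGraph V)

/-- The potential `k²ω²g` of `L_k = -d²/dx² - k²ω²g`. -/
def potential (g : ℝ → ℝ) (ω : ℝ) (k : ℕ) (x : ℝ) : ℝ := (k : ℝ) ^ 2 * ω ^ 2 * g x

/-- For all odd `k ∈ ℕ`, `0` lies neither in the essential spectrum nor in the Dirichlet spectrum
of `L_k`. -/
def SpectralCondition (g : ℝ → ℝ) (ω : ℝ) : Prop :=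
  ∀ k : ℕ, Odd k → (0 : ℂ) ∉ essSpectrum (schrodingerGraph (potential g ω k)) ∪
    dirichletSpectrum (potential g ω k)

/-- `g ∈ L^∞(ℝ)` is even and not (almost everywhere) zero. -/
structure IsAdmissiblePotential (g : ℝ → ℝ) : Prop where
  memLp_top : MemLp g ∞ volume
  even : ∀ᵐ x : ℝ, g (-x) = g x
  ne_zero : ¬ g =ᵐ[volume] 0

/-- `φ ∈ H²(0,∞)` (represented by its continuous version on `[0,∞)`) solves `-φ'' - V φ = 0` on
`(0,∞)` and `φ(0) = 1`. -/
structure IsDecayingSolution (V φ : ℝ → ℝ) : Prop where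
  continuousOn : ContinuousOn φ (Set.Ici 0)
  at_zero : φ 0 = 1
  sobolev : ∃ d₁ d₂ : ℝ → ℝ,
    MemLp φ 2 (volume.restrict (Set.Ioi 0)) ∧
    MemLp d₁ 2 (volume.restrict (Set.Ioi 0)) ∧
    MemLp d₂ 2 (volume.restrict (Set.Ioi 0)) ∧
    HasWeakDerivOn (Set.Ioi 0) φ d₁ ∧ HasWeakDerivOn (Set.Ioi 0) d₁ d₂ ∧
    ∀ᵐ x ∂(volume.restrict (Set.Ioi (0 : ℝ))), -d₂ x - V x * φ x = 0

/-- The number `φ'(0)` for `φ ∈ H²(0,∞) ⊆ C¹([0,∞))`. -/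
def derivZero (φ : ℝ → ℝ) : ℝ := derivWithin φ (Set.Ici 0) 0

/-! ### Functions on `ℝ × 𝕋_T`, as functions on `ℝ × ℝ` that are `T`-periodic in the second variable -/

/-- A fundamental domain of `ℝ × 𝕋_T`. -/
def strip (T : ℝ) : Set (ℝ × ℝ) := Set.univ ×ˢ Set.Ioc 0 T

/-- The partial derivative with respect to the first variable. -/
def dx (ψ : ℝ × ℝ → ℝ) (z : ℝ × ℝ) : ℝ := deriv (fun s => ψ (s, z.2)) z.1

/-- The partial derivative with respect to the second variable. -/
def dt (ψ : ℝ × ℝ → ℝ) (z : ℝ × ℝ) : ℝ := deriv (fun s => ψ (z.1, s)) z.2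

/-- `ψ ∈ C_c^∞(ℝ × 𝕋_T)`. -/
structure IsTestFunction (T : ℝ) (ψ : ℝ × ℝ → ℝ) : Prop where
  smooth : ContDiff ℝ ((⊤ : ℕ∞) : WithTop ℕ∞) ψ
  periodic : ∀ x t, ψ (x, t + T) = ψ (x, t)
  compact_support : ∃ R : ℝ, ∀ x t, R < |x| → ψ (x, t) = 0

/-- `w ∈ H¹(ℝ × 𝕋_T)` with weak partial derivatives `wx` and `wt`. -/
structure IsH1 (T : ℝ) (w wx wt : ℝ × ℝ → ℝ) : Prop where
  periodic : ∀ x t, w (x, t + T) = w (x, t)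
  memLp : MemLp w 2 (volume.restrict (strip T))
  memLp_x : MemLp wx 2 (volume.restrict (strip T))
  memLp_t : MemLp wt 2 (volume.restrict (strip T))
  weak_x : ∀ ψ, IsTestFunction T ψ →
    ∫ z in strip T, w z * dx ψ z = -∫ z in strip T, wx z * ψ z
  weak_t : ∀ ψ, IsTestFunction T ψ →
    ∫ z in strip T, w z * dt ψ z = -∫ z in strip T, wt z * ψ z

/-- `w₀ ∈ L²(𝕋_T)` is the trace `w(0,·)` of `w ∈ H¹(ℝ × 𝕋_T)`. -/
def IsTraceZero (T : ℝ) (w : ℝ × ℝ → ℝ) (w₀ : ℝ → ℝ) : Prop :=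
  MemLp w₀ 2 (volume.restrict (Set.Ioc 0 T)) ∧
    Tendsto (fun ε : ℝ => ε⁻¹ * ∫ z in Set.Ioo (-ε) ε ×ˢ Set.Ioc 0 T, (w z - w₀ z.2) ^ 2)
      (𝓝[>] 0) (𝓝 0)

/-- `p` is the weak derivative of `w₀` on the torus `𝕋_T`. -/
def HasWeakDerivTorus (T : ℝ) (w₀ p : ℝ → ℝ) : Prop :=
  ∀ φ : ℝ → ℝ, ContDiff ℝ ((⊤ : ℕ∞) : WithTop ℕ∞) φ → (∀ t, φ (t + T) = φ t) →
    ∫ t in Set.Ioc 0 T, w₀ t * deriv φ t = -∫ t in Set.Ioc 0 T, p t * φ t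

/-- Weak solutions `w ∈ H¹(ℝ × 𝕋_T)`, `∂ₜw(0,·) ∈ L³(𝕋_T)`, of
`g(x) w_tt - w_xx + γ δ₀(x) (w_t³)_t = 0`. -/
def IsWeakSolution (g : ℝ → ℝ) (γ T : ℝ) (w : ℝ × ℝ → ℝ) : Prop :=
  ∃ (wx wt : ℝ × ℝ → ℝ) (w₀ p : ℝ → ℝ), IsH1 T w wx wt ∧ IsTraceZero T w w₀ ∧
    HasWeakDerivTorus T w₀ p ∧ MemLp p 3 (volume.restrict (Set.Ioc 0 T)) ∧
    ∀ ψ, IsTestFunction T ψ →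
      (∫ z in strip T, (-g z.1 * wt z * dt ψ z + wx z * dx ψ z)) -
        γ * ∫ t in Set.Ioc 0 T, p t ^ 3 * dt ψ (0, t) = 0

/-! ### Fractional Sobolev spaces of time-periodic functions -/

/-- The Fourier coefficient `û_k(x) = (1/T) ∫₀ᵀ u(x,t) e^{-iωkt} dt`, `ω = 2π/T`. -/
def timeCoeff (T : ℝ) (u : ℝ × ℝ → ℝ) (k : ℤ) (x : ℝ) : ℂ :=
  (1 / T : ℂ) * ∫ t in Set.Ioc 0 T,
    (u (x, t) : ℂ) * Complex.exp (-(2 * Real.pi * Complex.I * k * t / T))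

/-- `u ∈ H^s(𝕋_T; L²(ℝ))`, for `s ≥ 0`. -/
def MemHsL2 (T s : ℝ) (u : ℝ × ℝ → ℝ) : Prop :=
  (∀ x t, u (x, t + T) = u (x, t)) ∧ MemLp u 2 (volume.restrict (strip T)) ∧
    (∀ k : ℤ, MemLp (timeCoeff T u k) 2 volume) ∧
    Summable fun k : ℤ => (1 + (k : ℝ) ^ 2) ^ s * ∫ x : ℝ, ‖timeCoeff T u k x‖ ^ 2

/-- `u ∈ H^s(𝕋_T; H¹(ℝ))`, for `s ≥ 0`; `d k` is the weak derivative of `û_k`. -/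
def MemHsH1 (T s : ℝ) (u : ℝ × ℝ → ℝ) : Prop :=
  (∀ x t, u (x, t + T) = u (x, t)) ∧ MemLp u 2 (volume.restrict (strip T)) ∧
    ∃ d : ℤ → ℝ → ℂ,
      (∀ k : ℤ, MemLp (timeCoeff T u k) 2 volume ∧ MemLp (d k) 2 volume ∧
        HasWeakDerivOn Set.univ (timeCoeff T u k) (d k)) ∧
      Summable fun k : ℤ => (1 + (k : ℝ) ^ 2) ^ s *
        ((∫ x : ℝ, ‖timeCoeff T u k x‖ ^ 2) + ∫ x : ℝ, ‖d k x‖ ^ 2)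

/-! ### The functional on sequences -/

/-- Convolution of two sequences indexed by `ℤ`. -/
def convolve (z y : ℤ → ℝ) (k : ℤ) : ℝ := ∑' l : ℤ, z l * y (k - l)

/-- `D(J)`: the real sequences `z` on the odd integers (extended by `0` to `ℤ`) with `z_{-k} = -z_k`
and `z * z ∈ ℓ²`. -/
structure MemDomJ (z : ℤ → ℝ) : Prop where
  support_odd : ∀ k : ℤ, Even k → z k = 0
  odd : ∀ k : ℤ, z (-k) = -z k
  conv_converges : ∀ k : ℤ, Summable fun l : ℤ => z l * z (k - l)
  conv_sq_summable : Summable fun k : ℤ => convolve z z k ^ 2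

/-- The norm `‖z * z‖_{ℓ²}^{1/2}` of `D(J)`. -/
def normJ (z : ℤ → ℝ) : ℝ := Real.sqrt (Real.sqrt (∑' k : ℤ, convolve z z k ^ 2))

/-- `J(z) = (1/4) (z*z*z*z)_0 + T/(γω⁴) ∑_k (Φ_k'(0)/k²) z_k²` with `T = 2π/ω`, `Φ_{-k} = Φ_k`. -/
def J (γ ω : ℝ) (Φ : ℕ → ℝ → ℝ) (z : ℤ → ℝ) : ℝ :=
  1 / 4 * convolve (convolve z z) (convolve z z) 0 +
    (2 * Real.pi / ω) / (γ * ω ^ 4) *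
      ∑' k : ℤ, derivZero (Φ k.natAbs) / (k : ℝ) ^ 2 * z k ^ 2

/-- `α ∈ D(J)` is a critical point of `J`: the Fréchet derivative of `J` at `α` with respect to the
norm of `D(J)` is zero. -/
def IsCriticalPoint (γ ω : ℝ) (Φ : ℕ → ℝ → ℝ) (α : ℤ → ℝ) : Prop :=
  MemDomJ α ∧ ∀ ε > 0, ∃ δ > 0, ∀ y : ℤ → ℝ, MemDomJ y → normJ y < δ →
    |J γ ω Φ (α + y) - J γ ω Φ α| ≤ ε * normJ y

/-- `e_k(t) = T^{-1/2} e^{iωkt}`, `ω = 2π/T`. -/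
def e (T : ℝ) (k : ℤ) (t : ℝ) : ℂ :=
  (1 / Real.sqrt T : ℂ) * Complex.exp (2 * Real.pi * Complex.I * k * t / T)

/-- The real-valued function `w` is given by
`w(x,t) = ∑_{k odd} (α_k/k) Φ_k(|x|) e_k(t)`, where `Φ_{-k} = Φ_k`. -/
def IsSeriesOf (T : ℝ) (Φ : ℕ → ℝ → ℝ) (α : ℤ → ℝ) (w : ℝ × ℝ → ℝ) : Prop :=
  ∀ x t : ℝ, HasSum
    (fun k : {k : ℤ // Odd k} => ((α k / (k : ℤ) * Φ (k : ℤ).natAbs |x| : ℝ) : ℂ) * e T k t)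
    (w (x, t) : ℂ)

end Breather

end

open Breather

/-! A sequence `z` in D(J) is encoded by the real function `F` on the circle whose Fourier
coefficients are `-i z_k` (`MemDomJ.exists_hasSineCoeff`). For normalised Haar measure, Parseval
turns both `(z*z*z*z)_0` and the fourth power of the norm of D(J) into `∫ F^4`. Thus D(J) is a
subspace of L⁴ and J reads `1/4 ∫ F^4 + ∑ r_k z_k^2`, where the growth bound on `Φ_k'(0)` gives `r_k
= O(1/|k|)`.

Testing criticality of `α` with single sine modes gives the Euler-Lagrange equation: `F^3` has
coefficients `-i b_k` with `b_k = -2 r_k α_k` (`fourierCoeff_cube_of_critical`). Hence `k b_k` is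
square summable, that is, `F^3` lies in H¹. The cube root is Hölder continuous, so this controls the
L² modulus of continuity of `F`, and a dyadic summation gives `∑ (1+k²)^ν α_k² < ∞` for `ν < 1/4`
(`summable_weighted_sq`).

On the side of the wave equation, pairing `k` with `-k` turns the series into `∑ a_n Φ_k(|x|)
cos(κ_n t)` with `k = 2n+1`, `a_n = 2α_k/(k√T)`, `κ_n = ωk`, and the `a_n` are absolutely summable.
Each profile solves a linear equation off the origin; its even reflection `u`, with weak derivative
`D`, carries the boundary term `-2Φ_k'(0)` at the origin and satisfies `∫ D² = -2Φ_k'(0) + ∫ k²ω² g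
u² = O(k²)` (`IsDecayingSolution.exists_extension`). This energy bound puts the series in H¹. With
`β = ω/√T`, the time derivative at `x = 0` is `-βF`. In the weak form the bulk terms cancel mode by
mode, and the remaining boundary terms are the Fourier expansion of the cubic term, which is the
Euler-Lagrange equation again (`IsModeFamily.isWeakSolution`). The factor `1/k` in `a_n` raises the
regularity of `α` by one order.

A minimiser comes from the direct method (`exists_energy_min`). Bounded `r` gives coercivity; `r_k →
0` makes the quadratic part continuous for coordinatewise convergence of bounded sequences;
Clarkson's inequality then makes a minimising sequence Cauchy in L⁴. Under the sign conditions some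
`r_k` is negative, so a small sine mode has negative energy and the minimiser is not zero
(`exists_energyCritical_min`). -/

noncomputable section

namespace Breather

/-! ### Fourier coefficients on the circle: uniqueness, Parseval, Riesz–Fischer. -/

section FourierSeries

open AddCircle

variable {T : ℝ} [hT : Fact (0 < T)]

/-- A real integrable function on the circle whose Fourier coefficients vanish is zero. -/
theorem ae_eq_zero_of_fourierCoeff_eq_zero {f : AddCircle T → ℝ}
    (hf : Integrable f haarAddCircle)
    (h : ∀ k, fourierCoeff (fun t => (f t : ℂ)) k = 0) : f =ᵐ[haarAddCircle] 0 := by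
  have hfc : Integrable (fun t => (f t : ℂ)) haarAddCircle := hf.ofReal
  have key : ∀ φ : C(AddCircle T, ℂ), ∫ t, φ t * (f t : ℂ) ∂haarAddCircle = 0 := by
    have hint : ∀ φ : C(AddCircle T, ℂ), Integrable (fun t => φ t * (f t : ℂ)) haarAddCircle := by
      intro φ
      exact hfc.bdd_mul (map_continuous φ).aestronglyMeasurable
        (ae_of_all _ fun t => φ.norm_coe_le_norm t)
    let Λ : C(AddCircle T, ℂ) →ₗ[ℂ] ℂ :=
      { toFun := fun φ => ∫ t, φ t * (f t : ℂ) ∂haarAddCircle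
        map_add' := fun φ ψ => by
          simp only [ContinuousMap.add_apply, add_mul]
          exact integral_add (hint φ) (hint ψ)
        map_smul' := fun c φ => by
          simp only [ContinuousMap.smul_apply, smul_eq_mul, mul_assoc, RingHom.id_apply]
          exact integral_const_mul _ _ }
    let Λ' : C(AddCircle T, ℂ) →L[ℂ] ℂ := Λ.mkContinuous (∫ t, |f t| ∂haarAddCircle) (by
      intro φ
      calc ‖∫ t, φ t * (f t : ℂ) ∂haarAddCircle‖ ≤ ∫ t, ‖φ‖ * |f t| ∂haarAddCircle := by
            refine norm_integral_le_of_norm_le (hf.abs.const_mul _) (ae_of_all _ fun t => ?_)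
            rw [norm_mul, Complex.norm_real, Real.norm_eq_abs]
            exact mul_le_mul_of_nonneg_right (φ.norm_coe_le_norm t) (abs_nonneg _)
        _ = _ := by rw [integral_const_mul, mul_comm])
    -- Trigonometric polynomials are dense in the continuous functions, so a bounded functional
    -- vanishing on them vanishes.
    have : Λ' = 0 := by
      refine ContinuousLinearMap.ext_on (s := Set.range (@fourier T)) ?_ ?_
      · have := span_fourier_closure_eq_top (T := T)
        rw [dense_iff_closure_eq, ← Submodule.topologicalClosure_coe, this]
        rfl
      · rintro _ ⟨k, rfl⟩
        have := h (-k)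
        simpa [fourierCoeff, Λ', Λ] using this
    intro φ
    exact DFunLike.congr_fun this φ
  obtain ⟨f', hf'm, hff'⟩ := hf.1
  have hf' : Integrable f' haarAddCircle := hf.congr hff'
  have hf'meas : Measurable f' := hf'm.measurable
  have hfin : ∀ s : ℝ, ∫⁻ t, ENNReal.ofReal (s * f' t) ∂haarAddCircle ≠ ∞ := fun s =>
    ((hf'.const_mul s).lintegral_lt_top).ne
  have hm : ∀ s : ℝ, Measurable fun t => ENNReal.ofReal (s * f' t) := fun s =>
    (hf'meas.const_mul s).ennreal_ofReal
  have : ∀ s : ℝ, IsFiniteMeasure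
      ((haarAddCircle (T := T)).withDensity fun t => ENNReal.ofReal (s * f' t)) := fun s =>
    isFiniteMeasure_withDensity (hfin s)
  -- The positive and negative parts of `f'` are densities of finite measures with the same
  -- integrals of continuous functions. So the measures, and then the densities, coincide.
  have heq : (haarAddCircle (T := T)).withDensity (fun t => ENNReal.ofReal (1 * f' t)) =
      (haarAddCircle (T := T)).withDensity (fun t => ENNReal.ofReal (-1 * f' t)) := by
    refine ext_of_forall_integral_eq_of_IsFiniteMeasure fun φ => ?_
    rw [integral_withDensity_eq_integral_toReal_smul (hm 1) (by simp),
      integral_withDensity_eq_integral_toReal_smul (hm (-1)) (by simp), ← sub_eq_zero,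
      ← integral_sub]
    · have h0 := key ⟨fun t => (φ t : ℂ), by fun_prop⟩
      have h1 : ∫ t, φ t * f' t ∂haarAddCircle = 0 := by
        have : ∫ t, ((φ t * f t : ℝ) : ℂ) ∂haarAddCircle = 0 := by
          simpa using h0
        rw [integral_complex_ofReal] at this
        rw [← Complex.ofReal_eq_zero, ← this]
        congr 1
        exact integral_congr_ae (by filter_upwards [hff'] with t ht; rw [ht])
      rw [← h1]
      refine integral_congr_ae (ae_of_all _ fun t => ?_)
      simp only [smul_eq_mul]
      rw [ENNReal.toReal_ofReal', ENNReal.toReal_ofReal']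
      rcases le_total 0 (f' t) with h | h
      · rw [max_eq_left (by linarith), max_eq_right (by linarith)]; ring
      · rw [max_eq_right (by linarith), max_eq_left (by linarith)]; ring
    all_goals
      simp only [smul_eq_mul, ENNReal.toReal_ofReal']
      refine Integrable.mul_bdd ?_ φ.continuous.aestronglyMeasurable
        (ae_of_all _ fun t => φ.norm_coe_le_norm t)
      exact (hf'.const_mul _).pos_part
  rw [withDensity_eq_iff (hm 1).aemeasurable (hm (-1)).aemeasurable (hfin 1)] at heq
  filter_upwards [heq, hff'] with t ht h2
  rw [h2]
  rcases le_total 0 (f' t) with h | h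
  · rw [ENNReal.ofReal_of_nonpos (p := -1 * f' t) (by linarith), ENNReal.ofReal_eq_zero] at ht
    simp; linarith
  · rw [ENNReal.ofReal_of_nonpos (p := 1 * f' t) (by linarith), eq_comm,
      ENNReal.ofReal_eq_zero] at ht
    simp; linarith

theorem hasSum_sq_norm_fourierCoeff {f : AddCircle T → ℂ} (hf : MemLp f 2 haarAddCircle) :
    HasSum (fun k => ‖fourierCoeff f k‖ ^ 2) (∫ t, ‖f t‖ ^ 2 ∂haarAddCircle) := by
  convert hasSum_sq_fourierCoeff hf.toLp using 1
  · rw [fourierCoeff_congr_ae hf.coeFn_toLp]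
  · exact integral_congr_ae (by filter_upwards [hf.coeFn_toLp] with t ht; rw [ht])

/-- Parseval's identity for the bilinear pairing. -/
theorem hasSum_fourierCoeff_mul {f g : AddCircle T → ℂ} (hf : MemLp f 2 haarAddCircle)
    (hg : MemLp g 2 haarAddCircle) (k : ℤ) :
    HasSum (fun l => fourierCoeff f l * fourierCoeff g (k - l))
      (fourierCoeff (fun t => f t * g t) k) := by
  -- The bilinear pairing becomes an inner product: the coefficient of `f g` at `k` is the inner
  -- product of `e_k * conj g` with `f`.
  have hh : MemLp (fun t => fourier k t * (starRingEnd ℂ) (g t)) 2 haarAddCircle := by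
    refine MemLp.of_le (f := fun t => fourier k t * (starRingEnd ℂ) (g t)) hg
      ((map_continuous (fourier k)).aestronglyMeasurable.mul
        (Complex.continuous_conj.comp_aestronglyMeasurable hg.1)) (ae_of_all _ fun t => ?_)
    rw [norm_mul, RCLike.norm_conj, fourier_apply, Circle.norm_coe, one_mul]
  have := (fourierBasis (T := T)).hasSum_inner_mul_inner hh.toLp hf.toLp
  have h1 : ∀ l, fourierCoeff f l * fourierCoeff g (k - l) =
      inner ℂ hh.toLp (fourierBasis (T := T) l) * inner ℂ (fourierBasis (T := T) l) hf.toLp := by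
    intro l
    rw [mul_comm, ← HilbertBasis.repr_apply_apply, fourierBasis_repr,
      fourierCoeff_congr_ae hf.coeFn_toLp]
    congr 1
    rw [← inner_conj_symm, ← HilbertBasis.repr_apply_apply, fourierBasis_repr,
      fourierCoeff_congr_ae hh.coeFn_toLp, fourierCoeff, fourierCoeff, ← integral_conj]
    refine integral_congr_ae (ae_of_all _ fun t => ?_)
    simp only [smul_eq_mul, map_mul, Complex.conj_conj]
    rw [← fourier_neg, ← fourier_neg, ← mul_assoc, ← fourier_add]
    congr 3
    ring
  have h2 : fourierCoeff (fun t => f t * g t) k = inner ℂ hh.toLp hf.toLp := by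
    rw [L2.inner_def, fourierCoeff]
    refine integral_congr_ae ?_
    filter_upwards [hf.coeFn_toLp, hh.coeFn_toLp] with t h1 h2
    rw [h1, h2, RCLike.inner_apply', map_mul, Complex.conj_conj, ← fourier_neg, smul_eq_mul]
    ring
  simpa only [h1, h2] using this

theorem exists_memLp_fourierCoeff_eq {c : ℤ → ℂ} (hc : Summable fun k => ‖c k‖ ^ 2) :
    ∃ f : AddCircle T → ℂ, MemLp f 2 haarAddCircle ∧ fourierCoeff f = c := by
  have hm : Memℓp c 2 := by
    rw [memℓp_gen_iff (by norm_num)]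
    simpa using hc
  refine ⟨(fourierBasis (T := T)).repr.symm ⟨c, hm⟩, Lp.memLp _, ?_⟩
  ext k
  rw [← fourierBasis_repr, LinearIsometryEquiv.apply_symm_apply]

theorem fourierCoeff_conj (f : AddCircle T → ℂ) (k : ℤ) :
    fourierCoeff (fun t => (starRingEnd ℂ) (f t)) k = (starRingEnd ℂ) (fourierCoeff f (-k)) := by
  rw [fourierCoeff, fourierCoeff, ← integral_conj]
  refine integral_congr_ae (ae_of_all _ fun t => ?_)
  simp only [smul_eq_mul, map_mul, ← fourier_neg, neg_neg]

theorem fourierCoeff_sub {f g : AddCircle T → ℂ} (hf : Integrable f haarAddCircle)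
    (hg : Integrable g haarAddCircle) (k : ℤ) :
    fourierCoeff (fun t => f t - g t) k = fourierCoeff f k - fourierCoeff g k := by
  simpa [fourierCoeff, mul_sub, -fourier_apply] using
    integral_sub (hf.fourier_smul (-k)) (hg.fourier_smul (-k))

/-- Passing to the real part of the Riesz–Fischer function replaces `c_k` by the mean of `c_k` and
`conj c_{-k}`, which is `c_k` by the symmetry. -/
theorem exists_real_memLp_fourierCoeff_eq {c : ℤ → ℂ} (hc : Summable fun k => ‖c k‖ ^ 2)
    (hconj : ∀ k, c (-k) = (starRingEnd ℂ) (c k)) :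
    ∃ f : AddCircle T → ℝ, MemLp f 2 haarAddCircle ∧ fourierCoeff (fun t => (f t : ℂ)) = c := by
  obtain ⟨f, hf, hfc⟩ := exists_memLp_fourierCoeff_eq (T := T) hc
  have hf' : MemLp (fun t => (starRingEnd ℂ) (f t)) 2 haarAddCircle := hf.star
  refine ⟨fun t => (f t).re, hf.re, ?_⟩
  ext k
  have : (fun t => (((f t).re : ℝ) : ℂ)) = (2⁻¹ : ℂ) • (f + fun t => (starRingEnd ℂ) (f t)) := by
    ext t
    simp only [Pi.smul_apply, Pi.add_apply, Complex.add_conj, smul_eq_mul]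
    push_cast; ring
  rw [this, fourierCoeff.const_smul,
    fourierCoeff.add (hf.integrable one_le_two) (hf'.integrable one_le_two), Pi.add_apply,
    fourierCoeff_conj, hfc, hconj, Complex.conj_conj, smul_eq_mul]
  ring

theorem memLp_four_iff {α : Type*} [MeasurableSpace α] {μ : Measure α} {F : α → ℝ}
    (hF : AEStronglyMeasurable F μ) : MemLp F 4 μ ↔ Integrable (fun t => F t ^ 4) μ := by
  rw [← integrable_norm_rpow_iff hF (by norm_num) (by norm_num)]
  refine integrable_congr (ae_of_all _ fun t => ?_)
  have : (4 : ℝ≥0∞).toReal = (4 : ℕ) := by norm_num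
  simp only [this, Real.rpow_natCast, Real.norm_eq_abs]
  exact Even.pow_abs (by decide) _

theorem memLp_sq_two_iff {α : Type*} [MeasurableSpace α] {μ : Measure α} {F : α → ℝ}
    (hF : AEStronglyMeasurable F μ) : MemLp (fun t => F t ^ 2) 2 μ ↔ MemLp F 4 μ := by
  rw [memLp_two_iff_integrable_sq (f := fun t => F t ^ 2) (hF.pow 2), memLp_four_iff hF]
  simp only [← pow_mul, Nat.reduceMul]

/-- An integrable function is square integrable if its Fourier coefficients are square summable. -/
theorem memLp_two_of_summable {f : AddCircle T → ℝ} (hf : Integrable f haarAddCircle)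
    (h : Summable fun k => ‖fourierCoeff (fun t => (f t : ℂ)) k‖ ^ 2) :
    MemLp f 2 haarAddCircle := by
  obtain ⟨H, hH, hHc⟩ := exists_real_memLp_fourierCoeff_eq (T := T) h (by
    intro k
    have := fourierCoeff_conj (fun t => (f t : ℂ)) (-k)
    simpa only [Complex.conj_ofReal, neg_neg] using this)
  have hi : Integrable H haarAddCircle := hH.integrable one_le_two
  -- The function `f` is only in L¹ here, so the L² isometry cannot identify it with `H`; uniqueness
  -- in L¹ is needed.
  have h0 : (fun t => f t - H t) =ᵐ[haarAddCircle] 0 := by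
    refine ae_eq_zero_of_fourierCoeff_eq_zero (hf.sub hi) fun k => ?_
    have := fourierCoeff_sub (hf.ofReal (𝕜 := ℂ)) (hi.ofReal (𝕜 := ℂ)) k
    simp only [Complex.coe_algebraMap] at this
    rw [hHc, sub_self] at this
    simpa using this
  refine hH.ae_eq ?_
  filter_upwards [h0] with t ht
  simp only [Pi.zero_apply] at ht
  linarith

/-- A square integrable function is in `L⁴` if its square has square summable Fourier
coefficients. -/
theorem memLp_four_of_summable {F : AddCircle T → ℝ} (hF : MemLp F 2 haarAddCircle)
    (h : Summable fun k => ‖fourierCoeff (fun t => ((F t ^ 2 : ℝ) : ℂ)) k‖ ^ 2) :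
    MemLp F 4 haarAddCircle :=
  (memLp_sq_two_iff hF.1).1 (memLp_two_of_summable hF.integrable_sq h)

end FourierSeries

/-! ### The dictionary between sequences in D(J) and functions in L⁴. -/

section Sequences

open AddCircle

variable {T : ℝ} [hT : Fact (0 < T)]

/-- `F(t) = ∑ₖ -i zₖ e^{2πikt/T}`, in the sense of Fourier coefficients. -/
def HasSineCoeff (z : ℤ → ℝ) (F : AddCircle T → ℝ) : Prop :=
  ∀ k, fourierCoeff (fun t => (F t : ℂ)) k = -Complex.I * z k

theorem memLp_two_of_four {F : AddCircle T → ℝ} (hF : MemLp F 4 haarAddCircle) :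
    MemLp F 2 haarAddCircle :=
  hF.mono_exponent (by norm_num)

/-- Parseval also supplies the convergence of the convolution. The factors `a` and `b` take the
values `-i` and `-1` for `F` and `F^2`. -/
theorem fourierCoeff_mul_eq_convolve {f g : AddCircle T → ℂ} (hf : MemLp f 2 haarAddCircle)
    (hg : MemLp g 2 haarAddCircle) {z y : ℤ → ℝ} {a b : ℂ} (ha : a ≠ 0) (hb : b ≠ 0)
    (hfz : ∀ k, fourierCoeff f k = a * z k) (hgy : ∀ k, fourierCoeff g k = b * y k) (k : ℤ) :
    (Summable fun l => z l * y (k - l)) ∧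
      fourierCoeff (fun t => f t * g t) k = a * b * convolve z y k := by
  have h := hasSum_fourierCoeff_mul hf hg k
  have h1 := h.mul_left (a * b)⁻¹
  have h2 : (fun l => (a * b)⁻¹ * (fourierCoeff f l * fourierCoeff g (k - l))) =
      fun l => ((z l * y (k - l) : ℝ) : ℂ) := by
    ext l
    rw [hfz, hgy]
    push_cast
    field_simp
  rw [h2] at h1
  have hs : Summable fun l => z l * y (k - l) := Complex.summable_ofReal.1 h1.summable
  refine ⟨hs, ?_⟩
  have h3 := h1.unique (Complex.hasSum_ofReal.2 hs.hasSum)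
  rw [convolve, ← h3]
  field_simp

namespace HasSineCoeff

variable {z y : ℤ → ℝ} {F G : AddCircle T → ℝ}

theorem add (hz : HasSineCoeff z F) (hy : HasSineCoeff y G) (hF : Integrable F haarAddCircle)
    (hG : Integrable G haarAddCircle) : HasSineCoeff (z + y) (fun t => F t + G t) := by
  intro k
  have h := congrFun (fourierCoeff.add hF.ofReal (hG.ofReal (𝕜 := ℂ))) k
  have h2 : ((fun t => ((F t : ℝ) : ℂ)) + fun t => ((G t : ℝ) : ℂ)) =
    fun t => ((F t + G t : ℝ) : ℂ) := by ext t; simp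
  simp only [Complex.coe_algebraMap, h2, Pi.add_apply] at h
  rw [h, hz k, hy k, Pi.add_apply]
  push_cast; ring

theorem smul (hz : HasSineCoeff z F) (s : ℝ) : HasSineCoeff (s • z) (fun t => s * F t) := by
  intro k
  have h := fourierCoeff.const_mul (fun t => ((F t : ℝ) : ℂ)) (s : ℂ) k
  simp only [Complex.ofReal_mul]
  rw [h, hz k, Pi.smul_apply, smul_eq_mul]
  push_cast; ring

/-- Reality of `F` makes the coefficients at `k` and `-k` conjugate, and the factor `-i` turns this
into oddness. -/
theorem odd (hz : HasSineCoeff z F) (k : ℤ) : z (-k) = -z k := by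
  have := fourierCoeff_conj (fun t => ((F t : ℝ) : ℂ)) k
  simp only [Complex.conj_ofReal] at this
  rw [hz k, hz (-k)] at this
  simp only [map_mul, map_neg, Complex.conj_I, Complex.conj_ofReal, neg_neg] at this
  have h3 : Complex.I * (z (-k) : ℂ) = Complex.I * ((-z k : ℝ) : ℂ) := by
    rw [← this]; push_cast; ring
  exact_mod_cast mul_left_cancel₀ Complex.I_ne_zero h3

theorem hasSum_mul (hz : HasSineCoeff z F) (hy : HasSineCoeff y G)
    (hF : MemLp F 2 haarAddCircle) (hG : MemLp G 2 haarAddCircle) :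
    HasSum (fun k => z k * y k) (∫ t, F t * G t ∂haarAddCircle) := by
  have h := hasSum_fourierCoeff_mul hF.ofReal (hG.ofReal (K := ℂ)) 0
  rw [← Complex.hasSum_ofReal, ← integral_complex_ofReal]
  convert h using 1
  · ext l
    simp only [Complex.coe_algebraMap]
    rw [hz l, hy, zero_sub, hy.odd]
    push_cast
    linear_combination ((z l : ℂ) * y l) * Complex.I_sq
  · simp [fourierCoeff]

theorem hasSum_sq (hz : HasSineCoeff z F) (hF : MemLp F 2 haarAddCircle) :
    HasSum (fun k => z k ^ 2) (∫ t, F t ^ 2 ∂haarAddCircle) := by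
  simpa only [pow_two] using hz.hasSum_mul hz hF hF

theorem fourierCoeff_sq (hz : HasSineCoeff z F) (hF : MemLp F 2 haarAddCircle) (k : ℤ) :
    (Summable fun l => z l * z (k - l)) ∧
      fourierCoeff (fun t => ((F t ^ 2 : ℝ) : ℂ)) k = -1 * convolve z z k := by
  have h := fourierCoeff_mul_eq_convolve hF.ofReal hF.ofReal (neg_ne_zero.2 Complex.I_ne_zero)
    (neg_ne_zero.2 Complex.I_ne_zero) hz hz k
  simpa [pow_two] using h

/-- Parseval for `F^2`, whose coefficients are `-(z*z)_k`. This identifies the norm of D(J) with the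
L⁴ norm. -/
theorem hasSum_convolve_sq (hz : HasSineCoeff z F) (hF : MemLp F 4 haarAddCircle) :
    HasSum (fun k => convolve z z k ^ 2) (∫ t, F t ^ 4 ∂haarAddCircle) := by
  have h2 : MemLp (fun t => F t ^ 2) 2 haarAddCircle := (memLp_sq_two_iff hF.1).2 hF
  have h := hasSum_sq_norm_fourierCoeff (h2.ofReal (K := ℂ))
  convert h using 1
  · ext k
    have := (hz.fourierCoeff_sq (memLp_two_of_four hF) k).2
    simp only [Complex.coe_algebraMap]
    rw [this]
    simp
  · refine integral_congr_ae (ae_of_all _ fun t => ?_)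
    simp only [Complex.coe_algebraMap, Complex.norm_real, Real.norm_eq_abs, sq_abs]
    ring

theorem memDomJ (hz : HasSineCoeff z F) (hF : MemLp F 4 haarAddCircle)
    (hodd : ∀ k, Even k → z k = 0) : MemDomJ z where
  support_odd := hodd
  odd := hz.odd
  conv_converges k := (hz.fourierCoeff_sq (memLp_two_of_four hF) k).1
  conv_sq_summable := (hz.hasSum_convolve_sq hF).summable

theorem normJ_pow_four (hz : HasSineCoeff z F) (hF : MemLp F 4 haarAddCircle) :
    normJ z ^ 4 = ∫ t, F t ^ 4 ∂haarAddCircle := by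
  have h0 : 0 ≤ ∫ t, F t ^ 4 ∂(haarAddCircle (T := T)) := integral_nonneg fun t => by positivity
  rw [normJ, (hz.hasSum_convolve_sq hF).tsum_eq,
    show ∀ x : ℝ, x ^ 4 = (x ^ 2) ^ 2 from fun x => by ring,
    Real.sq_sqrt (Real.sqrt_nonneg _), Real.sq_sqrt h0]

theorem convolve_convolve_zero (hz : HasSineCoeff z F) (hF : MemLp F 4 haarAddCircle) :
    convolve (convolve z z) (convolve z z) 0 = ∫ t, F t ^ 4 ∂haarAddCircle := by
  rw [← (hz.hasSum_convolve_sq hF).tsum_eq, convolve]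
  congr 1
  ext l
  have : convolve z z (-l) = convolve z z l := by
    rw [convolve, ← (Equiv.neg ℤ).tsum_eq, convolve]
    congr 1
    ext j
    rw [Equiv.neg_apply, hz.odd, show -l - -j = -(l - j) by ring, hz.odd]
    ring
  rw [zero_sub, this, pow_two]

theorem fourierCoeff_cube (hz : HasSineCoeff z F) (hF : MemLp F 4 haarAddCircle) (k : ℤ) :
    fourierCoeff (fun t => ((F t ^ 3 : ℝ) : ℂ)) k =
      Complex.I * convolve (convolve z z) z k := by
  have h2 : MemLp (fun t => F t ^ 2) 2 haarAddCircle := (memLp_sq_two_iff hF.1).2 hF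
  have h := (fourierCoeff_mul_eq_convolve h2.ofReal (memLp_two_of_four hF).ofReal (neg_ne_zero.2 one_ne_zero)
    (neg_ne_zero.2 Complex.I_ne_zero) (fun k => (hz.fourierCoeff_sq (memLp_two_of_four hF) k).2) hz k).2
  simp only [Complex.coe_algebraMap, neg_mul, one_mul, neg_neg] at h
  rw [← h]
  congr 1
  ext t
  push_cast; ring

end HasSineCoeff

/-- By oddness the convolution series at index `0` is `-∑ z_k²`. -/
theorem MemDomJ.summable_sq {z : ℤ → ℝ} (hz : MemDomJ z) : Summable fun k => z k ^ 2 := by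
  have := (hz.conv_converges 0).neg
  refine this.congr fun k => ?_
  rw [zero_sub, hz.odd]
  ring

/-- The elements of `D(J)` are the coefficient sequences of functions in `L⁴`. -/
theorem MemDomJ.exists_hasSineCoeff {z : ℤ → ℝ} (hz : MemDomJ z) :
    ∃ F : AddCircle T → ℝ, MemLp F 4 haarAddCircle ∧ HasSineCoeff z F := by
  obtain ⟨F, hF, hFc⟩ := exists_real_memLp_fourierCoeff_eq (T := T)
    (c := fun k => -Complex.I * z k) (by simpa using hz.summable_sq)
    (fun k => by rw [hz.odd]; simp)
  have hc : HasSineCoeff z F := fun k => congrFun hFc k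
  -- Riesz–Fischer yields only `F` in L². The coefficients of `F^2` are `-(z*z)_k`, and their square
  -- summability raises `F^2` from L¹ to L².
  refine ⟨F, memLp_four_of_summable hF ?_, hc⟩
  refine hz.conv_sq_summable.congr fun k => ?_
  rw [(hc.fourierCoeff_sq hF k).2]
  simp

/-- Parity: a sum of three odd integers is odd. -/
theorem convolve_convolve_eq_zero_of_even {z : ℤ → ℝ} (hz : ∀ k, Even k → z k = 0) {k : ℤ}
    (hk : Even k) : convolve (convolve z z) z k = 0 := by
  rw [convolve, ← tsum_zero (α := ℝ) (β := ℤ)]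
  congr 1
  ext l
  rcases Int.even_or_odd l with hl | hl
  · rw [hz _ (hk.sub hl), mul_zero]
  · have : convolve z z l = 0 := by
      rw [convolve, ← tsum_zero (α := ℝ) (β := ℤ)]
      congr 1
      ext m
      rcases Int.even_or_odd m with hm | hm
      · rw [hz _ hm, zero_mul]
      · rw [hz _ (hl.sub_odd hm), mul_zero]
    rw [this, zero_mul]

/-- The sequence with the entries `1` at `k` and `-1` at `-k`. -/
def sineSeq (k : ℤ) : ℤ → ℝ := Pi.single k 1 - Pi.single (-k) 1

/-- From `2 Im e_k = -i (e_k - e_{-k})`. These are the test directions for the Euler-Lagrange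
equation. -/
theorem hasSineCoeff_sineSeq (k : ℤ) :
    HasSineCoeff (sineSeq k) (fun t : AddCircle T => 2 * (fourier k t).im) := by
  intro j
  have h1 : (fun t : AddCircle T => ((2 * (fourier k t).im : ℝ) : ℂ)) =
      fun t => -Complex.I * (fourier k t - fourier (-k) t) := by
    ext t
    rw [fourier_neg, Complex.sub_conj]
    push_cast
    linear_combination (2 * ((fourier k t).im : ℂ)) * Complex.I_sq
  have hi : ∀ k, Integrable (fourier (T := T) k) haarAddCircle := fun k =>
    (map_continuous (fourier k)).integrable_of_hasCompactSupport
      (HasCompactSupport.of_compactSpace _)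
  rw [h1, fourierCoeff.const_mul, fourierCoeff_sub (hi _) (hi _), fourierCoeff_fourier,
    fourierCoeff_fourier, sineSeq]
  congr 1
  simp only [Pi.sub_apply, Pi.single_apply]
  split_ifs <;> simp

theorem memLp_fourier_im (k : ℤ) :
    MemLp (fun t : AddCircle T => 2 * (fourier k t).im) 4 haarAddCircle := by
  refine MemLp.of_bound (by fun_prop) 2 (ae_of_all _ fun t => ?_)
  rw [norm_mul]
  have : ‖(fourier k t).im‖ ≤ 1 := by
    refine (Complex.abs_im_le_norm _).trans ?_
    rw [fourier_apply, Circle.norm_coe]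
  simp only [Real.norm_ofNat]
  linarith

theorem sineSeq_even {k : ℤ} (hk : Odd k) (j : ℤ) (hj : Even j) : sineSeq k j = 0 := by
  have h1 : j ≠ k := by rintro rfl; exact (Int.not_even_iff_odd.2 hk) hj
  have h2 : j ≠ -k := by rintro rfl; exact (Int.not_even_iff_odd.2 hk) ((even_neg).1 hj)
  simp [sineSeq, h1, h2]

end Sequences

/-! ### The energy along lines, first variation and Euler–Lagrange equation. -/

section Energy

open AddCircle

/-- The functional `z ↦ (1/4) (z*z*z*z)₀ + ∑ₖ rₖ zₖ²`. -/
def energy (r z : ℤ → ℝ) : ℝ :=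
  1 / 4 * convolve (convolve z z) (convolve z z) 0 + ∑' k : ℤ, r k * z k ^ 2

theorem integrable_mul_of_memLp_four {α : Type*} [MeasurableSpace α] {μ : Measure α}
    {F G : α → ℝ} (hF : MemLp F 4 μ) (hG : MemLp G 4 μ) :
    Integrable (fun t => F t ^ 3 * G t) μ ∧ Integrable (fun t => F t ^ 2 * G t ^ 2) μ := by
  have hF4 := (memLp_four_iff hF.1).1 hF
  have hG4 := (memLp_four_iff hG.1).1 hG
  refine ⟨(hF4.add hG4).mono' ((hF.1.pow 3).mul hG.1) (ae_of_all _ fun t => ?_),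
    (hF4.add hG4).mono' ((hF.1.pow 2).mul (hG.1.pow 2)) (ae_of_all _ fun t => ?_)⟩
  · simp only [Pi.add_apply, Real.norm_eq_abs]
    rw [abs_le]
    constructor <;> nlinarith [sq_nonneg (F t ^ 2 - G t ^ 2), sq_nonneg (F t - G t),
      sq_nonneg (F t + G t), sq_nonneg (F t ^ 2 + F t * G t), sq_nonneg (F t ^ 2 - F t * G t),
      sq_nonneg (F t * G t)]
  · simp only [Pi.add_apply, Real.norm_eq_abs]
    rw [abs_of_nonneg (by positivity)]
    nlinarith [sq_nonneg (F t ^ 2 - G t ^ 2), sq_nonneg (F t ^ 2), sq_nonneg (G t ^ 2)]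

theorem summable_weight_mul {r x y : ℤ → ℝ} {C : ℝ} (hr : ∀ k, |r k| ≤ C)
    (hx : Summable fun k => x k ^ 2) (hy : Summable fun k => y k ^ 2) :
    Summable fun k => r k * (x k * y k) := by
  refine Summable.of_norm_bounded ((hx.add hy).mul_left C) fun k => ?_
  rw [norm_mul, Real.norm_eq_abs, Real.norm_eq_abs]
  refine mul_le_mul (hr k) ?_ (abs_nonneg _) ((abs_nonneg _).trans (hr k))
  rw [abs_le]
  constructor <;> nlinarith [sq_nonneg (x k + y k), sq_nonneg (x k - y k)]

variable {T : ℝ} [hT : Fact (0 < T)] {r a y : ℤ → ℝ} {C : ℝ} {F G : AddCircle T → ℝ}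

theorem energy_eq (ha : HasSineCoeff a F) (hF : MemLp F 4 haarAddCircle) :
    energy r a = 1 / 4 * ∫ t, F t ^ 4 ∂haarAddCircle + ∑' k, r k * a k ^ 2 := by
  rw [energy, ha.convolve_convolve_zero hF]

/-- The first variation of `energy r` at `a` in the direction `y`. -/
def firstVariation (r a y : ℤ → ℝ) (F G : AddCircle T → ℝ) : ℝ :=
  ∫ t, F t ^ 3 * G t ∂haarAddCircle + 2 * ∑' k, r k * (a k * y k)

/-- The energy restricted to a line is an exact quartic polynomial. Its linear term gives the
Euler-Lagrange equation, and the higher terms bound the remainder in the converse from vanishing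
first variations to Fréchet criticality. -/
theorem energy_add_smul (hr : ∀ k, |r k| ≤ C) (ha : HasSineCoeff a F)
    (hF : MemLp F 4 haarAddCircle) (hy : HasSineCoeff y G) (hG : MemLp G 4 haarAddCircle) (s : ℝ) :
    energy r (a + s • y) = energy r a + s * firstVariation r a y F G +
      s ^ 2 * (3 / 2 * ∫ t, F t ^ 2 * G t ^ 2 ∂haarAddCircle + ∑' k, r k * y k ^ 2) +
      s ^ 3 * ∫ t, G t ^ 3 * F t ∂haarAddCircle + s ^ 4 * (1 / 4 * ∫ t, G t ^ 4 ∂haarAddCircle) := by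
  have hF2 := memLp_two_of_four hF
  have hG2 := memLp_two_of_four hG
  have hadd := ha.add (hy.smul s) (hF2.integrable one_le_two)
    ((hG2.integrable one_le_two).const_mul s)
  rw [energy_eq hadd (hF.add (hG.const_mul s)), energy_eq ha hF, firstVariation]
  have i1 := (memLp_four_iff hF.1).1 hF
  have i2 := (integrable_mul_of_memLp_four hF hG).1
  have i3 := (integrable_mul_of_memLp_four hF hG).2
  have i4 := (integrable_mul_of_memLp_four hG hF).1
  have i5 := (memLp_four_iff hG.1).1 hG
  have e1 : ∫ t, (F t + s * G t) ^ 4 ∂haarAddCircle = ∫ t, F t ^ 4 ∂haarAddCircle +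
      4 * s * ∫ t, F t ^ 3 * G t ∂haarAddCircle + 6 * s ^ 2 * ∫ t, F t ^ 2 * G t ^ 2 ∂haarAddCircle +
      4 * s ^ 3 * ∫ t, G t ^ 3 * F t ∂haarAddCircle + s ^ 4 * ∫ t, G t ^ 4 ∂haarAddCircle := by
    have j2 := i1.fun_add (i2.const_mul (4 * s))
    have j3 := j2.fun_add (i3.const_mul (6 * s ^ 2))
    have j4 := j3.fun_add (i4.const_mul (4 * s ^ 3))
    rw [← integral_const_mul, ← integral_const_mul, ← integral_const_mul, ← integral_const_mul,
      ← integral_add i1 (i2.const_mul _), ← integral_add j2 (i3.const_mul _),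
      ← integral_add j3 (i4.const_mul _), ← integral_add j4 (i5.const_mul _)]
    refine integral_congr_ae (ae_of_all _ fun t => ?_)
    ring
  have sa := (ha.hasSum_sq hF2).summable
  have sy := (hy.hasSum_sq hG2).summable
  have s1 := summable_weight_mul hr sa sa
  have s2 := summable_weight_mul hr sa sy
  have s3 := summable_weight_mul hr sy sy
  have e2 : ∑' k, r k * (a + s • y) k ^ 2 = ∑' k, r k * a k ^ 2 +
      2 * s * ∑' k, r k * (a k * y k) + s ^ 2 * ∑' k, r k * y k ^ 2 := by
    simp only [pow_two (a _), pow_two (y _)]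
    rw [← tsum_mul_left, ← tsum_mul_left, ← s1.tsum_add (s2.mul_left _),
      ← (s1.add (s2.mul_left _)).tsum_add (s3.mul_left _)]
    congr 1
    ext k
    simp only [Pi.add_apply, Pi.smul_apply, smul_eq_mul]
    ring
  rw [e1, e2]
  ring

theorem hasDerivAt_energy (hr : ∀ k, |r k| ≤ C) (ha : HasSineCoeff a F)
    (hF : MemLp F 4 haarAddCircle) (hy : HasSineCoeff y G) (hG : MemLp G 4 haarAddCircle) :
    HasDerivAt (fun s : ℝ => energy r (a + s • y)) (firstVariation r a y F G) 0 := by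
  have : (fun s : ℝ => energy r (a + s • y)) = _ :=
    funext fun s => energy_add_smul hr ha hF hy hG s
  rw [this]
  generalize firstVariation r a y F G = A
  generalize (3 / 2 * ∫ t, F t ^ 2 * G t ^ 2 ∂haarAddCircle + ∑' k, r k * y k ^ 2) = B
  generalize ∫ t, G t ^ 3 * F t ∂haarAddCircle = D
  generalize (1 / 4 * ∫ t, G t ^ 4 ∂haarAddCircle) = E
  have h := (((((hasDerivAt_id (0 : ℝ)).mul_const A).const_add (energy r a)).add
    ((hasDerivAt_pow 2 (0 : ℝ)).mul_const B)).add ((hasDerivAt_pow 3 (0 : ℝ)).mul_const D)).add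
    ((hasDerivAt_pow 4 (0 : ℝ)).mul_const E)
  refine h.congr_deriv ?_
  simp

/-- `energy r` has vanishing Fréchet derivative at `a` on `D(J)`. -/
def EnergyCritical (r a : ℤ → ℝ) : Prop :=
  MemDomJ a ∧ ∀ ε > 0, ∃ δ > 0, ∀ y : ℤ → ℝ, MemDomJ y → normJ y < δ →
    |energy r (a + y) - energy r a| ≤ ε * normJ y

theorem normJ_nonneg (z : ℤ → ℝ) : 0 ≤ normJ z := Real.sqrt_nonneg _

theorem normJ_smul (hy : HasSineCoeff y G) (hG : MemLp G 4 haarAddCircle) (s : ℝ) :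
    normJ (s • y) = |s| * normJ y := by
  have h1 := (hy.smul s).normJ_pow_four (hG.const_mul s)
  have h2 := hy.normJ_pow_four hG
  simp only [mul_pow] at h1
  rw [integral_const_mul, ← h2, ← Even.pow_abs (by decide) s, ← mul_pow] at h1
  exact (pow_left_inj₀ (normJ_nonneg _) (mul_nonneg (abs_nonneg _) (normJ_nonneg _))
    (by norm_num)).1 h1

/-- Fréchet criticality forces the derivative `0` along every line, and derivatives are unique. -/
theorem firstVariation_eq_zero (hr : ∀ k, |r k| ≤ C) (hcrit : EnergyCritical r a)
    (ha : HasSineCoeff a F) (hF : MemLp F 4 haarAddCircle) (hy : HasSineCoeff y G)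
    (hG : MemLp G 4 haarAddCircle) (hye : ∀ k, Even k → y k = 0) :
    firstVariation r a y F G = 0 := by
  have h := hasDerivAt_energy hr ha hF hy hG
  have h0 : HasDerivAt (fun s : ℝ => energy r (a + s • y)) 0 0 := by
    rw [hasDerivAt_iff_isLittleO, Asymptotics.isLittleO_iff]
    intro c hc
    have hn := normJ_nonneg y
    -- Adding `1` keeps the division meaningful when `normJ y = 0`.
    obtain ⟨δ, hδ, H⟩ := hcrit.2 (c / (normJ y + 1)) (by positivity)
    have : ∀ᶠ s : ℝ in 𝓝 0, |s| < δ / (normJ y + 1) := by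
      have hc : Tendsto (fun s : ℝ => |s|) (𝓝 0) (𝓝 0) := by
        simpa using (continuous_abs (G := ℝ)).tendsto 0
      exact hc.eventually_lt_const (by positivity)
    filter_upwards [this] with s hs
    rw [lt_div_iff₀ (by positivity)] at hs
    have hsy := H (s • y) ((hy.smul s).memDomJ (hG.const_mul s) fun k hk => by simp [hye k hk])
      (by rw [normJ_smul hy hG]; nlinarith [abs_nonneg s])
    simp only [zero_smul, add_zero, sub_zero, smul_zero, Real.norm_eq_abs]
    refine hsy.trans ?_
    rw [normJ_smul hy hG, div_mul_eq_mul_div, div_le_iff₀ (by positivity)]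
    nlinarith [mul_nonneg hc.le (abs_nonneg s)]
  exact h.unique h0

/-- The Euler--Lagrange equation of `energy r`. -/
theorem fourierCoeff_cube_of_critical (hr : ∀ k, |r k| ≤ C) (hre : ∀ k, r (-k) = r k)
    (hcrit : EnergyCritical r a) (ha : HasSineCoeff a F) (hF : MemLp F 4 haarAddCircle) :
    HasSineCoeff (fun k => -2 * r k * a k) (fun t => F t ^ 3) := by
  intro k
  rw [ha.fourierCoeff_cube hF k]
  rcases Int.even_or_odd k with hk | hk
  · simp [convolve_convolve_eq_zero_of_even hcrit.1.support_odd hk, hcrit.1.support_odd k hk]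
  -- The mode `2 Im e_k` isolates the coefficient of `F^3` at `k`. At even `k` no admissible
  -- direction exists, but there both sides vanish by parity.
  have h := firstVariation_eq_zero hr hcrit ha hF (hasSineCoeff_sineSeq k) (memLp_fourier_im k)
    (sineSeq_even hk)
  have hk0 : k ≠ -k := by
    intro h'
    have : k = 0 := by omega
    rw [this] at hk
    exact absurd hk (by decide)
  have hs : ∑' j, r j * (a j * sineSeq k j) = 2 * r k * a k := by
    rw [tsum_eq_sum (s := {k, -k})]
    · rw [Finset.sum_pair hk0, hre, ha.odd]
      simp [sineSeq, hk0, hk0.symm]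
      ring
    · intro j hj
      simp only [Finset.mem_insert, Finset.mem_singleton, not_or] at hj
      simp [sineSeq, hj.1, hj.2]
  rw [firstVariation, hs] at h
  have hc := ha.fourierCoeff_cube hF k
  have him := congrArg Complex.im hc
  simp only [Complex.mul_im, Complex.I_re, Complex.I_im, Complex.ofReal_re, Complex.ofReal_im,
    mul_zero, one_mul, zero_add] at him
  have hint : Integrable (fun t => ((F t ^ 3 : ℝ) : ℂ)) haarAddCircle := by
    have h3 : Integrable (fun t => F t ^ 3) haarAddCircle := by
      simpa using (integrable_mul_of_memLp_four hF (memLp_const (1 : ℝ))).1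
    exact h3.ofReal
  have h5 : (fourierCoeff (fun t => ((F t ^ 3 : ℝ) : ℂ)) k).im =
      -∫ t, F t ^ 3 * (fourier k t).im ∂haarAddCircle := by
    rw [fourierCoeff, ← integral_neg]
    have := integral_im (hint.fourier_smul (-k))
    simp only [RCLike.im_eq_complex_im] at this
    rw [← this]
    refine integral_congr_ae (ae_of_all _ fun t => ?_)
    simp only [smul_eq_mul, fourier_neg, Complex.mul_im, Complex.ofReal_re, Complex.ofReal_im,
      Complex.conj_im]
    ring
  have h6 : ∫ t, F t ^ 3 * (2 * (fourier k t).im) ∂haarAddCircle =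
      2 * ∫ t, F t ^ 3 * (fourier k t).im ∂haarAddCircle := by
    rw [← integral_const_mul]
    congr 1; ext t; ring
  rw [h6] at h
  have : convolve (convolve a a) a k = 2 * r k * a k := by
    rw [← him, h5]; linarith
  rw [this]
  push_cast; ring

theorem abs_tsum_weight_le (hr : ∀ k, |r k| ≤ C) (hy : HasSineCoeff y G)
    (hG : MemLp G 2 haarAddCircle) :
    |∑' k, r k * y k ^ 2| ≤ C * ∫ t, G t ^ 2 ∂haarAddCircle := by
  have h := hy.hasSum_sq hG
  rw [← h.tsum_eq, ← tsum_mul_left]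
  have hs : ∀ k, ‖r k * y k ^ 2‖ ≤ C * y k ^ 2 := fun k => by
    rw [norm_mul, norm_pow, Real.norm_eq_abs, Real.norm_eq_abs, sq_abs]
    exact mul_le_mul_of_nonneg_right (hr k) (sq_nonneg _)
  exact tsum_of_norm_bounded (h.summable.mul_left C).hasSum hs

/-- Cauchy–Schwarz by the discriminant of a nonnegative quadratic; bounds on the squares avoid
explicit roots of integrals. -/
theorem abs_integral_mul_le {α : Type*} [MeasurableSpace α] {μ : Measure α} {A B : α → ℝ}
    (hA : MemLp A 2 μ) (hB : MemLp B 2 μ) (x z : ℝ) (hx : 0 ≤ x) (hz : 0 ≤ z)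
    (h1 : ∫ t, A t ^ 2 ∂μ ≤ x ^ 2) (h2 : ∫ t, B t ^ 2 ∂μ ≤ z ^ 2) :
    |∫ t, A t * B t ∂μ| ≤ x * z := by
  have iA := hA.integrable_sq
  have iB := hB.integrable_sq
  have iAB : Integrable (fun t => A t * B t) μ := hA.integrable_mul hB
  have q : ∀ s : ℝ, 0 ≤ x ^ 2 * (s * s) + (2 * ∫ t, A t * B t ∂μ) * s + z ^ 2 := by
    intro s
    have : 0 ≤ ∫ t, (s * A t + B t) ^ 2 ∂μ := integral_nonneg fun t => sq_nonneg _
    have e : ∫ t, (s * A t + B t) ^ 2 ∂μ =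
        s ^ 2 * ∫ t, A t ^ 2 ∂μ + 2 * s * ∫ t, A t * B t ∂μ + ∫ t, B t ^ 2 ∂μ := by
      rw [← integral_const_mul, ← integral_const_mul,
        ← integral_add (iA.const_mul _) (iAB.const_mul _),
        ← integral_add ((iA.const_mul _).fun_add (iAB.const_mul _)) iB]
      refine integral_congr_ae (ae_of_all _ fun t => ?_)
      ring
    nlinarith [sq_nonneg s, mul_le_mul_of_nonneg_left h1 (sq_nonneg s)]
  have := discrim_le_zero q
  rw [discrim] at this
  exact abs_le_of_sq_le_sq (by nlinarith) (mul_nonneg hx hz)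

/-- A point of `D(J)` at which all first variations vanish is critical. -/
theorem energyCritical_of_firstVariation (hr : ∀ k, |r k| ≤ C) (ha : HasSineCoeff a F)
    (hF : MemLp F 4 haarAddCircle) (hae : ∀ k, Even k → a k = 0)
    (h : ∀ (y : ℤ → ℝ) (G : AddCircle T → ℝ), HasSineCoeff y G → MemLp G 4 haarAddCircle →
      (∀ k, Even k → y k = 0) → firstVariation r a y F G = 0) : EnergyCritical r a := by
  refine ⟨ha.memDomJ hF hae, ?_⟩
  have hC : 0 ≤ C := (abs_nonneg _).trans (hr 0)
  set N := ∫ t, F t ^ 4 ∂(haarAddCircle (T := T)) with hN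
  have hN0 : 0 ≤ N := integral_nonneg fun t => by positivity
  -- Once the linear term vanishes, the increment is quadratic in `normJ y` on the unit ball, hence
  -- of smaller order than the norm.
  have key : ∀ y : ℤ → ℝ, MemDomJ y → normJ y ≤ 1 →
      |energy r (a + y) - energy r a| ≤ (2 * (N + 1) + C + 2) * normJ y ^ 2 := by
    intro y hyD hy1
    obtain ⟨G, hG, hy⟩ := hyD.exists_hasSineCoeff (T := T)
    have hn := normJ_nonneg y
    have h4 := hy.normJ_pow_four hG
    have hE := energy_add_smul hr ha hF hy hG 1
    rw [one_smul, h y G hy hG hyD.support_odd] at hE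
    set δ := normJ y with hδ
    have i1 := (memLp_four_iff hF.1).1 hF
    have i3 := (integrable_mul_of_memLp_four hF hG).2
    have i4 := (integrable_mul_of_memLp_four hG hF).1
    have i5 := (memLp_four_iff hG.1).1 hG
    have hG2 := memLp_two_of_four hG
    have m1 : MemLp (fun t => F t ^ 2) 2 haarAddCircle := (memLp_sq_two_iff hF.1).2 hF
    have m2 : MemLp (fun t => G t ^ 2) 2 haarAddCircle := (memLp_sq_two_iff hG.1).2 hG
    have b2 : |∫ t, G t ^ 2 ∂haarAddCircle| ≤ δ ^ 2 := by
      have := abs_integral_mul_le m2 (memLp_const (1 : ℝ)) (δ ^ 2) 1 (sq_nonneg _) zero_le_one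
        (by simp only [← pow_mul]; exact h4.ge) (by simp)
      simpa using this
    -- The root of `N` is replaced by `N + 1`, using `N ≤ (N + 1)²`.
    have b1 : |∫ t, F t ^ 2 * G t ^ 2 ∂haarAddCircle| ≤ (N + 1) * δ ^ 2 := by
      refine abs_integral_mul_le m1 m2 (N + 1) (δ ^ 2) (by linarith) (sq_nonneg _) ?_
        (by simp only [← pow_mul]; exact h4.ge)
      simp only [← pow_mul]
      norm_num
      rw [← hN]
      nlinarith
    have b3 : |∫ t, G t ^ 3 * F t ∂haarAddCircle| ≤
        1 / 2 * (δ ^ 4 + (N + 1) * δ ^ 2) := by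
      have hle : ∀ t, ‖G t ^ 3 * F t‖ ≤ 1 / 2 * (G t ^ 4 + F t ^ 2 * G t ^ 2) := by
        intro t
        rw [Real.norm_eq_abs, abs_le]
        constructor <;> nlinarith [sq_nonneg (G t ^ 2 + F t * G t), sq_nonneg (G t ^ 2 - F t * G t)]
      have h := norm_integral_le_of_norm_le ((i5.add i3).const_mul (1 / 2)) (ae_of_all _ hle)
      rw [Real.norm_eq_abs, integral_const_mul, integral_add' i5 i3] at h
      rw [← h4] at h
      linarith [le_abs_self (∫ t, F t ^ 2 * G t ^ 2 ∂(haarAddCircle (T := T)))]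
    have b4 := abs_tsum_weight_le hr hy hG2
    have b5 : C * ∫ t, G t ^ 2 ∂haarAddCircle ≤ C * δ ^ 2 :=
      mul_le_mul_of_nonneg_left ((le_abs_self _).trans b2) hC
    have b6 : δ ^ 4 ≤ δ ^ 2 := by
      have : δ ^ 2 ≤ 1 := by nlinarith
      nlinarith [sq_nonneg δ]
    rw [hE, ← h4]
    rw [abs_le] at b1 b3 b4 ⊢
    constructor <;> nlinarith [sq_nonneg δ]
  intro ε hε
  set K := 2 * (N + 1) + C + 2 with hK
  have hK0 : 0 < K := by positivity
  refine ⟨min 1 (ε / K), by positivity, fun y hyD hlt => ?_⟩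
  have hn := normJ_nonneg y
  have h2 : normJ y * K ≤ ε := ((lt_div_iff₀ hK0).1 (hlt.trans_le (min_le_right _ _))).le
  refine (key y hyD (hlt.le.trans (min_le_left _ _))).trans ?_
  nlinarith

end Energy

/-! ### Compactness, coercivity and uniform convexity. -/

section Minimizer

open AddCircle

theorem norm_toLp_pow_four {α : Type*} [MeasurableSpace α] {μ : Measure α} {F : α → ℝ}
    (hF : MemLp F 4 μ) : ‖hF.toLp‖ ^ 4 = ∫ t, F t ^ 4 ∂μ := by
  have h4 : (4 : ℝ≥0∞).toReal = (4 : ℕ) := by norm_num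
  have e : ∫ t, ‖F t‖ ^ (4 : ℝ≥0∞).toReal ∂μ = ∫ t, F t ^ 4 ∂μ := by
    refine integral_congr_ae (ae_of_all _ fun t => ?_)
    simp only [h4, Real.rpow_natCast, Real.norm_eq_abs]
    exact Even.pow_abs (by decide) _
  have h0 : 0 ≤ ∫ t, F t ^ 4 ∂μ := integral_nonneg fun t => by positivity
  rw [Lp.norm_toLp, hF.eLpNorm_eq_integral_rpow_norm (by norm_num) (by norm_num), e,
    ENNReal.toReal_ofReal (by positivity), h4, Real.rpow_inv_natCast_pow h0 (by norm_num)]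

/-- Outside a finite set `|r k|` is small and the uniform ℓ¹ bound controls the tail; on the finite
set coordinatewise convergence suffices. -/
theorem tendsto_tsum_weight_mul {ι : Type*} {l : Filter ι} {r : ℤ → ℝ} {d : ι → ℤ → ℝ} {B : ℝ}
    (hr : Tendsto r cofinite (𝓝 0)) (hd : ∀ k, Tendsto (fun i => d i k) l (𝓝 0))
    (hs : ∀ i, Summable fun k => |d i k|) (hB : ∀ i, ∑' k, |d i k| ≤ B) :
    Tendsto (fun i => ∑' k, r k * d i k) l (𝓝 0) := by
  rw [Metric.tendsto_nhds]
  intro ε hε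
  have hB1 : 0 < |B| + 1 := by positivity
  set η := ε / (2 * (|B| + 1)) with hη
  have hη0 : 0 < η := by positivity
  have hfin : {k | ¬ |r k| < η}.Finite := by
    have := hr.eventually (Metric.ball_mem_nhds 0 hη0)
    rw [Filter.eventually_cofinite] at this
    simpa only [Metric.mem_ball, dist_zero_right, Real.norm_eq_abs] using this
  set s := hfin.toFinset with hsdef
  have hT : Tendsto (fun i => ∑ k ∈ s, |r k| * |d i k|) l (𝓝 0) := by
    have : Tendsto (fun i => ∑ k ∈ s, |r k| * |d i k|) l (𝓝 (∑ k ∈ s, |r k| * |(0 : ℝ)|)) :=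
      tendsto_finsetSum _ fun k _ => ((hd k).abs).const_mul _
    simpa using this
  filter_upwards [hT.eventually_lt_const (half_pos hε)] with i hi
  rw [Real.dist_eq, sub_zero]
  have hsum : HasSum (fun k => (if k ∈ s then |r k| * |d i k| else 0) + η * |d i k|)
      (∑ k ∈ s, |r k| * |d i k| + η * ∑' k, |d i k|) := by
    refine HasSum.add ?_ ((hs i).hasSum.mul_left _)
    have := hasSum_sum_of_ne_finset_zero (L := .unconditional ℤ) (f := fun k => if k ∈ s then |r k| * |d i k| else 0)
      (s := s) (fun k hk => by simp [hk])
    rwa [Finset.sum_congr rfl (g := fun k => |r k| * |d i k|) (fun k hk => by simp [hk])] at this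
  have hle : |∑' k, r k * d i k| ≤ ∑ k ∈ s, |r k| * |d i k| + η * ∑' k, |d i k| := by
    refine tsum_of_norm_bounded (f := fun k => r k * d i k) hsum fun k => ?_
    rw [norm_mul, Real.norm_eq_abs, Real.norm_eq_abs]
    by_cases hk : k ∈ s
    · simp only [hk, if_true]
      have := mul_nonneg hη0.le (abs_nonneg (d i k))
      linarith
    · simp only [hk, if_false, zero_add]
      have : |r k| < η := by simpa [hsdef] using hk
      exact mul_le_mul_of_nonneg_right this.le (abs_nonneg _)
  have h1 : η * ∑' k, |d i k| ≤ η * |B| :=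
    mul_le_mul_of_nonneg_left ((hB i).trans (le_abs_self _)) hη0.le
  have h2 : η * (2 * (|B| + 1)) = ε := by rw [hη]; field_simp
  nlinarith

variable {T : ℝ} [hT : Fact (0 < T)] {r a b : ℤ → ℝ} {C : ℝ} {F G : AddCircle T → ℝ}

/-- Coercivity: completing the square in `(F² - 4C)²` gives `C F² ≤ F⁴/8 + 2C²`, so half of the
quartic part survives. -/
theorem energy_lower_bound (hr : ∀ k, |r k| ≤ C) (ha : HasSineCoeff a F)
    (hF : MemLp F 4 haarAddCircle) :
    1 / 8 * ∫ t, F t ^ 4 ∂haarAddCircle - 2 * C ^ 2 ≤ energy r a := by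
  have h2 := memLp_two_of_four hF
  have h := (abs_le.1 (abs_tsum_weight_le hr ha h2)).1
  have i4 := (memLp_four_iff hF.1).1 hF
  have : C * ∫ t, F t ^ 2 ∂haarAddCircle ≤
      1 / 8 * ∫ t, F t ^ 4 ∂haarAddCircle + 2 * C ^ 2 := by
    have h3 : ∫ t, C * F t ^ 2 ∂(haarAddCircle (T := T)) ≤
        ∫ t, (1 / 8 * F t ^ 4 + 2 * C ^ 2) ∂(haarAddCircle (T := T)) :=
      integral_mono (h2.integrable_sq.const_mul _)
        ((i4.const_mul _).add (integrable_const _)) fun t => by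
          simp only
          nlinarith [sq_nonneg (F t ^ 2 - 4 * C)]
    rw [integral_const_mul, integral_add (i4.const_mul _) (integrable_const _),
      integral_const_mul] at h3
    simpa using h3
  rw [energy_eq ha hF]
  linarith

/-- A quantitative convexity estimate, from Clarkson's inequality in `L⁴`. -/
theorem integral_sub_pow_four_le (hr : ∀ k, |r k| ≤ C) (ha : HasSineCoeff a F)
    (hF : MemLp F 4 haarAddCircle) (hb : HasSineCoeff b G) (hG : MemLp G 4 haarAddCircle) :
    ∫ t, (F t - G t) ^ 4 ∂haarAddCircle ≤
      64 * ((energy r a + energy r b) / 2 - energy r ((1 / 2 : ℝ) • (a + b)) -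
        1 / 4 * ∑' k, r k * (a k - b k) ^ 2) := by
  have hF2 := memLp_two_of_four hF
  have hG2 := memLp_two_of_four hG
  have hadd := (ha.add hb (hF2.integrable one_le_two) (hG2.integrable one_le_two)).smul (1 / 2)
  have m1 : MemLp (fun t => 1 / 2 * (F t + G t)) 4 haarAddCircle := (hF.add hG).const_mul _
  have m2 : MemLp (fun t => F t - G t) 4 haarAddCircle := hF.sub hG
  have i1 := (memLp_four_iff hF.1).1 hF
  have i2 := (memLp_four_iff hG.1).1 hG
  have i3 := (memLp_four_iff m1.1).1 m1
  have i4 := (memLp_four_iff m2.1).1 m2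
  -- Pointwise this inequality reduces to `(F² - G²)² ≥ 0`. The factor `1/16`, times the `1/4` in
  -- the energy, produces the constant `64`; the quadratic part obeys the exact parallelogram
  -- identity.
  have h1 : ∫ t, (1 / 2 * (F t + G t)) ^ 4 ∂(haarAddCircle (T := T)) +
      1 / 16 * ∫ t, (F t - G t) ^ 4 ∂(haarAddCircle (T := T)) ≤
      1 / 2 * (∫ t, F t ^ 4 ∂(haarAddCircle (T := T)) +
        ∫ t, G t ^ 4 ∂(haarAddCircle (T := T))) := by
    rw [← integral_add i1 i2, ← integral_const_mul, ← integral_const_mul,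
      ← integral_add i3 (i4.const_mul _)]
    refine integral_mono (i3.add (i4.const_mul _)) ((i1.add i2).const_mul _) fun t => ?_
    simp only
    nlinarith [sq_nonneg (F t ^ 2 - G t ^ 2)]
  have sa := (ha.hasSum_sq hF2).summable
  have sb := (hb.hasSum_sq hG2).summable
  have s1 := summable_weight_mul hr sa sa
  have s2 := summable_weight_mul hr sa sb
  have s3 := summable_weight_mul hr sb sb
  have e1 : ∑' k, r k * ((1 / 2 : ℝ) • (a + b)) k ^ 2 =
      1 / 4 * ∑' k, r k * (a k * a k) + 1 / 2 * ∑' k, r k * (a k * b k) +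
        1 / 4 * ∑' k, r k * (b k * b k) := by
    rw [← tsum_mul_left, ← tsum_mul_left, ← tsum_mul_left,
      ← (s1.mul_left _).tsum_add (s2.mul_left _),
      ← ((s1.mul_left _).add (s2.mul_left _)).tsum_add (s3.mul_left _)]
    congr 1
    ext k
    simp only [Pi.add_apply, Pi.smul_apply, smul_eq_mul]
    ring
  have e2 : ∑' k, r k * (a k - b k) ^ 2 =
      ∑' k, r k * (a k * a k) + -2 * ∑' k, r k * (a k * b k) + ∑' k, r k * (b k * b k) := by
    rw [← tsum_mul_left, ← s1.tsum_add (s2.mul_left _),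
      ← (s1.add (s2.mul_left _)).tsum_add s3]
    congr 1
    ext k
    ring
  rw [energy_eq ha hF, energy_eq hb hG, energy_eq hadd m1, e1, e2]
  simp only [pow_two (a _), pow_two (b _)]
  linarith

theorem norm_fourierCoeff_le {p : ℝ≥0∞} [Fact (1 ≤ p)] (hF : MemLp F p haarAddCircle) (k : ℤ) :
    ‖fourierCoeff (fun t => (F t : ℂ)) k‖ ≤ ‖hF.toLp‖ := by
  have h1 : ‖fourierCoeff (fun t => (F t : ℂ)) k‖ ≤ ∫ t, ‖F t‖ ∂haarAddCircle := by
    refine norm_integral_le_of_norm_le (hF.integrable Fact.out).norm (ae_of_all _ fun t => ?_)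
    rw [norm_smul, fourier_apply, Circle.norm_coe, one_mul, Complex.norm_real]
  refine h1.trans ?_
  rw [Lp.norm_toLp, integral_norm_eq_lintegral_enorm hF.1, ← eLpNorm_one_eq_lintegral_enorm]
  exact ENNReal.toReal_mono hF.eLpNorm_ne_top
    (eLpNorm_le_eLpNorm_of_exponent_le Fact.out hF.1)

end Minimizer

/-! ### Existence of a nonzero minimiser. -/

section Existence

open AddCircle

variable {r : ℤ → ℝ} {C : ℝ}

/-- Direct method with strong convergence: midpoints have energy at least the infimum, so Clarkson's
estimate makes a minimising sequence Cauchy in L⁴, up to the compact quadratic part. -/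
theorem exists_energy_min (hr : ∀ k, |r k| ≤ C) (hr0 : Tendsto r cofinite (𝓝 0)) :
    ∃ α : ℤ → ℝ, MemDomJ α ∧ ∀ z, MemDomJ z → energy r α ≤ energy r z := by
  -- The energy is defined on sequences, so the period of the auxiliary circle is immaterial.
  have hfact : Fact ((0 : ℝ) < 1) := ⟨one_pos⟩
  have hfact4 : Fact ((1 : ℝ≥0∞) ≤ 4) := ⟨by norm_num⟩
  have hzero : MemDomJ 0 := by
    have h : HasSineCoeff 0 (fun _ : AddCircle (1 : ℝ) => (0 : ℝ)) := fun k => by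
      simp [fourierCoeff]
    exact h.memDomJ MemLp.zero' fun _ _ => rfl
  set S : Set ℝ := energy r '' {z | MemDomJ z} with hS
  have hne : S.Nonempty := ⟨_, 0, hzero, rfl⟩
  have hbdd : BddBelow S := by
    refine ⟨-(2 * C ^ 2), ?_⟩
    rintro _ ⟨z, hz, rfl⟩
    obtain ⟨F, hF, hz'⟩ := MemDomJ.exists_hasSineCoeff (T := 1) hz
    have := energy_lower_bound hr hz' hF
    have h0 : 0 ≤ ∫ t, F t ^ 4 ∂(haarAddCircle (T := 1)) := integral_nonneg fun t => by positivity
    linarith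
  obtain ⟨u, hanti, hlim, hu⟩ := exists_seq_tendsto_sInf hne hbdd
  choose z hzD hzu using hu
  choose F hF hzF using fun n => MemDomJ.exists_hasSineCoeff (T := 1) (hzD n)
  set B := 8 * (u 0 + 2 * C ^ 2) with hBdef
  have hN : ∀ n, ∫ t, F n t ^ 4 ∂(haarAddCircle (T := 1)) ≤ B := by
    intro n
    have h1 := energy_lower_bound hr (hzF n) (hF n)
    have h2 := hanti (Nat.zero_le n)
    rw [hzu] at h1
    linarith
  have hF2 := fun n => memLp_two_of_four (hF n)
  have hsq : ∀ n, ∑' k, z n k ^ 2 ≤ B + 1 := by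
    intro n
    rw [((hzF n).hasSum_sq (hF2 n)).tsum_eq]
    have i4 := (memLp_four_iff (hF n).1).1 (hF n)
    have : ∫ t, F n t ^ 2 ∂(haarAddCircle (T := 1)) ≤
        ∫ t, (F n t ^ 4 + 1) ∂(haarAddCircle (T := 1)) :=
      integral_mono (hF2 n).integrable_sq (i4.add (integrable_const _)) fun t => by
        simp only
        nlinarith [sq_nonneg (F n t ^ 2 - 1)]
    rw [integral_add i4 (integrable_const _)] at this
    simp only [integral_const, probReal_univ, smul_eq_mul, mul_one] at this
    linarith [hN n]
  -- The ℓ² bound confines every coordinate to a fixed interval, and the countable product of these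
  -- intervals is compact.
  have hcomp : IsCompact (Set.univ.pi fun _ : ℤ => Set.Icc (-(B + 2)) (B + 2)) :=
    isCompact_univ_pi fun _ => isCompact_Icc
  obtain ⟨α, -, φ, hφ, hα⟩ := hcomp.tendsto_subseq (x := z) (by
    intro n k _
    have h1 : z n k ^ 2 ≤ B + 1 :=
      ((hzD n).summable_sq.le_tsum k fun j _ => sq_nonneg _).trans (hsq n)
    have hB0 : 0 ≤ B + 1 := (sq_nonneg _).trans h1
    constructor <;> nlinarith)
  rw [tendsto_pi_nhds] at hα
  have hcauchy : CauchySeq fun n => (hF (φ n)).toLp := by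
    rw [cauchySeq_iff_tendsto_dist_atTop_0]
    have hdist : ∀ p : ℕ × ℕ, dist (hF (φ p.1)).toLp (hF (φ p.2)).toLp ^ 4 =
        ∫ t, (F (φ p.1) t - F (φ p.2) t) ^ 4 ∂(haarAddCircle (T := 1)) := by
      intro p
      rw [dist_eq_norm, ← MemLp.toLp_sub, norm_toLp_pow_four]
      rfl
    -- The quadratic part may be indefinite, but it vanishes in the limit, since differences tend to
    -- `0` coordinatewise with bounded ℓ² norm.
    have hQ : Tendsto (fun p : ℕ × ℕ => ∑' k, r k * (z (φ p.1) k - z (φ p.2) k) ^ 2)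
        atTop (𝓝 0) := by
      refine tendsto_tsum_weight_mul (B := 4 * (B + 1)) hr0 (fun k => ?_) (fun p => ?_)
        (fun p => ?_)
      · have h1 : Tendsto (fun p : ℕ × ℕ => z (φ p.1) k) atTop (𝓝 (α k)) := by
          rw [← prod_atTop_atTop_eq]; exact (hα k).comp tendsto_fst
        have h2 : Tendsto (fun p : ℕ × ℕ => z (φ p.2) k) atTop (𝓝 (α k)) := by
          rw [← prod_atTop_atTop_eq]; exact (hα k).comp tendsto_snd
        simpa using (h1.sub h2).pow 2
      all_goals
        have hb : ∀ k, |(z (φ p.1) k - z (φ p.2) k) ^ 2| ≤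
            2 * (z (φ p.1) k ^ 2 + z (φ p.2) k ^ 2) := fun k => by
          rw [abs_of_nonneg (sq_nonneg _)]
          nlinarith [sq_nonneg (z (φ p.1) k + z (φ p.2) k)]
        have hs := ((hzD (φ p.1)).summable_sq.add (hzD (φ p.2)).summable_sq).mul_left 2
        have hs' := Summable.of_nonneg_of_le (fun k => abs_nonneg _) hb hs
      · exact hs'
      · refine (hs'.tsum_le_tsum hb hs).trans ?_
        rw [tsum_mul_left, (hzD (φ p.1)).summable_sq.tsum_add (hzD (φ p.2)).summable_sq]
        linarith [hsq (φ p.1), hsq (φ p.2)]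
    have hu1 : Tendsto (fun n => u (φ n)) atTop (𝓝 (sInf S)) := hlim.comp hφ.tendsto_atTop
    have hbound : Tendsto (fun p : ℕ × ℕ => 64 * ((u (φ p.1) + u (φ p.2)) / 2 - sInf S -
        1 / 4 * ∑' k, r k * (z (φ p.1) k - z (φ p.2) k) ^ 2)) atTop (𝓝 0) := by
      have h1 : Tendsto (fun p : ℕ × ℕ => u (φ p.1)) atTop (𝓝 (sInf S)) := by
        rw [← prod_atTop_atTop_eq]; exact hu1.comp tendsto_fst
      have h2 : Tendsto (fun p : ℕ × ℕ => u (φ p.2)) atTop (𝓝 (sInf S)) := by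
        rw [← prod_atTop_atTop_eq]; exact hu1.comp tendsto_snd
      have := (((((h1.add h2).div_const 2).sub_const (sInf S)).sub (hQ.const_mul (1 / 4))).const_mul
        64)
      convert this using 2
      ring
    have h4 : Tendsto (fun p : ℕ × ℕ => dist (hF (φ p.1)).toLp (hF (φ p.2)).toLp ^ 4) atTop
        (𝓝 0) := by
      refine squeeze_zero (fun p => by positivity) (fun p => ?_) hbound
      rw [hdist]
      refine (integral_sub_pow_four_le hr (hzF _) (hF _) (hzF _) (hF _)).trans ?_
      have hm : MemDomJ ((1 / 2 : ℝ) • (z (φ p.1) + z (φ p.2))) := by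
        refine (((hzF (φ p.1)).add (hzF (φ p.2)) ((hF2 _).integrable one_le_two)
          ((hF2 _).integrable one_le_two)).smul (1 / 2)).memDomJ
          (((hF _).add (hF _)).const_mul _) fun k hk => ?_
        simp [(hzD (φ p.1)).support_odd k hk, (hzD (φ p.2)).support_odd k hk]
      have : sInf S ≤ energy r ((1 / 2 : ℝ) • (z (φ p.1) + z (φ p.2))) :=
        csInf_le hbdd ⟨_, hm, rfl⟩
      rw [hzu, hzu]
      linarith
    have hsq0 : Tendsto Real.sqrt (𝓝 0) (𝓝 0) := by
      simpa using Real.continuous_sqrt.tendsto 0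
    have h5 := hsq0.comp (hsq0.comp h4)
    refine h5.congr fun p => ?_
    simp only [Function.comp_apply]
    rw [show ∀ x : ℝ, x ^ 4 = (x ^ 2) ^ 2 from fun x => by ring, Real.sqrt_sq (by positivity),
      Real.sqrt_sq dist_nonneg]
  obtain ⟨f, hf⟩ := cauchySeq_tendsto_of_complete hcauchy
  have hfL : MemLp (f : AddCircle (1 : ℝ) → ℝ) 4 haarAddCircle := Lp.memLp f
  have hαF : HasSineCoeff α (f : AddCircle (1 : ℝ) → ℝ) := by
    intro k
    have h1 : Tendsto (fun n => fourierCoeff (fun t => (F (φ n) t : ℂ)) k) atTop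
        (𝓝 (fourierCoeff (fun t => ((f : AddCircle (1 : ℝ) → ℝ) t : ℂ)) k)) := by
      rw [tendsto_iff_norm_sub_tendsto_zero]
      rw [tendsto_iff_norm_sub_tendsto_zero] at hf
      refine squeeze_zero (fun _ => norm_nonneg _) (fun n => ?_) hf
      have h2 := fourierCoeff_sub (((hF2 (φ n)).integrable one_le_two).ofReal (𝕜 := ℂ))
        (((memLp_two_of_four hfL).integrable one_le_two).ofReal (𝕜 := ℂ)) k
      have h3 := norm_fourierCoeff_le ((hF (φ n)).sub hfL) k
      rw [MemLp.toLp_sub _ hfL, Lp.toLp_coeFn] at h3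
      simp only [Complex.coe_algebraMap] at h2
      rw [← h2]
      simpa using h3
    refine tendsto_nhds_unique h1 ?_
    simp only [hzF _ k]
    exact ((Complex.continuous_ofReal.tendsto _).comp (hα k)).const_mul _
  have hαe : ∀ k, Even k → α k = 0 := fun k hk =>
    tendsto_nhds_unique (hα k) (by simp [(hzD _).support_odd k hk])
  have hαD := hαF.memDomJ hfL hαe
  refine ⟨α, hαD, fun y hy => ?_⟩
  -- The quartic part converges by strong convergence in L⁴ and the quadratic part by `r → 0`.
  have hmin : energy r α = sInf S := by
    refine tendsto_nhds_unique (f := fun n => energy r (z (φ n))) (l := atTop) ?_ ?_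
    · simp only [fun n => energy_eq (r := r) (hzF (φ n)) (hF _)]
      rw [energy_eq hαF hfL]
      refine Tendsto.add (Tendsto.const_mul _ ?_) ?_
      · simp only [← norm_toLp_pow_four (hF _)]
        rw [← norm_toLp_pow_four hfL, Lp.toLp_coeFn]
        exact hf.norm.pow 4
      · have hd := tendsto_tsum_weight_mul (l := atTop) (r := r)
          (d := fun n k => z (φ n) k ^ 2 - α k ^ 2) (B := B + 1 + ∑' k, α k ^ 2) hr0 (fun k => by
            rw [← sub_self (α k ^ 2)]
            exact ((hα k).pow 2).sub_const (α k ^ 2)) ?_ ?_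
        · have h1 : ∀ n, ∑' k, r k * (z (φ n) k ^ 2 - α k ^ 2) =
              ∑' k, r k * z (φ n) k ^ 2 - ∑' k, r k * α k ^ 2 := by
            intro n
            have s1 := summable_weight_mul hr (hzD (φ n)).summable_sq (hzD (φ n)).summable_sq
            have s2 := summable_weight_mul hr hαD.summable_sq hαD.summable_sq
            simp only [← pow_two] at s1 s2
            rw [← s1.tsum_sub s2]
            congr 1; ext k; ring
          simp only [h1] at hd
          have h2 := hd.add_const (∑' k, r k * α k ^ 2)
          rw [zero_add] at h2
          exact h2.congr fun n => sub_add_cancel _ _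
        all_goals
          intro n
          have hb : ∀ k, |z (φ n) k ^ 2 - α k ^ 2| ≤ z (φ n) k ^ 2 + α k ^ 2 := fun k => by
            rw [abs_le]; constructor <;> nlinarith [sq_nonneg (z (φ n) k), sq_nonneg (α k)]
          have hs := (hzD (φ n)).summable_sq.add hαD.summable_sq
          have hs' := Summable.of_nonneg_of_le (fun k => abs_nonneg _) hb hs
        · exact hs'
        · refine (hs'.tsum_le_tsum hb hs).trans ?_
          rw [(hzD (φ n)).summable_sq.tsum_add hαD.summable_sq]
          linarith [hsq (φ n)]
    · simp only [hzu]
      exact hlim.comp hφ.tendsto_atTop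
  rw [hmin]
  exact csInf_le hbdd ⟨_, hy, rfl⟩

/-- Minimality along lines kills every first variation. The zero sequence is not minimal, because
along the sine mode `k` the energy is `2 r_k s² + N s⁴`. -/
theorem exists_energyCritical_min (hr : ∀ k, |r k| ≤ C) (hr0 : Tendsto r cofinite (𝓝 0))
    (hre : ∀ k, r (-k) = r k) {k : ℤ} (hk : Odd k) (hrk : r k < 0) :
    ∃ α : ℤ → ℝ, EnergyCritical r α ∧ α ≠ 0 ∧ ∀ z, MemDomJ z → energy r α ≤ energy r z := by
  have hfact : Fact ((0 : ℝ) < 1) := ⟨one_pos⟩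
  obtain ⟨α, hαD, hmin⟩ := exists_energy_min hr hr0
  obtain ⟨F, hF, hα⟩ := hαD.exists_hasSineCoeff (T := 1)
  refine ⟨α, energyCritical_of_firstVariation hr hα hF hαD.support_odd fun y G hy hG hye => ?_,
    ?_, hmin⟩
  · refine IsLocalMin.hasDerivAt_eq_zero (Eventually.of_forall fun s => ?_)
      (hasDerivAt_energy hr hα hF hy hG)
    have hd : MemDomJ (α + s • y) :=
      (hα.add (hy.smul s) ((memLp_two_of_four hF).integrable one_le_two)
        (((memLp_two_of_four hG).integrable one_le_two).const_mul s)).memDomJ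
        (hF.add (hG.const_mul s)) fun k hk => by simp [hαD.support_odd k hk, hye k hk]
    simpa using hmin _ hd
  · rintro rfl
    have hy := hasSineCoeff_sineSeq (T := 1) k
    have hG := memLp_fourier_im (T := 1) k
    have hk0 : k ≠ -k := by
      intro h'
      have : k = 0 := by omega
      rw [this] at hk
      exact absurd hk (by decide)
    have e0 : energy r 0 = 0 := by simp [energy, convolve]
    have hs : ∑' j, r j * sineSeq k j ^ 2 = 2 * r k := by
      rw [tsum_eq_sum (s := {k, -k})]
      · rw [Finset.sum_pair hk0, hre]
        simp [sineSeq, hk0, hk0.symm]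
        ring
      · intro j hj
        simp only [Finset.mem_insert, Finset.mem_singleton, not_or] at hj
        simp [sineSeq, hj.1, hj.2]
    have key : ∀ s : ℝ, 0 ≤ s ^ 2 * (2 * r k) +
        s ^ 4 * (1 / 4 * ∫ t : AddCircle (1 : ℝ), (2 * (fourier k t).im) ^ 4 ∂haarAddCircle) := by
      intro s
      have h := hmin (s • sineSeq k) ((hy.smul s).memDomJ (hG.const_mul s) fun j hj => by
        simp [sineSeq_even hk j hj])
      rw [e0, energy_eq (hy.smul s) (hG.const_mul s)] at h
      simp only [Pi.smul_apply, smul_eq_mul, mul_pow s] at h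
      rw [integral_const_mul] at h
      have h2 : ∑' j, r j * (s ^ 2 * sineSeq k j ^ 2) = s ^ 2 * (2 * r k) := by
        rw [← hs, ← tsum_mul_left]
        congr 1; ext j; ring
      rw [h2] at h
      linarith
    generalize (1 / 4 * ∫ t : AddCircle (1 : ℝ), (2 * (fourier k t).im) ^ 4 ∂haarAddCircle) = N
      at key
    -- The choice `s² = -r_k/(|N|+1)` makes `N s² ≤ -r_k`, so the energy is at most `r_k s² < 0`.
    have h1 : 0 < -r k / (|N| + 1) := by have := abs_nonneg N; apply div_pos <;> linarith
    have h2 := key (Real.sqrt (-r k / (|N| + 1)))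
    rw [show ∀ x : ℝ, x ^ 4 = (x ^ 2) ^ 2 from fun x => by ring, Real.sq_sqrt h1.le] at h2
    have h3 : -r k / (|N| + 1) * (|N| + 1) = -r k := by
      have := abs_nonneg N
      field_simp
    nlinarith [le_abs_self N, mul_pos h1 h1, mul_le_mul_of_nonneg_left (le_abs_self N) (mul_pos h1 h1).le]

end Existence

/-! ### Fractional regularity of a function whose cube is in H¹. -/

section Regularity

open AddCircle

variable {T : ℝ} [hT : Fact (0 < T)]

theorem fourierCoeff_translate (f : AddCircle T → ℂ) (h : AddCircle T) (k : ℤ) :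
    fourierCoeff (fun t => f (t + h)) k = fourier k h * fourierCoeff f k := by
  rw [fourierCoeff, fourierCoeff,
    ← integral_add_right_eq_self (fun t => fourier (-k) t • f t) h, ← integral_const_mul]
  refine integral_congr_ae (ae_of_all _ fun t => ?_)
  have h1 : fourier k h * fourier (-k) h = 1 := by
    rw [fourier_neg, Complex.mul_conj, Complex.normSq_eq_norm_sq, fourier_apply, Circle.norm_coe]
    simp
  have h2 : fourier (-k) (t + h) = fourier (-k) t * fourier (-k) h := by
    simp only [fourier_apply, smul_add, toCircle_add, Circle.coe_mul]
  simp only [smul_eq_mul]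
  rw [h2]
  linear_combination (-(fourier (-k) t : ℂ) * f (t + h)) * h1

theorem memLp_translate {F : AddCircle T → ℝ} {p : ℝ≥0∞} (hF : MemLp F p haarAddCircle)
    (h : AddCircle T) : MemLp (fun t => F (t + h)) p haarAddCircle :=
  hF.comp_measurePreserving (measurePreserving_add_right _ h)

/-- The `L²` modulus of continuity in terms of the Fourier coefficients. -/
theorem HasSineCoeff.hasSum_translate_sub {z : ℤ → ℝ} {F : AddCircle T → ℝ}
    (hz : HasSineCoeff z F) (hF : MemLp F 2 haarAddCircle) (h : AddCircle T) :
    HasSum (fun k => ‖fourier k h - 1‖ ^ 2 * z k ^ 2)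
      (∫ t, (F (t + h) - F t) ^ 2 ∂haarAddCircle) := by
  have hFh := memLp_translate hF h
  have := hasSum_sq_norm_fourierCoeff ((hFh.sub hF).ofReal (K := ℂ))
  convert this using 1
  · ext k
    have h1 := fourierCoeff_sub ((hFh.integrable one_le_two).ofReal (𝕜 := ℂ))
      ((hF.integrable one_le_two).ofReal (𝕜 := ℂ)) k
    simp only [Complex.coe_algebraMap, Pi.sub_apply, Complex.ofReal_sub] at h1 ⊢
    rw [h1, fourierCoeff_translate (fun t => (F t : ℂ)), hz k, ← sub_one_mul, norm_mul, norm_mul,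
      mul_pow]
    simp
  · refine integral_congr_ae (ae_of_all _ fun t => ?_)
    simp only [Pi.sub_apply, Complex.coe_algebraMap, Complex.norm_real, Real.norm_eq_abs, sq_abs]

/-- The shift `T s / 2π` rotates the mode `k` by the angle `k s`, which removes `T` from the later
estimates. -/
theorem norm_fourier_sub_one (k : ℤ) (s : ℝ) :
    ‖fourier k ((T / (2 * Real.pi) * s : ℝ) : AddCircle T) - 1‖ = 2 * |Real.sin (k * s / 2)| := by
  have hT0 : (T : ℂ) ≠ 0 := by exact_mod_cast hT.out.ne'
  have hpi : (Real.pi : ℂ) ≠ 0 := by exact_mod_cast Real.pi_ne_zero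
  have : 2 * Real.pi * Complex.I * k * ((T / (2 * Real.pi) * s : ℝ) : ℂ) / T =
      Complex.I * ((k * s : ℝ) : ℂ) := by
    push_cast
    field_simp
  rw [fourier_coe_apply, this, Complex.norm_exp_I_mul_ofReal_sub_one, norm_mul]
  simp

/-- Hölder continuity of the cube root, `|x - y|³ ≤ 4 |x³ - y³|`, combined with `u ≤ D + u³/D²`. The
free parameter `D` replaces fractional powers under the integral. -/
theorem sq_le_add_of_cube {x y D : ℝ} (hD : 0 < D) :
    (x - y) ^ 2 ≤ D + 16 * (x ^ 3 - y ^ 3) ^ 2 / D ^ 2 := by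
  have h1 : ((x - y) ^ 2) ^ 3 ≤ 16 * (x ^ 3 - y ^ 3) ^ 2 := by
    have h2 : (x - y) ^ 2 ≤ 4 * (x ^ 2 + x * y + y ^ 2) := by nlinarith [sq_nonneg (x + y)]
    have h3 : ((x - y) ^ 2) ^ 2 ≤ (4 * (x ^ 2 + x * y + y ^ 2)) ^ 2 :=
      pow_le_pow_left₀ (sq_nonneg _) h2 2
    nlinarith [mul_le_mul_of_nonneg_left h3 (sq_nonneg (x - y))]
  have h4 : (x - y) ^ 2 ≤ D + ((x - y) ^ 2) ^ 3 / D ^ 2 := by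
    generalize hu : (x - y) ^ 2 = u
    have hu0 : 0 ≤ u := hu ▸ sq_nonneg _
    rcases le_total u D with h | h
    · have : 0 ≤ u ^ 3 / D ^ 2 := by positivity
      linarith
    · have : u ≤ u ^ 3 / D ^ 2 := by
        rw [le_div_iff₀ (by positivity)]
        nlinarith [mul_le_mul h h hD.le hu0]
      linarith
  refine h4.trans ?_
  gcongr

variable {α b : ℤ → ℝ} {F : AddCircle T → ℝ}

/-- Parseval expresses the L² modulus of continuity of `F` and of `F^3` through coefficients; the
latter is at most `|s|` times an H¹ seminorm, and the previous inequality transfers the bound to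
`F`. -/
theorem tsum_translate_le (hα : HasSineCoeff α F) (hF : MemLp F 4 haarAddCircle)
    (hb : HasSineCoeff b (fun t => F t ^ 3)) (hbs : Summable fun k : ℤ => (k : ℝ) ^ 2 * b k ^ 2)
    {D : ℝ} (hD : 0 < D) (s : ℝ) :
    (Summable fun k : ℤ => (2 * |Real.sin (k * s / 2)|) ^ 2 * α k ^ 2) ∧
    ∑' k : ℤ, (2 * |Real.sin (k * s / 2)|) ^ 2 * α k ^ 2 ≤
      D + 16 / D ^ 2 * (s ^ 2 * ∑' k : ℤ, (k : ℝ) ^ 2 * b k ^ 2) := by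
  have hi3 : Integrable (fun t => F t ^ 3) haarAddCircle := by
    simpa using (integrable_mul_of_memLp_four hF (memLp_const (1 : ℝ))).1
  have hb0 : b 0 = 0 := by
    have := hb.odd 0
    simp only [neg_zero] at this
    linarith
  have hb2 : Summable fun k => b k ^ 2 := by
    refine Summable.of_nonneg_of_le (fun _ => sq_nonneg _) (fun k => ?_) hbs
    rcases eq_or_ne k 0 with rfl | hk
    · simp [hb0]
    · have : (1 : ℝ) ≤ (k : ℝ) ^ 2 := by
        have : (1 : ℤ) ≤ k ^ 2 := by
          have := sq_nonneg k
          have : k ^ 2 ≠ 0 := pow_ne_zero 2 hk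
          omega
        exact_mod_cast this
      nlinarith [sq_nonneg (b k)]
  have hG : MemLp (fun t => F t ^ 3) 2 haarAddCircle := by
    refine memLp_two_of_summable hi3 (hb2.congr fun k => ?_)
    rw [hb k]
    simp
  have hF2 := memLp_two_of_four hF
  set h : AddCircle T := ((T / (2 * Real.pi) * s : ℝ) : AddCircle T) with hh
  have e1 := hα.hasSum_translate_sub hF2 h
  have e2 := hb.hasSum_translate_sub hG h
  simp only [hh, norm_fourier_sub_one] at e1 e2
  rw [← hh] at e1 e2
  refine ⟨e1.summable, ?_⟩
  rw [e1.tsum_eq]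
  have i1 : Integrable (fun t => (F (t + h) - F t) ^ 2) haarAddCircle :=
    ((memLp_translate hF2 h).sub hF2).integrable_sq
  have i2 : Integrable (fun t => (F (t + h) ^ 3 - F t ^ 3) ^ 2) haarAddCircle :=
    ((memLp_translate hG h).sub hG).integrable_sq
  have h1 : ∫ t, (F (t + h) - F t) ^ 2 ∂(haarAddCircle (T := T)) ≤
      ∫ t, (D + 16 / D ^ 2 * (F (t + h) ^ 3 - F t ^ 3) ^ 2) ∂(haarAddCircle (T := T)) := by
    refine integral_mono i1 ((integrable_const _).add (i2.const_mul _)) fun t => ?_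
    refine (sq_le_add_of_cube hD).trans (le_of_eq ?_)
    ring
  rw [integral_add (integrable_const _) (i2.const_mul _), integral_const_mul] at h1
  simp only [integral_const, probReal_univ, smul_eq_mul, one_mul] at h1
  refine h1.trans ?_
  have h2 : ∫ t, (F (t + h) ^ 3 - F t ^ 3) ^ 2 ∂(haarAddCircle (T := T)) ≤
      s ^ 2 * ∑' k : ℤ, (k : ℝ) ^ 2 * b k ^ 2 := by
    rw [← e2.tsum_eq, ← tsum_mul_left]
    refine e2.summable.tsum_le_tsum (fun k => ?_) (hbs.mul_left _)
    have h3 : 2 * |Real.sin (k * s / 2)| ≤ |k * s| := by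
      have := Real.abs_sin_le_abs (x := (k * s / 2 : ℝ))
      rw [abs_div, abs_two] at this
      linarith
    have h4 : (2 * |Real.sin (k * s / 2)|) ^ 2 ≤ (k * s) ^ 2 := by
      rw [← sq_abs ((k : ℝ) * s)]
      exact pow_le_pow_left₀ (by positivity) h3 2
    nlinarith [mul_le_mul_of_nonneg_right h4 (sq_nonneg (b k))]
  gcongr

theorem dyadic_bounds {k : ℤ} (hk : k ≠ 0) :
    (2 : ℝ) ^ Nat.log 2 k.natAbs ≤ |(k : ℝ)| ∧ |(k : ℝ)| < 2 ^ (Nat.log 2 k.natAbs + 1) := by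
  have hkn : k.natAbs ≠ 0 := Int.natAbs_ne_zero.2 hk
  rw [← Int.cast_abs, Int.abs_eq_natAbs]
  exact ⟨by exact_mod_cast Nat.pow_log_le_self 2 hkn,
    by exact_mod_cast Nat.lt_pow_succ_log_self one_lt_two k.natAbs⟩

/-- Here `1 + k² ≤ 8 · 4^j`, and `8^ν ≤ 8` because `ν ≤ 1`. -/
theorem rpow_le_dyadic {k : ℤ} {j : ℕ} {ν : ℝ} (hν0 : 0 ≤ ν) (hν : ν ≤ 1)
    (l2 : |(k : ℝ)| < 2 ^ (j + 1)) : (1 + (k : ℝ) ^ 2) ^ ν ≤ 8 * ((4 : ℝ) ^ ν) ^ j := by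
  have hk1 : (1 : ℝ) ≤ 2 ^ j := one_le_pow₀ (by norm_num)
  have h1 : 1 + (k : ℝ) ^ 2 ≤ 8 * 4 ^ j := by
    rw [← sq_abs (k : ℝ), show (4 : ℝ) ^ j = 2 ^ j * 2 ^ j by rw [← mul_pow]; norm_num]
    rw [pow_succ] at l2
    nlinarith [abs_nonneg (k : ℝ)]
  calc (1 + (k : ℝ) ^ 2) ^ ν ≤ (8 * 4 ^ j) ^ ν :=
        Real.rpow_le_rpow (by positivity) h1 hν0
    _ = 8 ^ ν * ((4 : ℝ) ^ ν) ^ j := by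
        rw [Real.mul_rpow (by norm_num) (by positivity), ← Real.rpow_natCast,
          ← Real.rpow_natCast, ← Real.rpow_mul (by norm_num), ← Real.rpow_mul (by norm_num),
          mul_comm ν]
    _ ≤ 8 * ((4 : ℝ) ^ ν) ^ j := by
        have : (8 : ℝ) ^ ν ≤ 8 ^ (1 : ℝ) :=
          Real.rpow_le_rpow_of_exponent_le (by norm_num) (hν)
        rw [Real.rpow_one] at this
        gcongr

/-- For the shift `2^{-j}` the half angle has modulus in `[1/2, 1]`, where Jordan's inequality gives
a sine of at least `1/π`. So that shift sees all frequencies of its dyadic block. -/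
theorem one_le_sin_dyadic {k : ℤ} {j : ℕ} (l1 : (2 : ℝ) ^ j ≤ |(k : ℝ)|)
    (l2 : |(k : ℝ)| < 2 ^ (j + 1)) :
    1 ≤ Real.pi ^ 2 / 4 * (2 * |Real.sin (k * (1 / 2) ^ j / 2)|) ^ 2 := by
  have hp : (0 : ℝ) < 2 ^ j := by positivity
  have e : |Real.sin (k * (1 / 2) ^ j / 2)| = |Real.sin (|(k : ℝ)| * (1 / 2) ^ j / 2)| := by
    rcases abs_cases (k : ℝ) with h | h
    · rw [h.1]
    · rw [h.1, neg_mul, neg_div, Real.sin_neg, abs_neg]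
  have hx1 : 1 / 2 ≤ |(k : ℝ)| * (1 / 2) ^ j / 2 := by
    rw [one_div_pow, mul_one_div]
    have : 1 ≤ |(k : ℝ)| / 2 ^ j := (one_le_div hp).2 l1
    linarith
  have hx2 : |(k : ℝ)| * (1 / 2) ^ j / 2 ≤ 1 := by
    rw [one_div_pow, mul_one_div]
    have : |(k : ℝ)| / 2 ^ j ≤ 2 := by
      rw [div_le_iff₀ hp, ← pow_succ']; exact l2.le
    linarith
  rw [e]
  generalize |(k : ℝ)| * (1 / 2) ^ j / 2 = x at hx1 hx2
  have hpi := Real.pi_gt_three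
  have h1 := Real.mul_le_sin (by linarith : 0 ≤ x) (by linarith)
  have h2 : 1 / Real.pi ≤ Real.sin x := by
    refine le_trans ?_ h1
    rw [div_mul_eq_mul_div]
    gcongr
    linarith
  have h3 : 1 ≤ Real.pi * Real.sin x := by
    rw [div_le_iff₀ (by positivity)] at h2
    linarith
  have h4 : 1 ≤ (Real.pi * Real.sin x) ^ 2 := one_le_pow₀ h3
  rw [mul_pow, sq_abs]
  nlinarith

theorem summable_prod_of_geometric {θ : ℕ → ℤ → ℝ} {A σ τ : ℝ} (hθ0 : ∀ j k, 0 ≤ θ j k)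
    (hθ : ∀ j, Summable (θ j)) (hθA : ∀ j, ∑' k, θ j k ≤ A * σ ^ j) (hσ0 : 0 < σ) (hτ0 : 0 < τ)
    (hτσ : τ * σ < 1) : Summable fun p : ℕ × ℤ => τ ^ p.1 * θ p.1 p.2 := by
  have hgeom : Summable fun j : ℕ => A * (τ * σ) ^ j :=
    (summable_geometric_of_lt_one (mul_pos hτ0 hσ0).le hτσ).mul_left _
  have hnn : ∀ j k, 0 ≤ τ ^ j * θ j k := fun j k => mul_nonneg (pow_pos hτ0 j).le (hθ0 j k)
  have hsum : Summable fun j : ℕ => ∑' k, τ ^ j * θ j k := by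
    refine Summable.of_nonneg_of_le (fun j => tsum_nonneg (hnn j)) (fun j => ?_) hgeom
    rw [tsum_mul_left, mul_pow]
    calc τ ^ j * ∑' k, θ j k ≤ τ ^ j * (A * σ ^ j) :=
          mul_le_mul_of_nonneg_left (hθA j) (pow_pos hτ0 j).le
      _ = _ := by ring
  have hs : ∀ j, Summable fun k => τ ^ j * θ j k := fun j => (hθ j).mul_left (τ ^ j)
  generalize hf : (fun j k => τ ^ j * θ j k) = f
  have hf' : ∀ j k, τ ^ j * θ j k = f j k := fun j k => by rw [← hf]
  simp only [hf'] at hnn hs hsum ⊢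
  rw [summable_prod_of_nonneg fun p => hnn p.1 p.2]
  exact ⟨hs, hsum⟩

/-- For `s = 2^{-j}` the parameter is `D = σ^j = s^{1/2}`, so both terms of the bound are at most a
constant times `s^{1/2}`; this decay gives every `ν < 1/4`. -/
theorem tsum_translate_dyadic_le (hα : HasSineCoeff α F) (hF : MemLp F 4 haarAddCircle)
    (hb : HasSineCoeff b (fun t => F t ^ 3)) (hbs : Summable fun k : ℤ => (k : ℝ) ^ 2 * b k ^ 2)
    {σ : ℝ} (hσ0 : 0 < σ) (hσ2 : σ ^ 2 = 1 / 2) (j : ℕ) :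
    (Summable fun k : ℤ => (2 * |Real.sin (k * (1 / 2) ^ j / 2)|) ^ 2 * α k ^ 2) ∧
    ∑' k : ℤ, (2 * |Real.sin (k * (1 / 2) ^ j / 2)|) ^ 2 * α k ^ 2 ≤
      (1 + 16 * ∑' k : ℤ, (k : ℝ) ^ 2 * b k ^ 2) * σ ^ j := by
  obtain ⟨h1, h2⟩ := tsum_translate_le hα hF hb hbs (pow_pos hσ0 j) ((1 / 2) ^ j)
  refine ⟨h1, h2.trans ?_⟩
  have hS0 : 0 ≤ ∑' k : ℤ, (k : ℝ) ^ 2 * b k ^ 2 := tsum_nonneg fun k => by positivity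
  generalize ∑' k : ℤ, (k : ℝ) ^ 2 * b k ^ 2 = S at hS0
  have hσ1 : σ ≤ 1 := by nlinarith
  have h5 : 0 < σ ^ j := pow_pos hσ0 j
  have h3 : 16 / (σ ^ j) ^ 2 * (((1 / 2) ^ j) ^ 2 * S) = 16 * S * (σ ^ j * σ ^ j) := by
    rw [← hσ2, ← pow_mul, ← pow_mul, ← pow_mul]
    field_simp
    ring
  have h4 : σ ^ j ≤ 1 := pow_le_one₀ hσ0.le hσ1
  have h6 : S * (σ ^ j * σ ^ j) ≤ S * σ ^ j :=
    mul_le_mul_of_nonneg_left (mul_le_of_le_one_right h5.le h4) hS0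
  rw [h3]
  linarith

theorem summable_prod_translate (hα : HasSineCoeff α F) (hF : MemLp F 4 haarAddCircle)
    (hb : HasSineCoeff b (fun t => F t ^ 3)) (hbs : Summable fun k : ℤ => (k : ℝ) ^ 2 * b k ^ 2)
    {σ τ : ℝ} (hσ0 : 0 < σ) (hσ2 : σ ^ 2 = 1 / 2) (hτ0 : 0 < τ) (hτσ : τ * σ < 1) :
    Summable fun p : ℕ × ℤ =>
      τ ^ p.1 * ((2 * |Real.sin (p.2 * (1 / 2) ^ p.1 / 2)|) ^ 2 * α p.2 ^ 2) :=
  summable_prod_of_geometric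
    (θ := fun j k => (2 * |Real.sin (k * (1 / 2) ^ j / 2)|) ^ 2 * α k ^ 2)
    (fun _ _ => mul_nonneg (sq_nonneg _) (sq_nonneg _))
    (fun j => (tsum_translate_dyadic_le hα hF hb hbs hσ0 hσ2 j).1)
    (fun j => (tsum_translate_dyadic_le hα hF hb hbs hσ0 hσ2 j).2) hσ0 hτ0 hτσ

/-- Fractional regularity of a function whose cube lies in `H¹`. -/
theorem summable_weighted_sq (hα : HasSineCoeff α F) (hF : MemLp F 4 haarAddCircle)
    (hb : HasSineCoeff b (fun t => F t ^ 3)) (hbs : Summable fun k : ℤ => (k : ℝ) ^ 2 * b k ^ 2)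
    {ν : ℝ} (hν0 : 0 < ν) (hν : ν < 1 / 4) :
    Summable fun k : ℤ => (1 + (k : ℝ) ^ 2) ^ ν * α k ^ 2 := by
  set σ : ℝ := Real.sqrt (1 / 2) with hσdef
  have hσ2 : σ ^ 2 = 1 / 2 := Real.sq_sqrt (by norm_num)
  have hσ0 : 0 < σ := Real.sqrt_pos.2 (by norm_num)
  set τ : ℝ := (4 : ℝ) ^ ν with hτdef
  have hτ0 : 0 < τ := by positivity
  -- This is where `ν < 1/4` enters: `τ^4 = 4^{4ν} < 4` while `σ^4 = 1/4`.
  have hτσ : τ * σ < 1 := by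
    have h1 : τ ^ 4 < 4 := by
      rw [hτdef, ← Real.rpow_natCast, ← Real.rpow_mul (by norm_num)]
      calc (4 : ℝ) ^ (ν * (4 : ℕ)) < 4 ^ (1 : ℝ) :=
            Real.rpow_lt_rpow_of_exponent_lt (by norm_num) (by push_cast; linarith)
        _ = 4 := by norm_num
    have h2 : (τ * σ) ^ 4 < 1 := by
      have : σ ^ 4 = 1 / 4 := by
        rw [show σ ^ 4 = (σ ^ 2) ^ 2 by ring, hσ2]; norm_num
      rw [mul_pow, this]; linarith
    by_contra hcon
    exact absurd (one_le_pow₀ (n := 4) (not_lt.1 hcon)) (not_le.2 h2)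
  have hprod := summable_prod_translate hα hF hb hbs hσ0 hσ2 hτ0 hτσ
  -- From the double series only the term of the matching dyadic shift is kept for each frequency
  -- `k`.
  have hcomp := hprod.comp_injective (i := fun k : ℤ => (Nat.log 2 k.natAbs, k))
    fun k l h => (Prod.ext_iff.1 h).2
  refine Summable.of_nonneg_of_le (fun k => by positivity) (fun k => ?_)
    (hcomp.mul_left (8 * Real.pi ^ 2 / 4))
  simp only [Function.comp_apply]
  have hα0 : α 0 = 0 := by
    have := hα.odd 0
    simp only [neg_zero] at this
    linarith
  rcases eq_or_ne k 0 with rfl | hk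
  · simp [hα0]
  obtain ⟨l1, l2⟩ := dyadic_bounds hk
  have b1 := rpow_le_dyadic hν0.le (by linarith) l2
  have b2 := one_le_sin_dyadic l1 l2
  rw [← hτdef] at b1
  set j := Nat.log 2 k.natAbs with hj
  have hαk := sq_nonneg (α k)
  have hτj : 0 < τ ^ j := pow_pos hτ0 j
  calc (1 + (k : ℝ) ^ 2) ^ ν * α k ^ 2 ≤ 8 * τ ^ j * α k ^ 2 := by gcongr
    _ ≤ 8 * τ ^ j * α k ^ 2 * (Real.pi ^ 2 / 4 * (2 * |Real.sin (k * (1 / 2) ^ j / 2)|) ^ 2) :=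
        le_mul_of_one_le_right (by positivity) b2
    _ = 8 * Real.pi ^ 2 / 4 * (τ ^ j * ((2 * |Real.sin (k * (1 / 2) ^ j / 2)|) ^ 2 * α k ^ 2)) := by ring

end Regularity

/-! ### Weak derivatives on the half line and the equation up to the boundary. -/

section HalfLine

open Set

/-- A smooth compactly supported function on `(0,∞)` with zero mean is the derivative of such a
function. -/
theorem exists_primitive_of_integral_eq_zero {χ : ℝ → ℝ}
    (hχ : ContDiff ℝ ((⊤ : ℕ∞) : WithTop ℕ∞) χ) (hc : HasCompactSupport χ)
    (hs : tsupport χ ⊆ Ioi 0) (h0 : ∫ x, χ x = 0) :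
    ∃ X : ℝ → ℝ, ContDiff ℝ ((⊤ : ℕ∞) : WithTop ℕ∞) X ∧ HasCompactSupport X ∧
      tsupport X ⊆ Ioi 0 ∧ deriv X = χ := by
  obtain ⟨R, hR, hRχ⟩ := hc.exists_pos_le_norm
  -- A compact support inside the open half line stays away from `0`, so the primitive also vanishes
  -- near `0`; zero mean makes it vanish beyond the support.
  obtain ⟨a, ha, haχ⟩ : ∃ a > 0, ∀ x < a, χ x = 0 := by
    rcases (tsupport χ).eq_empty_or_nonempty with he | hne
    · refine ⟨1, one_pos, fun x _ => ?_⟩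
      rw [tsupport_eq_empty_iff] at he
      simp [he]
    · have hl := hc.isCompact.isLeast_sInf hne
      refine ⟨sInf (tsupport χ), hs hl.1, fun x hx => ?_⟩
      by_contra hx0
      exact absurd (hl.2 (subset_tsupport χ hx0)) (not_le.2 hx)
  have hcont := hχ.continuous
  have hder : deriv (fun x => ∫ t in (0 : ℝ)..x, χ t) = χ :=
    funext fun x => hcont.deriv_integral _ 0 x
  have hsupp : Function.support (fun x => ∫ t in (0 : ℝ)..x, χ t) ⊆ Icc a R := by
    intro x hx
    rw [Function.mem_support] at hx
    by_contra hcon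
    refine hx ?_
    rw [mem_Icc, not_and_or, not_le, not_le] at hcon
    rcases hcon with h | h
    · have : EqOn χ (fun _ => 0) (uIcc 0 x) := fun t ht => haχ t (by
        rcases mem_uIcc.1 ht with h1 | h1 <;> linarith [h1.1, h1.2])
      rw [intervalIntegral.integral_congr this]
      simp
    · rw [intervalIntegral.integral_eq_integral_of_support_subset, h0]
      intro t ht
      rw [Function.mem_support] at ht
      constructor
      · by_contra h1
        exact ht (haχ t (by linarith [not_lt.1 h1]))
      · by_contra h1
        exact ht (hRχ t (by rw [Real.norm_eq_abs]; linarith [le_abs_self t, not_le.1 h1]))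
  have hts : tsupport (fun x => ∫ t in (0 : ℝ)..x, χ t) ⊆ Icc a R :=
    closure_minimal hsupp isClosed_Icc
  refine ⟨fun x => ∫ t in (0 : ℝ)..x, χ t, ?_, ?_, fun x hx => ha.trans_le (hts hx).1, hder⟩
  · rw [contDiff_infty_iff_deriv, hder]
    exact ⟨fun x => (hcont.integral_hasStrictDerivAt 0 x).hasDerivAt.differentiableAt, hχ⟩
  · exact HasCompactSupport.of_support_subset_isCompact isCompact_Icc hsupp

theorem integrableOn_mul_of_hasCompactSupport {ψ u : ℝ → ℝ} (hψ : Continuous ψ)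
    (hc : HasCompactSupport ψ) (hu : LocallyIntegrable u) :
    Integrable fun x => ψ x * u x := by
  simpa [smul_eq_mul] using hu.integrable_smul_left_of_hasCompactSupport hψ hc

/-- The lemma of du Bois-Reymond on the half line. -/
theorem exists_const_of_weakDeriv_eq_zero {u : ℝ → ℝ} (hu : LocallyIntegrable u)
    (h : ∀ φ : ℝ → ℝ, ContDiff ℝ ((⊤ : ℕ∞) : WithTop ℕ∞) φ → HasCompactSupport φ →
      tsupport φ ⊆ Ioi 0 → ∫ x in Ioi 0, deriv φ x * u x = 0) :
    ∃ C : ℝ, ∀ᵐ x, x ∈ Ioi (0 : ℝ) → u x = C := by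
  let f : ContDiffBump (2 : ℝ) := ⟨1 / 2, 1, by norm_num, by norm_num⟩
  set η := f.normed volume with hη
  have hη1 : ContDiff ℝ ((⊤ : ℕ∞) : WithTop ℕ∞) η := f.contDiff_normed
  have hη2 : HasCompactSupport η := f.hasCompactSupport_normed
  have hη3 : tsupport η ⊆ Ioi 0 := by
    rw [hη, f.tsupport_normed_eq]
    intro x hx
    have : |x - 2| ≤ 1 := hx
    rw [abs_le] at this
    simp only [mem_Ioi]
    linarith [this.1]
  have hη4 : ∫ x, η x = 1 := f.integral_normed
  have hset : ∀ φ v : ℝ → ℝ, tsupport φ ⊆ Ioi 0 →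
      ∫ x in Ioi 0, φ x * v x = ∫ x, φ x * v x := fun φ v hφ =>
    setIntegral_eq_integral_of_forall_compl_eq_zero fun x hx => by
      rw [image_eq_zero_of_notMem_tsupport (fun h' => hx (hφ h')), zero_mul]
  refine ⟨∫ x, η x * u x, ?_⟩
  have key := isOpen_Ioi.ae_eq_zero_of_integral_contDiff_smul_eq_zero (μ := volume)
    (U := Ioi (0 : ℝ)) (f := fun x => u x - ∫ x, η x * u x)
    ((hu.sub (locallyIntegrable_const _)).locallyIntegrableOn _) (by
      intro ψ hψ hψc hψs
      -- Subtracting `m η`, with `η` a bump of mass one, leaves a test function of zero mean, that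
      -- is, an admissible derivative.
      set m := ∫ x, ψ x with hm
      have hχ := exists_primitive_of_integral_eq_zero (χ := fun x => ψ x - m * η x)
        (hψ.sub (contDiff_const.mul hη1)) (hψc.sub hη2.mul_left) (by
          refine (tsupport_sub _ _).trans (union_subset hψs ?_)
          exact (closure_mono (Function.support_mul_subset_right _ _)).trans hη3) (by
          rw [integral_sub (hψ.continuous.integrable_of_hasCompactSupport hψc)
            ((hη1.continuous.integrable_of_hasCompactSupport hη2).const_mul _),
            integral_const_mul, hη4, mul_one, sub_self])
      obtain ⟨X, hX1, hX2, hX3, hX4⟩ := hχ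
      have h1 := h X hX1 hX2 hX3
      have hX5 : tsupport (deriv X) ⊆ Ioi 0 := (tsupport_deriv_subset).trans hX3
      rw [hset _ _ hX5, hX4] at h1
      have i1 := integrableOn_mul_of_hasCompactSupport hψ.continuous hψc hu
      have i2 := integrableOn_mul_of_hasCompactSupport hη1.continuous hη2 hu
      have e1 : ∫ x, (ψ x - m * η x) * u x = (∫ x, ψ x * u x) - m * ∫ x, η x * u x := by
        rw [← integral_const_mul, ← integral_sub i1 (i2.const_mul _)]
        congr 1; ext x; ring
      have e2 : ∫ x, ψ x • (u x - ∫ x, η x * u x) =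
          (∫ x, ψ x * u x) - m * ∫ x, η x * u x := by
        rw [hm, ← integral_mul_const, ← integral_sub i1
          ((hψ.continuous.integrable_of_hasCompactSupport hψc).mul_const _)]
        congr 1; ext x; simp only [smul_eq_mul]; ring
      rw [e2, ← e1]
      exact h1)
  filter_upwards [key] with x hx hx0
  have := hx hx0
  linarith

/-- Integration by parts against a primitive. -/
theorem integral_primitive_mul_deriv {v ψ : ℝ → ℝ} (hv : LocallyIntegrable v) (c : ℝ)
    (hψ : ContDiff ℝ 1 ψ) (hc : HasCompactSupport ψ) :
    ∫ x in Ioi (0 : ℝ), (c + ∫ t in (0 : ℝ)..x, v t) * deriv ψ x =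
      -c * ψ 0 - ∫ x in Ioi (0 : ℝ), v x * ψ x := by
  obtain ⟨R, hR, hRψ⟩ := hc.exists_pos_le_norm
  have hRψ' : ∀ x, R ≤ x → ψ x = 0 := fun x hx => hRψ x (hx.trans (le_abs_self x))
  obtain ⟨R', hR', hRd⟩ := hc.deriv.exists_pos_le_norm
  have hRd' : ∀ x, R' ≤ x → deriv ψ x = 0 := fun x hx => hRd x (hx.trans (le_abs_self x))
  set b := max R R' with hb
  have hb0 : 0 ≤ b := hR.le.trans (le_max_left _ _)
  have hvi : IntervalIntegrable v volume 0 b := (hv.integrableOn_isCompact isCompact_uIcc).intervalIntegrable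
  have red : ∀ w : ℝ → ℝ, (∀ x, b < x → w x = 0) →
      ∫ x in Ioi (0 : ℝ), w x = ∫ x in (0 : ℝ)..b, w x := by
    intro w hw
    rw [intervalIntegral.integral_of_le hb0]
    refine setIntegral_eq_of_subset_of_forall_sdiff_eq_zero measurableSet_Ioi
      (fun x hx => hx.1) fun x hx => hw x ?_
    by_contra hcon
    exact hx.2 ⟨hx.1, not_lt.1 hcon⟩
  rw [red _ fun x hx => by rw [hRd' x ((le_max_right _ _).trans hx.le), mul_zero],
    red _ fun x hx => by rw [hRψ' x ((le_max_left _ _).trans hx.le), mul_zero]]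
  -- The primitive of a merely integrable function need not be C¹, so integration by parts is done
  -- for absolutely continuous functions.
  have hac1 := hvi.absolutelyContinuousOnInterval_intervalIntegral (c := 0) (by simp)
  have hac2 : AbsolutelyContinuousOnInterval ψ 0 b := by
    obtain ⟨K, hK⟩ := hψ.lipschitzWith_of_hasCompactSupport hc one_ne_zero
    exact (hK.lipschitzOnWith (s := uIcc 0 b)).absolutelyContinuousOnInterval
  have hac3 : AbsolutelyContinuousOnInterval (fun x => c + ∫ t in (0 : ℝ)..x, v t) 0 b := by
    have hcst : AbsolutelyContinuousOnInterval (fun _ : ℝ => c) 0 b :=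
      ((LipschitzWith.const c).lipschitzOnWith (s := uIcc 0 b)).absolutelyContinuousOnInterval
    exact hcst.add hac1
  rw [hac3.integral_mul_deriv_eq_deriv_mul hac2, hRψ' b (le_max_left _ _)]
  simp only [mul_zero, intervalIntegral.integral_same, add_zero, zero_sub, neg_mul]
  congr 1
  refine intervalIntegral.integral_congr_ae ?_
  filter_upwards [hvi.ae_hasDerivAt_integral] with x hx hxb
  rw [((hx (uIoc_subset_uIcc hxb) 0 (by simp)).const_add c).deriv]

/-- A function with a weak derivative on the half line is a primitive of it. -/
theorem exists_eq_primitive {u v : ℝ → ℝ} (hu : LocallyIntegrable u) (hv : LocallyIntegrable v)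
    (h : HasWeakDerivOn (Ioi 0) u v) :
    ∃ c : ℝ, ∀ᵐ x, x ∈ Ioi (0 : ℝ) → u x = c + ∫ t in (0 : ℝ)..x, v t := by
  have hcont : Continuous fun x => ∫ t in (0 : ℝ)..x, v t :=
    intervalIntegral.continuous_primitive (fun a b => (hv.integrableOn_isCompact isCompact_uIcc).intervalIntegrable) 0
  obtain ⟨c, hc⟩ := exists_const_of_weakDeriv_eq_zero
    (hu.sub hcont.locallyIntegrable) (by
      intro φ hφ hφc hφs
      have h1 := h φ hφ hφc hφs
      have h2 := integral_primitive_mul_deriv hv 0 (hφ.of_le (by simp)) hφc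
      simp only [smul_eq_mul] at h1
      simp only [zero_add, neg_zero, zero_mul, zero_sub] at h2
      have hd : Continuous (deriv φ) := hφ.continuous_deriv (by simp)
      have i1 := integrableOn_mul_of_hasCompactSupport hd hφc.deriv hu
      have i2 := integrableOn_mul_of_hasCompactSupport hd hφc.deriv hcont.locallyIntegrable
      simp only [Pi.sub_apply, mul_sub]
      rw [integral_sub i1.integrableOn i2.integrableOn, h1]
      simp only [mul_comm (deriv φ _)]
      rw [h2]
      simp only [mul_comm (v _)]
      ring)
  refine ⟨c, ?_⟩
  filter_upwards [hc] with x hx hx0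
  have := hx hx0
  simp only [Pi.sub_apply] at this
  linarith

/-- Extension by zero makes L² functions on the half line locally integrable on the whole line and
leaves integrals over `(0,∞)` unchanged. -/
theorem HasWeakDerivOn.indicator {u v : ℝ → ℝ} (h : HasWeakDerivOn (Ioi 0) u v) :
    HasWeakDerivOn (Ioi 0) ((Ioi 0).indicator u) ((Ioi 0).indicator v) := by
  intro φ h1 h2 h3
  have e : ∀ a b : ℝ → ℝ, ∫ x in Ioi (0 : ℝ), a x • (Ioi (0 : ℝ)).indicator b x =
      ∫ x in Ioi (0 : ℝ), a x • b x := fun a b =>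
    setIntegral_congr_fun measurableSet_Ioi fun x hx => by simp only [indicator_of_mem hx]
  rw [e, e]
  exact h φ h1 h2 h3

theorem memLp_indicator_Ioi {u : ℝ → ℝ} (h : MemLp u 2 (volume.restrict (Ioi 0))) :
    MemLp ((Ioi (0 : ℝ)).indicator u) 2 volume :=
  (memLp_indicator_iff_restrict measurableSet_Ioi).2 h

theorem locallyIntegrable_indicator_Ioi {u : ℝ → ℝ} (h : MemLp u 2 (volume.restrict (Ioi 0))) :
    LocallyIntegrable ((Ioi (0 : ℝ)).indicator u) :=
  (memLp_indicator_Ioi h).locallyIntegrable one_le_two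

/-- The energy identity for a product of two primitives that decays at infinity. -/
theorem integral_Ioi_deriv_mul_primitive {v w : ℝ → ℝ} {a c : ℝ} (hv : LocallyIntegrable v)
    (hw : LocallyIntegrable w)
    (hint : IntegrableOn (fun x => v x * (c + ∫ t in (0 : ℝ)..x, w t) +
      (a + ∫ t in (0 : ℝ)..x, v t) * w x) (Ioi 0))
    (hprod : IntegrableOn (fun x => (a + ∫ t in (0 : ℝ)..x, v t) * (c + ∫ t in (0 : ℝ)..x, w t))
      (Ioi 0)) :
    ∫ x in Ioi (0 : ℝ), (v x * (c + ∫ t in (0 : ℝ)..x, w t) +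
      (a + ∫ t in (0 : ℝ)..x, v t) * w x) = -(a * c) := by
  have hac : ∀ (f : ℝ → ℝ) (b R : ℝ), LocallyIntegrable f →
      AbsolutelyContinuousOnInterval (fun x => b + ∫ t in (0 : ℝ)..x, f t) 0 R := by
    intro f b R hf
    have hcst : AbsolutelyContinuousOnInterval (fun _ : ℝ => b) 0 R :=
      ((LipschitzWith.const b).lipschitzOnWith (s := uIcc 0 R)).absolutelyContinuousOnInterval
    exact hcst.add ((hf.integrableOn_isCompact
      isCompact_uIcc).intervalIntegrable.absolutelyContinuousOnInterval_intervalIntegral (by simp))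
  have hlim := intervalIntegral_tendsto_integral_Ioi 0 hint tendsto_id
  have heq : ∀ R : ℝ, ∫ x in (0 : ℝ)..R, (v x * (c + ∫ t in (0 : ℝ)..x, w t) +
      (a + ∫ t in (0 : ℝ)..x, v t) * w x) =
      (a + ∫ t in (0 : ℝ)..R, v t) * (c + ∫ t in (0 : ℝ)..R, w t) - a * c := by
    intro R
    have h1 := (hac v a R hv).integral_deriv_mul_eq_sub (hac w c R hw)
    simp only [intervalIntegral.integral_same, add_zero] at h1
    rw [← h1]
    refine intervalIntegral.integral_congr_ae ?_
    filter_upwards [(hv.integrableOn_isCompact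
      (isCompact_uIcc (a := 0) (b := R))).intervalIntegrable.ae_hasDerivAt_integral,
      (hw.integrableOn_isCompact
      (isCompact_uIcc (a := 0) (b := R))).intervalIntegrable.ae_hasDerivAt_integral] with x h1 h2 hx
    have hx' := uIoc_subset_uIcc hx
    rw [((h1 hx' 0 (by simp)).const_add a).deriv, ((h2 hx' 0 (by simp)).const_add c).deriv]
  simp only [id, heq] at hlim
  have hlim2 := hlim.add_const (a * c)
  simp only [sub_add_cancel] at hlim2
  -- The product has a limit at infinity because its derivative is integrable; being integrable
  -- itself, that limit is `0`.
  have hz := IntegrableAtFilter.eq_zero_of_tendsto (μ := volume) (l := atTop)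
    ⟨Ioi 0, Ioi_mem_atTop 0, hprod⟩ (fun s hs => by
      obtain ⟨b, hb⟩ := mem_atTop_sets.1 hs
      exact measure_mono_top (fun x hx => hb x hx) Real.volume_Ici) hlim2
  linarith

/-- The derivative of a solution in `H²(0,∞)`, the weak formulation of the equation up to the
boundary and the energy identity. -/
theorem IsDecayingSolution.exists_deriv {V φ : ℝ → ℝ} (h : IsDecayingSolution V φ) :
    ∃ d : ℝ → ℝ, Continuous d ∧ MemLp φ 2 (volume.restrict (Ioi 0)) ∧
      MemLp d 2 (volume.restrict (Ioi 0)) ∧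
      (∀ ψ : ℝ → ℝ, ContDiff ℝ 1 ψ → HasCompactSupport ψ →
        ∫ x in Ioi (0 : ℝ), φ x * deriv ψ x = -ψ 0 - ∫ x in Ioi (0 : ℝ), d x * ψ x) ∧
      (∀ ψ : ℝ → ℝ, ContDiff ℝ 1 ψ → HasCompactSupport ψ →
        ∫ x in Ioi (0 : ℝ), d x * deriv ψ x =
          -derivZero φ * ψ 0 + ∫ x in Ioi (0 : ℝ), V x * φ x * ψ x) ∧
      ∫ x in Ioi (0 : ℝ), d x ^ 2 = -derivZero φ + ∫ x in Ioi (0 : ℝ), V x * φ x ^ 2 := by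
  obtain ⟨d₁, d₂, hφ, hd₁, hd₂, hw₁, hw₂, heq⟩ := h.sobolev
  have lφ := locallyIntegrable_indicator_Ioi hφ
  have l₁ := locallyIntegrable_indicator_Ioi hd₁
  have l₂ := locallyIntegrable_indicator_Ioi hd₂
  obtain ⟨c, hc⟩ := exists_eq_primitive l₁ l₂ hw₂.indicator
  obtain ⟨c', hc'⟩ := exists_eq_primitive lφ l₁ hw₁.indicator
  set w := (Ioi (0 : ℝ)).indicator d₂ with hw
  set d : ℝ → ℝ := fun x => c + ∫ t in (0 : ℝ)..x, w t with hd
  have hdcont : Continuous d := continuous_const.add (intervalIntegral.continuous_primitive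
    (fun a b => (l₂.integrableOn_isCompact isCompact_uIcc).intervalIntegrable) 0)
  have hdd : d =ᵐ[volume.restrict (Ioi 0)] d₁ := by
    rw [EventuallyEq, ae_restrict_iff' measurableSet_Ioi]
    filter_upwards [hc] with x hx hx0
    have := hx hx0
    rw [indicator_of_mem hx0] at this
    exact this.symm
  have hdL : MemLp d 2 (volume.restrict (Ioi 0)) := (memLp_congr_ae hdd).2 hd₁
  set P : ℝ → ℝ := fun x => ∫ t in (0 : ℝ)..x, d t with hP
  have hPcont : Continuous P := intervalIntegral.continuous_primitive
    (fun a b => hdcont.intervalIntegrable _ _) 0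
  have hprim : ∀ x : ℝ, 0 ≤ x → ∫ t in (0 : ℝ)..x, (Ioi (0 : ℝ)).indicator d₁ t = P x := by
    intro x hx
    refine intervalIntegral.integral_congr_ae ?_
    filter_upwards [hc] with t ht htx
    rw [uIoc_of_le hx] at htx
    exact ht htx.1
  have hφP : EqOn φ (fun x => c' + P x) (Ici 0) := by
    refine Measure.eqOn_of_ae_eq (μ := volume) ?_ h.continuousOn
      (continuous_const.add hPcont).continuousOn (by simp)
    rw [← restrict_Ioi_eq_restrict_Ici, EventuallyEq, ae_restrict_iff' measurableSet_Ioi]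
    filter_upwards [hc'] with x hx hx0
    rw [← hprim x (le_of_lt hx0), ← hx hx0, indicator_of_mem hx0]
  have hc1 : c' = 1 := by
    have := hφP (mem_Ici.2 le_rfl)
    simp only [h.at_zero, hP, intervalIntegral.integral_same, add_zero] at this
    exact this.symm
  rw [hc1] at hφP
  -- The continuous representative of the derivative has a value at `0`, and this value is the
  -- one-sided derivative in `derivZero`.
  have hd0 : derivZero φ = c := by
    have h1 : HasDerivAt (fun x => 1 + P x) (d 0) 0 :=
      ((hdcont.integral_hasStrictDerivAt 0 0).hasDerivAt).const_add 1
    have h2 : HasDerivWithinAt φ (d 0) (Ici 0) 0 :=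
      h1.hasDerivWithinAt.congr hφP (hφP (mem_Ici.2 le_rfl))
    rw [derivZero, h2.derivWithin (uniqueDiffOn_Ici 0 0 (mem_Ici.2 le_rfl))]
    simp [hd]
  have hwV : ∀ᵐ x ∂(volume.restrict (Ioi (0 : ℝ))), w x = -(V x * φ x) := by
    filter_upwards [heq, ae_restrict_mem measurableSet_Ioi] with x hx hx0
    rw [hw, indicator_of_mem hx0]
    linarith
  have hwL : MemLp w 2 (volume.restrict (Ioi 0)) := (memLp_indicator_Ioi hd₂).restrict _
  refine ⟨d, hdcont, hφ, hdL, fun ψ h1 h2 => ?_, fun ψ h1 h2 => ?_, ?_⟩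
  · have := integral_primitive_mul_deriv hdcont.locallyIntegrable 1 h1 h2
    rw [neg_one_mul] at this
    rw [← this]
    refine setIntegral_congr_fun measurableSet_Ioi fun x hx => ?_
    simp only [hφP (mem_Ici.2 (le_of_lt hx)), hP]
  · have := integral_primitive_mul_deriv l₂ c h1 h2
    rw [this, hd0, sub_eq_add_neg, ← integral_neg]
    congr 1
    refine integral_congr_ae ?_
    filter_upwards [hwV] with x hx
    rw [hx]; ring
  -- Energy identity: integrate `(φ φ')' = φ'² + φ φ''` over the half line and insert `φ'' = -Vφ`.
  · have hφae : (fun x => 1 + P x) =ᵐ[volume.restrict (Ioi 0)] φ := by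
      filter_upwards [ae_restrict_mem measurableSet_Ioi] with x hx
      exact (hφP (mem_Ici.2 (le_of_lt hx))).symm
    have hPL : MemLp (fun x => 1 + P x) 2 (volume.restrict (Ioi 0)) :=
      (memLp_congr_ae hφae).2 hφ
    have i1 : IntegrableOn (fun x => d x * d x) (Ioi 0) := hdL.integrable_mul hdL
    have i2 : IntegrableOn (fun x => (1 + P x) * w x) (Ioi 0) := hPL.integrable_mul hwL
    have i3 : IntegrableOn (fun x => (1 + P x) * d x) (Ioi 0) := hPL.integrable_mul hdL
    have key := integral_Ioi_deriv_mul_primitive (a := 1) (c := c) hdcont.locallyIntegrable l₂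
      (i1.add i2) i3
    have e : ∫ x in Ioi (0 : ℝ), (d x * d x + (1 + P x) * w x) = -(1 * c) := key
    rw [integral_add i1 i2] at e
    have e2 : ∫ x in Ioi (0 : ℝ), (1 + P x) * w x = -∫ x in Ioi (0 : ℝ), V x * φ x ^ 2 := by
      rw [← integral_neg]
      refine integral_congr_ae ?_
      filter_upwards [hwV, hφae] with x h1 h2
      rw [h1, h2]; ring
    rw [e2] at e
    simp only [pow_two (d _)]
    rw [hd0]
    linarith

end HalfLine

/-! ### Even reflection of the half-line profiles. -/

section WholeLine

open Set

/-- The odd extension to `ℝ` of a function on `(0,∞)`. -/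
def oddExt (d : ℝ → ℝ) (x : ℝ) : ℝ :=
  (Ioi (0 : ℝ)).indicator d x - (Ioi (0 : ℝ)).indicator d (-x)

theorem memLp_comp_neg {u : ℝ → ℝ} {p : ℝ≥0∞} (h : MemLp u p volume) :
    MemLp (fun x => u (-x)) p volume :=
  h.comp_measurePreserving (Measure.measurePreserving_neg volume)

theorem comp_abs_ae_eq (φ : ℝ → ℝ) : (fun x => φ |x|) =ᵐ[volume]
    fun x => (Ioi (0 : ℝ)).indicator φ x + (Ioi (0 : ℝ)).indicator φ (-x) := by
  have h0 : ∀ᵐ x : ℝ, x ≠ 0 := by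
    simp [ae_iff, measure_singleton]
  filter_upwards [h0] with x hx
  rcases lt_or_gt_of_ne hx with h | h
  · have h1 : x ∉ Ioi (0 : ℝ) := by simp [h.le]
    have h2 : -x ∈ Ioi (0 : ℝ) := by simp [h]
    rw [indicator_of_notMem h1, indicator_of_mem h2, abs_of_neg h, zero_add]
  · have h1 : x ∈ Ioi (0 : ℝ) := h
    have h2 : -x ∉ Ioi (0 : ℝ) := by simp [h.le]
    rw [indicator_of_mem h1, indicator_of_notMem h2, abs_of_pos h, add_zero]

variable {d φ V : ℝ → ℝ}

theorem memLp_comp_abs (h : MemLp φ 2 (volume.restrict (Ioi 0))) :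
    MemLp (fun x => φ |x|) 2 volume :=
  (memLp_congr_ae (comp_abs_ae_eq φ)).2
    ((memLp_indicator_Ioi h).add (memLp_comp_neg (memLp_indicator_Ioi h)))

theorem memLp_oddExt (h : MemLp d 2 (volume.restrict (Ioi 0))) : MemLp (oddExt d) 2 volume :=
  (memLp_indicator_Ioi h).sub (memLp_comp_neg (memLp_indicator_Ioi h))

theorem integral_indicator_mul (d w : ℝ → ℝ) :
    ∫ x, (Ioi (0 : ℝ)).indicator d x * w x = ∫ x in Ioi (0 : ℝ), d x * w x := by
  rw [← integral_indicator measurableSet_Ioi]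
  congr 1
  ext x
  by_cases hx : x ∈ Ioi (0 : ℝ)
  · rw [indicator_of_mem hx, indicator_of_mem hx]
  · rw [indicator_of_notMem hx, indicator_of_notMem hx, zero_mul]

theorem integral_indicator_neg_mul (d w : ℝ → ℝ) :
    ∫ x, (Ioi (0 : ℝ)).indicator d (-x) * w x = ∫ x in Ioi (0 : ℝ), d x * w (-x) := by
  rw [← integral_indicator_mul d fun x => w (-x),
    ← integral_neg_eq_self fun x => (Ioi (0 : ℝ)).indicator d x * w (-x)]
  simp only [neg_neg]

theorem integral_oddExt_mul (h : MemLp d 2 (volume.restrict (Ioi 0))) {w : ℝ → ℝ}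
    (hw : MemLp w 2 volume) : ∫ x, oddExt d x * w x =
      (∫ x in Ioi (0 : ℝ), d x * w x) - ∫ x in Ioi (0 : ℝ), d x * w (-x) := by
  have h1 := memLp_indicator_Ioi h
  have i1 : Integrable (fun x => (Ioi (0 : ℝ)).indicator d x * w x) := h1.integrable_mul hw
  have i2 : Integrable (fun x => (Ioi (0 : ℝ)).indicator d (-x) * w x) :=
    (memLp_comp_neg h1).integrable_mul hw
  rw [← integral_indicator_mul, ← integral_indicator_neg_mul, ← integral_sub i1 i2]
  simp only [oddExt, sub_mul]

theorem integral_comp_abs_mul (h : MemLp φ 2 (volume.restrict (Ioi 0))) {w : ℝ → ℝ}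
    (hw : MemLp w 2 volume) : ∫ x, φ |x| * w x =
      (∫ x in Ioi (0 : ℝ), φ x * w x) + ∫ x in Ioi (0 : ℝ), φ x * w (-x) := by
  have h1 := memLp_indicator_Ioi h
  have i1 : Integrable (fun x => (Ioi (0 : ℝ)).indicator φ x * w x) := h1.integrable_mul hw
  have i2 : Integrable (fun x => (Ioi (0 : ℝ)).indicator φ (-x) * w x) :=
    (memLp_comp_neg h1).integrable_mul hw
  rw [← integral_indicator_mul, ← integral_indicator_neg_mul, ← integral_add i1 i2]
  refine integral_congr_ae ?_
  filter_upwards [comp_abs_ae_eq φ] with x hx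
  rw [hx, add_mul]

theorem contDiff_comp_neg {ψ : ℝ → ℝ} (h : ContDiff ℝ 1 ψ) : ContDiff ℝ 1 fun x => ψ (-x) :=
  h.comp contDiff_neg

theorem deriv_comp_neg' (ψ : ℝ → ℝ) (x : ℝ) : deriv (fun x => ψ (-x)) x = -deriv ψ (-x) :=
  deriv_comp_neg ψ x

theorem memLp_of_hasCompactSupport {ψ : ℝ → ℝ} (h : Continuous ψ) (hc : HasCompactSupport ψ) :
    MemLp ψ 2 volume :=
  h.memLp_of_hasCompactSupport hc

/-- The even extension of a decaying solution to the whole line, its derivative `D` and the weak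
formulation of the equation with the jump of the derivative at the origin. -/
theorem IsDecayingSolution.exists_extension (h : IsDecayingSolution V φ)
    (hV : ∀ᵐ x, V (-x) = V x) (hVm : MemLp V ∞ volume) :
    ∃ D : ℝ → ℝ, MemLp (fun x => φ |x|) 2 volume ∧ MemLp D 2 volume ∧
      (∀ ψ : ℝ → ℝ, ContDiff ℝ 1 ψ → HasCompactSupport ψ →
        ∫ x, φ |x| * deriv ψ x = -∫ x, D x * ψ x) ∧
      (∀ ψ : ℝ → ℝ, ContDiff ℝ 1 ψ → HasCompactSupport ψ →
        ∫ x, D x * deriv ψ x = -2 * derivZero φ * ψ 0 + ∫ x, V x * φ |x| * ψ x) ∧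
      ∫ x, D x ^ 2 = -2 * derivZero φ + ∫ x, V x * φ |x| ^ 2 := by
  obtain ⟨d, -, hφ, hd, B1, B2, B3⟩ := h.exists_deriv
  have hVφ : MemLp (fun x => V x * φ |x|) 2 volume := by
    exact (memLp_comp_abs hφ).mul' hVm
  have hVφ' : MemLp (fun x => V x * φ x) 2 (volume.restrict (Ioi 0)) :=
    hφ.mul' (hVm.restrict _)
  have habs : ∀ᵐ x : ℝ, V x * φ |x| = (fun x => V x * φ x) |x| := by
    filter_upwards [hV] with x hx
    rcases le_total 0 x with h0 | h0
    · simp only [abs_of_nonneg h0]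
    · simp only [abs_of_nonpos h0, hx]
  have hVw : ∀ {w : ℝ → ℝ}, MemLp w 2 volume → ∫ x, V x * φ |x| * w x =
      (∫ x in Ioi (0 : ℝ), V x * φ x * w x) + ∫ x in Ioi (0 : ℝ), V x * φ x * w (-x) := by
    intro w hw
    rw [← integral_comp_abs_mul (φ := fun x => V x * φ x) hVφ' hw]
    refine integral_congr_ae ?_
    filter_upwards [habs] with x hx
    rw [hx]
  refine ⟨oddExt d, memLp_comp_abs hφ, memLp_oddExt hd, fun ψ h1 h2 => ?_, fun ψ h1 h2 => ?_, ?_⟩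
  · have hψ' := memLp_of_hasCompactSupport (h1.continuous_deriv le_rfl) h2.deriv
    have hψ := memLp_of_hasCompactSupport h1.continuous h2
    have e1 := B1 ψ h1 h2
    -- The half-line identity is used for `ψ` and for its reflection; the boundary values at `0`
    -- cancel since the even extension is continuous.
    have e2 := B1 (fun x => ψ (-x)) (contDiff_comp_neg h1) (h2.comp_homeomorph (Homeomorph.neg ℝ))
    simp only [deriv_comp_neg', mul_neg, neg_zero, integral_neg] at e2
    rw [integral_comp_abs_mul hφ hψ', integral_oddExt_mul hd hψ]
    linarith
  · have hψ' := memLp_of_hasCompactSupport (h1.continuous_deriv le_rfl) h2.deriv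
    have hψ := memLp_of_hasCompactSupport h1.continuous h2
    have e1 := B2 ψ h1 h2
    -- For the odd derivative the two boundary values add up, which gives the factor `2` in the
    -- jump.
    have e2 := B2 (fun x => ψ (-x)) (contDiff_comp_neg h1) (h2.comp_homeomorph (Homeomorph.neg ℝ))
    simp only [deriv_comp_neg', mul_neg, neg_zero, integral_neg] at e2
    rw [integral_oddExt_mul hd hψ', hVw hψ]
    linarith
  · have e1 : ∫ x, oddExt d x ^ 2 = 2 * ∫ x in Ioi (0 : ℝ), d x ^ 2 := by
      have h3 := integral_oddExt_mul hd (memLp_oddExt hd)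
      have h4 : ∫ x in Ioi (0 : ℝ), d x * oddExt d x = ∫ x in Ioi (0 : ℝ), d x ^ 2 := by
        refine setIntegral_congr_fun measurableSet_Ioi fun x hx => ?_
        have : -x ∉ Ioi (0 : ℝ) := by simp [(mem_Ioi.1 hx).le]
        simp only [oddExt, indicator_of_mem hx, indicator_of_notMem this]
        ring
      have h5 : ∫ x in Ioi (0 : ℝ), d x * oddExt d (-x) = -∫ x in Ioi (0 : ℝ), d x ^ 2 := by
        rw [← integral_neg]
        refine setIntegral_congr_fun measurableSet_Ioi fun x hx => ?_
        have : -x ∉ Ioi (0 : ℝ) := by simp [(mem_Ioi.1 hx).le]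
        simp only [oddExt, neg_neg, indicator_of_mem hx, indicator_of_notMem this]
        ring
      simp only [pow_two (oddExt d _)]
      rw [h3, h4, h5]
      ring
    have e2 : ∫ x, V x * φ |x| ^ 2 = 2 * ∫ x in Ioi (0 : ℝ), V x * φ x ^ 2 := by
      have h3 := hVw (memLp_comp_abs hφ)
      have h4 : ∀ x ∈ Ioi (0 : ℝ), V x * φ x * φ |x| = V x * φ x ^ 2 := fun x hx => by
        rw [abs_of_pos hx]; ring
      simp only [abs_neg] at h3
      rw [setIntegral_congr_fun measurableSet_Ioi h4] at h3
      rw [two_mul, ← h3]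
      congr 1; ext x; ring
    rw [e1, e2, B3]
    ring

end WholeLine

/-! ### Orthogonal series of products in L² of the strip. -/

section Strip

open Set

/-- Lebesgue measure on a fundamental domain. -/
theorem volume_restrict_strip (T : ℝ) : (volume : Measure (ℝ × ℝ)).restrict (strip T) =
    (volume : Measure ℝ).prod (volume.restrict (Ioc 0 T)) := by
  rw [strip, Measure.volume_eq_prod, ← Measure.prod_restrict, Measure.restrict_univ]

variable {T : ℝ}

theorem memLp_mul_strip {u c : ℝ → ℝ} {B : ℝ} (hu : MemLp u 2 volume) (hc : Continuous c)
    (hB : ∀ t, |c t| ≤ B) :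
    MemLp (fun z : ℝ × ℝ => u z.1 * c z.2) 2 (volume.restrict (strip T)) := by
  rw [volume_restrict_strip]
  have h1 : MemLp (fun z : ℝ × ℝ => u z.1) 2
      ((volume : Measure ℝ).prod (volume.restrict (Ioc 0 T))) := hu.comp_fst _
  have h2 : MemLp (fun z : ℝ × ℝ => c z.2) ∞
      ((volume : Measure ℝ).prod (volume.restrict (Ioc 0 T))) :=
    memLp_top_of_bound (by fun_prop) B (ae_of_all _ fun z => hB z.2)
  exact h2.mul' h1

/-- Summation of a series of functions `uₙ(x) cₙ(t)` with orthogonal `cₙ`. -/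
theorem exists_orthogonal_series {u c : ℕ → ℝ → ℝ} (hu : ∀ n, MemLp (u n) 2 volume)
    (hc : ∀ n, Continuous (c n)) (hB : ∀ n t, |c n t| ≤ 1)
    (horth : ∀ n m, n ≠ m → ∫ t in Ioc 0 T, c n t * c m t = 0)
    (hs : Summable fun n => ∫ x, u n x ^ 2) :
    ∃ U : ℝ × ℝ → ℝ, MemLp U 2 (volume.restrict (strip T)) ∧
      ∀ ψ : ℝ × ℝ → ℝ, MemLp ψ 2 (volume.restrict (strip T)) →
        HasSum (fun n => ∫ z in strip T, u n z.1 * c n z.2 * ψ z) (∫ z in strip T, U z * ψ z) := by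
  have hv : ∀ n, MemLp (fun z : ℝ × ℝ => u n z.1 * c n z.2) 2 (volume.restrict (strip T)) :=
    fun n => memLp_mul_strip (hu n) (hc n) (hB n)
  set v : ℕ → Lp ℝ 2 ((volume : Measure (ℝ × ℝ)).restrict (strip T)) := fun n => (hv n).toLp
    with hvdef
  have hinner : ∀ {f g : ℝ × ℝ → ℝ} (hf : MemLp f 2 (volume.restrict (strip T)))
      (hg : MemLp g 2 (volume.restrict (strip T))),
      inner ℝ hf.toLp hg.toLp = ∫ z in strip T, f z * g z := by
    intro f g hf hg
    rw [L2.inner_def]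
    refine integral_congr_ae ?_
    filter_upwards [hf.coeFn_toLp, hg.coeFn_toLp] with z h1 h2
    rw [h1, h2, real_inner_eq_re_inner]
    simp [mul_comm]
  have hprod : ∀ n m, inner ℝ (v n) (v m) =
      (∫ x, u n x * u m x) * ∫ t in Ioc 0 T, c n t * c m t := by
    intro n m
    rw [hvdef, hinner (hv n) (hv m), volume_restrict_strip, ← integral_prod_mul]
    congr 1; ext z; ring
  -- Orthogonality in time alone suffices, as the inner product factorises. Only square summability
  -- is then needed, which is all that the differentiated series provide.
  have hO : OrthogonalFamily ℝ (fun n => (ℝ ∙ v n : Submodule ℝ _))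
      fun n => (ℝ ∙ v n : Submodule ℝ _).subtypeₗᵢ := by
    refine OrthogonalFamily.of_pairwise fun n m hnm => ?_
    change (ℝ ∙ v n) ⟂ (ℝ ∙ v m)
    rw [Submodule.isOrtho_span]
    rintro x rfl y rfl
    rw [hprod, horth n m hnm, mul_zero]
  have hsum : Summable v := by
    have := (hO.summable_iff_norm_sq_summable
      fun n => ⟨v n, Submodule.mem_span_singleton_self (v n)⟩).2 (by
        refine Summable.of_nonneg_of_le (fun n => sq_nonneg _) (fun n => ?_) (hs.mul_right |T|)
        change ‖v n‖ ^ 2 ≤ _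
        rw [← real_inner_self_eq_norm_sq, hprod]
        simp only [← pow_two]
        refine mul_le_mul_of_nonneg_left ?_ (integral_nonneg fun x => sq_nonneg _)
        have h1 : ‖∫ t in Ioc 0 T, c n t ^ 2‖ ≤ 1 * volume.real (Ioc 0 T) :=
          norm_setIntegral_le_of_norm_le_const measure_Ioc_lt_top fun t _ => by
            rw [norm_pow, Real.norm_eq_abs]
            exact pow_le_one₀ (abs_nonneg _) (hB n t)
        refine (le_abs_self _).trans (h1.trans ?_)
        rw [one_mul, Real.volume_real_Ioc, sub_zero]
        exact max_le (le_abs_self _) (abs_nonneg _))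
    exact this
  refine ⟨(∑' n, v n : Lp ℝ 2 ((volume : Measure (ℝ × ℝ)).restrict (strip T))), Lp.memLp _,
    fun ψ hψ => ?_⟩
  have h1 := hsum.hasSum.mapL (innerSL ℝ hψ.toLp)
  simp only [innerSL_apply_apply] at h1
  have e : ∫ z in strip T, (∑' n, v n : Lp ℝ 2 ((volume : Measure (ℝ × ℝ)).restrict (strip T))) z
      * ψ z = inner ℝ hψ.toLp (∑' n, v n) := by
    have := hinner (Lp.memLp (∑' n, v n)) hψ
    rw [Lp.toLp_coeFn, real_inner_comm] at this
    exact this.symm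
  rw [e]
  refine h1.congr_fun fun n => ?_
  rw [real_inner_comm, hvdef, hinner (hv n) hψ]

end Strip

/-! ### Regularity and integrability of test functions on the strip. -/

section TestFunctions

open Set

variable {T : ℝ} {ψ : ℝ × ℝ → ℝ}

theorem hasDerivAt_fst (h : ContDiff ℝ ((⊤ : ℕ∞) : WithTop ℕ∞) ψ) (z : ℝ × ℝ) :
    HasDerivAt (fun s => ψ (s, z.2)) (fderiv ℝ ψ z (1, 0)) z.1 := by
  have h1 : HasFDerivAt ψ (fderiv ℝ ψ z) z := (h.differentiable (by simp) z).hasFDerivAt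
  exact h1.comp_hasDerivAt z.1 ((hasDerivAt_id z.1).prodMk (hasDerivAt_const z.1 z.2))

theorem hasDerivAt_snd (h : ContDiff ℝ ((⊤ : ℕ∞) : WithTop ℕ∞) ψ) (z : ℝ × ℝ) :
    HasDerivAt (fun s => ψ (z.1, s)) (fderiv ℝ ψ z (0, 1)) z.2 := by
  have h1 : HasFDerivAt ψ (fderiv ℝ ψ z) z := (h.differentiable (by simp) z).hasFDerivAt
  exact h1.comp_hasDerivAt z.2 ((hasDerivAt_const z.2 z.1).prodMk (hasDerivAt_id z.2))

theorem continuous_dx (h : ContDiff ℝ ((⊤ : ℕ∞) : WithTop ℕ∞) ψ) : Continuous (dx ψ) := by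
  have : dx ψ = fun z => fderiv ℝ ψ z (1, 0) := funext fun z => (hasDerivAt_fst h z).deriv
  rw [this]
  exact (h.continuous_fderiv (by simp)).clm_apply continuous_const

theorem continuous_dt (h : ContDiff ℝ ((⊤ : ℕ∞) : WithTop ℕ∞) ψ) : Continuous (dt ψ) := by
  have : dt ψ = fun z => fderiv ℝ ψ z (0, 1) := funext fun z => (hasDerivAt_snd h z).deriv
  rw [this]
  exact (h.continuous_fderiv (by simp)).clm_apply continuous_const

theorem memLp_strip_of_continuous {f : ℝ × ℝ → ℝ} (hf : Continuous f) {R : ℝ}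
    (hR : ∀ x t, R < |x| → f (x, t) = 0) : MemLp f 2 (volume.restrict (strip T)) := by
  set K : Set (ℝ × ℝ) := Icc (-R) R ×ˢ Icc 0 T with hK
  have hKc : IsCompact K := isCompact_Icc.prod isCompact_Icc
  obtain ⟨B, hB⟩ := hKc.exists_bound_of_continuousOn hf.continuousOn
  have : IsFiniteMeasure ((volume : Measure (ℝ × ℝ)).restrict K) :=
    ⟨by rw [Measure.restrict_apply_univ]; exact hKc.measure_lt_top⟩
  have h1 : MemLp f 2 (volume.restrict K) := by
    refine MemLp.of_bound hf.aestronglyMeasurable B ?_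
    filter_upwards [ae_restrict_mem hKc.measurableSet] with z hz
    exact hB z hz
  have h2 := ((memLp_indicator_iff_restrict hKc.measurableSet).2 h1).restrict (strip T)
  refine h2.ae_eq ?_
  have hms : MeasurableSet (strip T) := MeasurableSet.univ.prod measurableSet_Ioc
  filter_upwards [ae_restrict_mem hms] with z hz
  by_cases hzK : z ∈ K
  · rw [indicator_of_mem hzK]
  · rw [indicator_of_notMem hzK]
    refine (hR z.1 z.2 ?_).symm
    by_contra hcon
    exact hzK ⟨abs_le.1 (not_lt.1 hcon), hz.2.1.le, hz.2.2⟩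

namespace IsTestFunction

theorem memLp (h : IsTestFunction T ψ) : MemLp ψ 2 (volume.restrict (strip T)) := by
  obtain ⟨R, hR⟩ := h.compact_support
  exact memLp_strip_of_continuous h.smooth.continuous hR

theorem memLp_dx (h : IsTestFunction T ψ) : MemLp (dx ψ) 2 (volume.restrict (strip T)) := by
  obtain ⟨R, hR⟩ := h.compact_support
  refine memLp_strip_of_continuous (continuous_dx h.smooth) (R := R) fun x t hx => ?_
  have : (fun s => ψ (s, t)) =ᶠ[𝓝 x] fun _ => 0 := by
    filter_upwards [continuous_abs.continuousAt.eventually_const_lt hx] with s hs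
    exact hR s t hs
  change deriv (fun s => ψ (s, t)) x = 0
  rw [this.deriv_eq, deriv_const]

theorem memLp_dt (h : IsTestFunction T ψ) : MemLp (dt ψ) 2 (volume.restrict (strip T)) := by
  obtain ⟨R, hR⟩ := h.compact_support
  refine memLp_strip_of_continuous (continuous_dt h.smooth) (R := R) fun x t hx => ?_
  change deriv (fun s => ψ (x, s)) t = 0
  simp only [hR x _ hx, deriv_const]

theorem contDiff_fst (h : IsTestFunction T ψ) (t : ℝ) :
    ContDiff ℝ ((⊤ : ℕ∞) : WithTop ℕ∞) fun x => ψ (x, t) :=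
  h.smooth.comp (contDiff_id.prodMk contDiff_const)

theorem contDiff_snd (h : IsTestFunction T ψ) (x : ℝ) :
    ContDiff ℝ ((⊤ : ℕ∞) : WithTop ℕ∞) fun t => ψ (x, t) :=
  h.smooth.comp (contDiff_const.prodMk contDiff_id)

theorem hasCompactSupport_fst (h : IsTestFunction T ψ) (t : ℝ) :
    HasCompactSupport fun x => ψ (x, t) := by
  obtain ⟨R, hR⟩ := h.compact_support
  refine HasCompactSupport.of_support_subset_isCompact (isCompact_Icc (a := -R) (b := R)) ?_
  intro x hx
  by_contra hcon
  refine hx (hR x t ?_)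
  by_contra h'
  exact hcon (abs_le.1 (not_lt.1 h'))

end IsTestFunction

end TestFunctions

/-! ### Trigonometric modes: integration by parts in time and space. -/

section Modes

open Set

variable {T κ : ℝ}

theorem cos_sin_period (hκ : ∃ m : ℤ, κ * T = 2 * Real.pi * m) :
    Real.cos (κ * T) = 1 ∧ Real.sin (κ * T) = 0 := by
  obtain ⟨m, hm⟩ := hκ
  rw [hm, mul_comm]
  exact ⟨Real.cos_int_mul_two_pi m, by
    have := Real.sin_int_mul_pi (m * 2)
    push_cast at this
    rwa [mul_assoc] at this⟩

theorem hasDerivAt_cos_mul (κ t : ℝ) :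
    HasDerivAt (fun t => Real.cos (κ * t)) (-(κ * Real.sin (κ * t))) t := by
  have := ((hasDerivAt_id t).const_mul κ).cos
  simp only [id, mul_one] at this
  convert this using 1
  ring

theorem hasDerivAt_sin_mul (κ t : ℝ) :
    HasDerivAt (fun t => Real.sin (κ * t)) (κ * Real.cos (κ * t)) t := by
  have := ((hasDerivAt_id t).const_mul κ).sin
  simp only [id, mul_one] at this
  convert this using 1
  ring

/-- The boundary terms cancel because the mode and `χ` are both `T`-periodic. -/
theorem integral_cos_sin_mul_deriv (hT : 0 ≤ T) (hκ : ∃ m : ℤ, κ * T = 2 * Real.pi * m)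
    {χ : ℝ → ℝ} (hχ : ContDiff ℝ 1 χ) (hper : ∀ t, χ (t + T) = χ t) :
    (∫ t in Ioc 0 T, Real.cos (κ * t) * deriv χ t = κ * ∫ t in Ioc 0 T, Real.sin (κ * t) * χ t) ∧
    ∫ t in Ioc 0 T, Real.sin (κ * t) * deriv χ t =
      -(κ * ∫ t in Ioc 0 T, Real.cos (κ * t) * χ t) := by
  obtain ⟨hc, hs⟩ := cos_sin_period hκ
  have h0 : χ T = χ 0 := by simpa using hper 0
  have hd : ∀ t, HasDerivAt χ (deriv χ t) t := fun t =>
    (hχ.differentiable one_ne_zero t).hasDerivAt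
  have hdc : Continuous (deriv χ) := hχ.continuous_deriv le_rfl
  have c1 : Continuous fun t => Real.cos (κ * t) := by fun_prop
  have c2 : Continuous fun t => Real.sin (κ * t) := by fun_prop
  simp only [← intervalIntegral.integral_of_le hT]
  constructor
  · rw [intervalIntegral.integral_mul_deriv_eq_deriv_mul (u := fun t => Real.cos (κ * t))
      (fun t _ => hasDerivAt_cos_mul κ t) (fun t _ => hd t)
      ((c2.const_smul κ).neg.intervalIntegrable _ _) (hdc.intervalIntegrable _ _), hc, h0,
      ← intervalIntegral.integral_const_mul]
    simp only [mul_zero, Real.cos_zero, sub_self, zero_sub, ← intervalIntegral.integral_neg]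
    congr 1; ext t; ring
  · rw [intervalIntegral.integral_mul_deriv_eq_deriv_mul (u := fun t => Real.sin (κ * t))
      (fun t _ => hasDerivAt_sin_mul κ t) (fun t _ => hd t)
      ((c1.const_smul κ).intervalIntegrable _ _) (hdc.intervalIntegrable _ _), hs, h0,
      ← intervalIntegral.integral_const_mul]
    simp only [mul_zero, Real.sin_zero, zero_mul, sub_self, zero_sub]
    congr 2; ext t; ring

theorem integral_cos_period (hT : 0 ≤ T) (hκ : ∃ m : ℤ, κ * T = 2 * Real.pi * m) (h0 : κ ≠ 0) :
    ∫ t in Ioc 0 T, Real.cos (κ * t) = 0 := by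
  have h := (integral_cos_sin_mul_deriv hT hκ (χ := fun t => Real.sin (κ * t)) (by fun_prop)
    fun t => by
      obtain ⟨m, hm⟩ := hκ
      rw [mul_add, hm, mul_comm (2 * Real.pi)]
      exact Real.sin_add_int_mul_two_pi _ _)
  have h2 := integral_cos_sin_mul_deriv hT hκ (χ := fun _ => (1 : ℝ)) (by fun_prop) fun _ => rfl
  have h3 := h2.2
  simp only [deriv_const, mul_zero, integral_zero, mul_one] at h3
  have := neg_eq_zero.1 h3.symm
  exact (mul_eq_zero.1 this).resolve_left h0

/-- Orthogonality of the trigonometric functions. -/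
theorem integral_cos_mul_cos_and_sin_mul_sin {κ' : ℝ} (hT : 0 ≤ T)
    (hκ : ∃ m : ℤ, κ * T = 2 * Real.pi * m) (hκ' : ∃ m : ℤ, κ' * T = 2 * Real.pi * m)
    (h1 : κ - κ' ≠ 0) (h2 : κ + κ' ≠ 0) :
    (∫ t in Ioc 0 T, Real.cos (κ * t) * Real.cos (κ' * t) = 0) ∧
      ∫ t in Ioc 0 T, Real.sin (κ * t) * Real.sin (κ' * t) = 0 := by
  obtain ⟨m, hm⟩ := hκ
  obtain ⟨m', hm'⟩ := hκ'
  have e1 := integral_cos_period hT (κ := κ - κ') ⟨m - m', by push_cast; linarith⟩ h1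
  have e2 := integral_cos_period hT (κ := κ + κ') ⟨m + m', by push_cast; linarith⟩ h2
  have i : ∀ κ : ℝ, IntegrableOn (fun t => Real.cos (κ * t)) (Ioc 0 T) := fun κ =>
    (Continuous.integrableOn_Icc (by fun_prop)).mono_set Ioc_subset_Icc_self
  constructor
  · have : ∀ t, Real.cos (κ * t) * Real.cos (κ' * t) =
        1 / 2 * (Real.cos ((κ - κ') * t) + Real.cos ((κ + κ') * t)) := fun t => by
      rw [sub_mul, add_mul, Real.cos_sub, Real.cos_add]; ring
    simp only [this]
    rw [integral_const_mul, integral_add (i _) (i _), e1, e2]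
    simp
  · have : ∀ t, Real.sin (κ * t) * Real.sin (κ' * t) =
        1 / 2 * (Real.cos ((κ - κ') * t) - Real.cos ((κ + κ') * t)) := fun t => by
      rw [sub_mul, add_mul, Real.cos_sub, Real.cos_add]; ring
    simp only [this]
    rw [integral_const_mul, integral_sub (i _) (i _), e1, e2]
    simp

/-- Fubini in both orders: integration by parts in `t` needs the inner time integral, integration by
parts in `x` the inner space integral. -/
theorem integral_strip_mul {h c : ℝ → ℝ} {ψ : ℝ × ℝ → ℝ} (hh : MemLp h 2 volume)
    (hc : Continuous c) (hB : ∀ t, |c t| ≤ 1) (hψ : MemLp ψ 2 (volume.restrict (strip T))) :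
    (∫ z in strip T, h z.1 * c z.2 * ψ z = ∫ x, h x * ∫ t in Ioc 0 T, c t * ψ (x, t)) ∧
      ∫ z in strip T, h z.1 * c z.2 * ψ z = ∫ t in Ioc 0 T, c t * ∫ x, h x * ψ (x, t) := by
  have hi : Integrable (fun z : ℝ × ℝ => h z.1 * c z.2 * ψ z) (volume.restrict (strip T)) :=
    (memLp_mul_strip hh hc hB).integrable_mul hψ
  rw [volume_restrict_strip] at hi ⊢
  constructor
  · rw [integral_prod _ hi]
    congr 1; ext x
    rw [← integral_const_mul]
    congr 1; ext t; ring
  · rw [integral_prod_symm _ hi]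
    congr 1; ext t
    rw [← integral_const_mul]
    congr 1; ext x; ring

theorem abs_cos_mul_le (κ t : ℝ) : |Real.cos (κ * t)| ≤ 1 := Real.abs_cos_le_one _

theorem abs_sin_mul_le (κ t : ℝ) : |Real.sin (κ * t)| ≤ 1 := Real.abs_sin_le_one _

/-- Integration by parts in time for a single mode. -/
theorem integral_strip_mode_dt {h : ℝ → ℝ} {ψ : ℝ × ℝ → ℝ} (hT : 0 ≤ T)
    (hκ : ∃ m : ℤ, κ * T = 2 * Real.pi * m) (hh : MemLp h 2 volume) (hψ : IsTestFunction T ψ) :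
    (∫ z in strip T, h z.1 * Real.cos (κ * z.2) * dt ψ z =
      κ * ∫ z in strip T, h z.1 * Real.sin (κ * z.2) * ψ z) ∧
    ∫ z in strip T, h z.1 * Real.sin (κ * z.2) * dt ψ z =
      -(κ * ∫ z in strip T, h z.1 * Real.cos (κ * z.2) * ψ z) := by
  have c1 : Continuous fun t => Real.cos (κ * t) := by fun_prop
  have c2 : Continuous fun t => Real.sin (κ * t) := by fun_prop
  have key := fun x => integral_cos_sin_mul_deriv hT hκ ((hψ.contDiff_snd x).of_le (by simp))
    (hψ.periodic x)
  rw [(integral_strip_mul hh c1 (abs_cos_mul_le κ) hψ.memLp_dt).1,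
    (integral_strip_mul hh c2 (abs_sin_mul_le κ) hψ.memLp_dt).1,
    (integral_strip_mul hh c1 (abs_cos_mul_le κ) hψ.memLp).1,
    (integral_strip_mul hh c2 (abs_sin_mul_le κ) hψ.memLp).1]
  constructor
  · rw [← integral_const_mul]
    congr 1; ext x
    have := (key x).1
    simp only [dt]
    rw [this]; ring
  · rw [← integral_const_mul, ← integral_neg]
    congr 1; ext x
    have := (key x).2
    simp only [dt]
    rw [this]; ring

/-- Integration by parts in space for a single mode. -/
theorem integral_strip_mode_dx {u D v c : ℝ → ℝ} {j : ℝ} {ψ : ℝ × ℝ → ℝ} (hu : MemLp u 2 volume)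
    (hD : MemLp D 2 volume) (hv : MemLp v 2 volume) (hc : Continuous c) (hB : ∀ t, |c t| ≤ 1)
    (hψ : IsTestFunction T ψ)
    (h1 : ∀ ψ : ℝ → ℝ, ContDiff ℝ 1 ψ → HasCompactSupport ψ →
        ∫ x, u x * deriv ψ x = -∫ x, D x * ψ x)
    (h2 : ∀ ψ : ℝ → ℝ, ContDiff ℝ 1 ψ → HasCompactSupport ψ →
        ∫ x, D x * deriv ψ x = j * ψ 0 + ∫ x, v x * ψ x) :
    (∫ z in strip T, u z.1 * c z.2 * dx ψ z = -∫ z in strip T, D z.1 * c z.2 * ψ z) ∧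
    ∫ z in strip T, D z.1 * c z.2 * dx ψ z =
      j * (∫ t in Ioc 0 T, c t * ψ (0, t)) + ∫ z in strip T, v z.1 * c z.2 * ψ z := by
  have e1 := fun t => h1 _ ((hψ.contDiff_fst t).of_le (by simp)) (hψ.hasCompactSupport_fst t)
  have e2 := fun t => h2 _ ((hψ.contDiff_fst t).of_le (by simp)) (hψ.hasCompactSupport_fst t)
  rw [(integral_strip_mul hu hc hB hψ.memLp_dx).2, (integral_strip_mul hD hc hB hψ.memLp_dx).2,
    (integral_strip_mul hD hc hB hψ.memLp).2, (integral_strip_mul hv hc hB hψ.memLp).2]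
  have i0 : IntegrableOn (fun t => c t * ψ (0, t)) (Ioc 0 T) := by
    have : Continuous fun t => c t * ψ (0, t) :=
      hc.mul (hψ.contDiff_snd 0).continuous
    exact this.integrableOn_Icc.mono_set Ioc_subset_Icc_self
  have iv : IntegrableOn (fun t => c t * ∫ x, v x * ψ (x, t)) (Ioc 0 T) := by
    have hi : Integrable (fun z : ℝ × ℝ => v z.1 * c z.2 * ψ z) (volume.restrict (strip T)) :=
      (memLp_mul_strip hv hc hB).integrable_mul hψ.memLp
    rw [volume_restrict_strip] at hi
    refine hi.integral_prod_right.congr (ae_of_all _ fun t => ?_)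
    simp only
    rw [← integral_const_mul]
    congr 1; ext x; ring
  constructor
  · rw [← integral_neg]
    congr 1; ext t
    have := e1 t
    simp only [dx]
    rw [this]; ring
  · rw [← integral_const_mul, ← integral_add (i0.const_mul j) iv]
    congr 1; ext t
    have := e2 t
    simp only [dx]
    rw [this]; ring

end Modes

/-! ### The weights of the quadratic part of J. -/

section Coupling

variable {γ ω : ℝ} {Φ : ℕ → ℝ → ℝ}

/-- The coefficients of the quadratic part of `J`, set to `0` at even integers. -/
def coupling (γ ω : ℝ) (Φ : ℕ → ℝ → ℝ) (k : ℤ) : ℝ :=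
  if Odd k then (2 * Real.pi / ω) / (γ * ω ^ 4) * (derivZero (Φ k.natAbs) / (k : ℝ) ^ 2) else 0

theorem coupling_neg (k : ℤ) : coupling γ ω Φ (-k) = coupling γ ω Φ k := by
  simp [coupling]

/-- Sequences in D(J) vanish at even integers, so the weights there may be set to zero; the growth
bound concerns odd `k` only. -/
theorem J_eq_energy {z : ℤ → ℝ} (hz : ∀ k : ℤ, Even k → z k = 0) :
    J γ ω Φ z = energy (coupling γ ω Φ) z := by
  rw [J, energy, ← tsum_mul_left]
  congr 2
  ext k
  rcases Int.even_or_odd k with hk | hk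
  · simp [hz k hk]
  · rw [coupling, if_pos hk]; ring

theorem isCriticalPoint_iff {α : ℤ → ℝ} :
    IsCriticalPoint γ ω Φ α ↔ EnergyCritical (coupling γ ω Φ) α := by
  refine and_congr_right fun hα => forall₂_congr fun ε _ => exists_congr fun δ =>
    and_congr_right fun _ => forall₂_congr fun y hy => ?_
  rw [J_eq_energy hα.support_odd, J_eq_energy fun k hk => by
    simp [hα.support_odd k hk, hy.support_odd k hk]]

/-- The growth `K k` divided by `k²`. At `k = 0` both sides are zero, since division by zero gives
zero. -/
theorem exists_abs_coupling_le
    (hgrowth : ∃ K : ℝ, ∀ k : ℕ, Odd k → |derivZero (Φ k)| ≤ K * k) :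
    ∃ C, 0 ≤ C ∧ ∀ k : ℤ, |coupling γ ω Φ k| ≤ C / |(k : ℝ)| := by
  obtain ⟨K, hK⟩ := hgrowth
  have hK0 : 0 ≤ K := by simpa using (abs_nonneg _).trans (hK 1 odd_one)
  refine ⟨|(2 * Real.pi / ω) / (γ * ω ^ 4)| * K, by positivity, fun k => ?_⟩
  rw [coupling]
  split_ifs with hk
  · have hk0 : (k : ℝ) ≠ 0 := by
      rintro h
      have : k = 0 := by exact_mod_cast h
      subst this
      simp at hk
    have hk1 : 0 < |(k : ℝ)| := abs_pos.2 hk0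
    have h := hK k.natAbs (Int.natAbs_odd.2 hk)
    rw [Nat.cast_natAbs, Int.cast_abs] at h
    rw [abs_mul, abs_div (derivZero _), mul_div_assoc |2 * Real.pi / ω / (γ * ω ^ 4)|, abs_pow]
    refine mul_le_mul_of_nonneg_left ?_ (abs_nonneg _)
    rw [div_le_div_iff₀ (by positivity) hk1]
    nlinarith
  · rw [abs_zero]; positivity

theorem abs_coupling_le_const {C : ℝ} (hC : 0 ≤ C)
    (h : ∀ k : ℤ, |coupling γ ω Φ k| ≤ C / |(k : ℝ)|) (k : ℤ) : |coupling γ ω Φ k| ≤ C := by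
  refine (h k).trans ?_
  rcases eq_or_ne k 0 with rfl | hk
  · simpa using hC
  · have : (1 : ℝ) ≤ |(k : ℝ)| := by exact_mod_cast Int.one_le_abs hk
    exact div_le_self hC this

theorem tendsto_coupling {C : ℝ} (h : ∀ k : ℤ, |coupling γ ω Φ k| ≤ C / |(k : ℝ)|) :
    Tendsto (coupling γ ω Φ) cofinite (𝓝 0) := by
  refine squeeze_zero_norm h ?_
  have h1 : Tendsto (fun k : ℤ => |(k : ℝ)|) cofinite atTop := by
    have := tendsto_norm_cocompact_atTop (E := ℝ)
    exact this.comp Int.tendsto_coe_cofinite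
  exact h1.const_div_atTop C

/-- Existence of a nonzero global minimizer of `J`. -/
theorem exists_isCriticalPoint_min (hω : 0 < ω)
    (hgrowth : ∃ K : ℝ, ∀ k : ℕ, Odd k → |derivZero (Φ k)| ≤ K * k)
    (h : (γ < 0 ∧ ∃ k : ℕ, Odd k ∧ 0 < derivZero (Φ k)) ∨
      (0 < γ ∧ ∃ k : ℕ, Odd k ∧ derivZero (Φ k) < 0)) :
    ∃ α : ℤ → ℝ, IsCriticalPoint γ ω Φ α ∧ α ≠ 0 ∧
      ∀ z : ℤ → ℝ, MemDomJ z → J γ ω Φ α ≤ J γ ω Φ z := by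
  obtain ⟨C, hC0, hC⟩ := exists_abs_coupling_le (γ := γ) (ω := ω) hgrowth
  have hk : ∃ k : ℕ, Odd k ∧ coupling γ ω Φ k < 0 := by
    have hp : 0 < 2 * Real.pi / ω := by positivity
    -- Both alternatives say that `Φ_k'(0)/γ` is negative for some odd `k`.
    have key : ∀ k : ℕ, Odd k → derivZero (Φ k) / γ < 0 → coupling γ ω Φ k < 0 := by
      intro k hk hneg
      have hk0 : (0 : ℝ) < k := by exact_mod_cast hk.pos
      rw [coupling, if_pos (by exact_mod_cast hk), Int.natAbs_natCast, Int.cast_natCast]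
      have : (2 * Real.pi / ω) / (γ * ω ^ 4) * (derivZero (Φ k) / (k : ℝ) ^ 2) =
          (2 * Real.pi / ω) / (ω ^ 4 * (k : ℝ) ^ 2) * (derivZero (Φ k) / γ) := by
        rw [div_mul_div_comm, div_mul_div_comm]; ring_nf
      rw [this]
      exact mul_neg_of_pos_of_neg (by positivity) hneg
    rcases h with ⟨hγ, k, hk, hpos⟩ | ⟨hγ, k, hk, hneg⟩
    · exact ⟨k, hk, key k hk (div_neg_of_pos_of_neg hpos hγ)⟩
    · exact ⟨k, hk, key k hk (div_neg_of_neg_of_pos hneg hγ)⟩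
  obtain ⟨k, hko, hkn⟩ := hk
  obtain ⟨α, h1, h2, h3⟩ := exists_energyCritical_min (abs_coupling_le_const hC0 hC)
    (tendsto_coupling hC) coupling_neg (k := (k : ℤ)) (by exact_mod_cast hko) hkn
  refine ⟨α, isCriticalPoint_iff.2 h1, h2, fun z hz => ?_⟩
  rw [J_eq_energy h1.1.support_odd, J_eq_energy hz.support_odd]
  exact h3 z hz

end Coupling

/-! ### Critical points of J as functions on the circle. -/

section CriticalCoefficients

variable {γ ω : ℝ} {Φ : ℕ → ℝ → ℝ} {T : ℝ} [hT : Fact (0 < T)]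

/-- The Euler–Lagrange equation and the regularity of critical points of `J`. -/
theorem IsCriticalPoint.exists_function {α : ℤ → ℝ} (h : IsCriticalPoint γ ω Φ α)
    (hgrowth : ∃ K : ℝ, ∀ k : ℕ, Odd k → |derivZero (Φ k)| ≤ K * k) :
    ∃ F : AddCircle T → ℝ, MemLp F 4 AddCircle.haarAddCircle ∧ HasSineCoeff α F ∧
      HasSineCoeff (fun k => -2 * coupling γ ω Φ k * α k) (fun t => F t ^ 3) ∧
      (Summable fun k : ℤ => (-2 * coupling γ ω Φ k * α k) ^ 2) ∧
      ∀ ν : ℝ, 0 < ν → ν < 1 / 4 → Summable fun k : ℤ => (1 + (k : ℝ) ^ 2) ^ ν * α k ^ 2 := by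
  obtain ⟨C, hC0, hC⟩ := exists_abs_coupling_le (γ := γ) (ω := ω) hgrowth
  obtain ⟨F, hF, hα⟩ := h.1.exists_hasSineCoeff (T := T)
  have hcrit := isCriticalPoint_iff.1 h
  have hb := fourierCoeff_cube_of_critical (abs_coupling_le_const hC0 hC) coupling_neg hcrit hα hF
  have hs := h.1.summable_sq
  -- Since `|r_k| |k| ≤ C`, the Euler-Lagrange equation gains one derivative: the cube of `F` is in
  -- H¹.
  have hb2 : ∀ k : ℤ, (k : ℝ) ^ 2 * (-2 * coupling γ ω Φ k * α k) ^ 2 ≤ 4 * C ^ 2 * α k ^ 2 := by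
    intro k
    rcases eq_or_ne k 0 with rfl | hk
    · simp; positivity
    · have hk1 : 0 < |(k : ℝ)| := abs_pos.2 (by exact_mod_cast hk)
      have h1 := (le_div_iff₀ hk1).1 (hC k)
      rw [← abs_mul] at h1
      have h2 : (coupling γ ω Φ k * k) ^ 2 ≤ C ^ 2 := sq_le_sq' (abs_le.1 h1).1 (abs_le.1 h1).2
      nlinarith [mul_le_mul_of_nonneg_right h2 (sq_nonneg (α k))]
  refine ⟨F, hF, hα, hb, ?_, fun ν hν0 hν => summable_weighted_sq hα hF hb ?_ hν0 hν⟩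
  · refine Summable.of_nonneg_of_le (fun _ => sq_nonneg _) (fun k => ?_)
      (hs.mul_left (4 * C ^ 2))
    have := abs_coupling_le_const hC0 hC k
    have h2 : (coupling γ ω Φ k) ^ 2 ≤ C ^ 2 := sq_le_sq' (abs_le.1 this).1 (abs_le.1 this).2
    nlinarith [mul_le_mul_of_nonneg_right h2 (sq_nonneg (α k))]
  · exact Summable.of_nonneg_of_le (fun _ => by positivity) hb2 (hs.mul_left (4 * C ^ 2))

end CriticalCoefficients

/-! ### Sums over odd integers as sums over pairs of opposite signs. -/

section OddIntegers

/-- The odd integers are parametrized by `ℤ`. -/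
def oddEquiv : ℤ ≃ {k : ℤ // Odd k} where
  toFun m := ⟨2 * m + 1, m, rfl⟩
  invFun k := k / 2
  left_inv m := by simp only; omega
  right_inv := by
    rintro ⟨k, m, rfl⟩
    ext
    simp only
    omega

theorem hasSum_odd {E : Type*} [NormedAddCommGroup E] {f : ℤ → E} {a : E} (hf : HasSum f a)
    (h0 : ∀ k, Even k → f k = 0) :
    HasSum (fun n : ℕ => f (2 * n + 1) + f (-(2 * n + 1))) a := by
  have hinj : Function.Injective fun m : ℤ => 2 * m + 1 := fun a b h => by simp only at h; omega
  have h1 : HasSum (fun m : ℤ => f (2 * m + 1)) a := by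
    refine (hinj.hasSum_iff fun k hk => h0 k ?_).2 hf
    rw [← Int.not_odd_iff_even]
    rintro ⟨m, rfl⟩
    exact hk ⟨m, rfl⟩
  convert h1.nat_add_neg_add_one using 4
  ring

theorem hasSum_subtype_odd {E : Type*} [NormedAddCommGroup E] {f : ℤ → E} {a b : E}
    (ha : HasSum (fun n : ℕ => f (2 * n + 1)) a) (hb : HasSum (fun n : ℕ => f (-(2 * n + 1))) b) :
    HasSum (fun k : {k : ℤ // Odd k} => f k) (a + b) := by
  rw [← oddEquiv.hasSum_iff]
  refine HasSum.of_nat_of_neg_add_one ha ?_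
  convert hb using 2 with n
  simp only [oddEquiv, Equiv.coe_fn_mk, Function.comp]
  ring_nf

end OddIntegers

/-! ### Angular frequencies of the odd modes. -/

section Frequencies

variable {T : ℝ}

/-- The angular frequencies of the odd modes. -/
def freq (T : ℝ) (n : ℕ) : ℝ := 2 * Real.pi * (2 * n + 1) / T

theorem freq_mul (hT : 0 < T) (n : ℕ) : ∃ m : ℤ, freq T n * T = 2 * Real.pi * m :=
  ⟨2 * n + 1, by rw [freq]; push_cast; field_simp⟩

theorem freq_pos (hT : 0 < T) (n : ℕ) : 0 < freq T n := by
  rw [freq]; positivity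

theorem freq_ne (hT : 0 < T) {n m : ℕ} (h : n ≠ m) : freq T n ≠ freq T m := by
  rw [freq, freq]
  intro h1
  have := Real.pi_pos
  field_simp at h1
  apply h
  have h2 : (n : ℝ) = m := by linarith
  exact_mod_cast h2

end Frequencies

/-! ### From the circle back to the interval `(0, T]`. -/

section Circle

open Set AddCircle

variable {T : ℝ} [hT : Fact (0 < T)]

theorem memLp_comp_coe {F : AddCircle T → ℝ} {p : ℝ≥0∞} (hF : MemLp F p haarAddCircle) :
    MemLp (fun t : ℝ => F t) p (volume.restrict (Ioc 0 T)) := by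
  have h1 : MemLp F p volume := by
    rw [volume_eq_smul_haarAddCircle]
    exact hF.smul_measure ENNReal.ofReal_ne_top
  have h2 := AddCircle.measurePreserving_mk T 0
  rw [zero_add] at h2
  exact h1.comp_measurePreserving h2

/-- Parseval's identity for a function with purely imaginary odd coefficients. -/
theorem HasSineCoeff.hasSum_integral {z : ℤ → ℝ} {F : AddCircle T → ℝ} (hz : HasSineCoeff z F)
    (hev : ∀ k, Even k → z k = 0) (hF : MemLp F 2 haarAddCircle) {h : ℝ → ℝ} (hh : Continuous h)
    (hper : ∀ t, h (t + T) = h t) :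
    HasSum (fun n : ℕ => 2 * z (2 * n + 1) * ∫ t in Ioc 0 T, Real.sin (freq T n * t) * h t)
      (∫ t in Ioc 0 T, F t * h t) := by
  have hT0 : 0 < T := hT.out
  have hp : Function.Periodic h T := hper
  set H : AddCircle T → ℝ := hp.lift with hH
  have hHc : Continuous H := by
    exact continuous_coinduced_dom.2 hh
  have hH2 : MemLp H 2 haarAddCircle := by
    obtain ⟨B, hB⟩ := (isCompact_univ (X := AddCircle T)).exists_bound_of_continuousOn
      hHc.continuousOn
    exact MemLp.of_bound hHc.aestronglyMeasurable B (ae_of_all _ fun t => hB t (mem_univ _))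
  -- Parseval at frequency `0`, summed over the pairs `±(2n+1)`; oddness of `z` merges the two
  -- exponentials into a sine.
  have h1 := hasSum_odd (hasSum_fourierCoeff_mul (hF.ofReal (K := ℂ)) (hH2.ofReal (K := ℂ)) 0)
    fun k hk => by
      have := hz k
      simp only [Complex.coe_algebraMap] at this ⊢
      rw [this, hev k hk]; simp
  have hint : fourierCoeff (fun t => ((F t : ℝ) : ℂ) * ((H t : ℝ) : ℂ)) 0 =
      ((1 / T * ∫ t in Ioc 0 T, F t * h t : ℝ) : ℂ) := by
    rw [fourierCoeff_eq_intervalIntegral _ _ 0, zero_add, intervalIntegral.integral_of_le hT0.le]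
    simp only [neg_zero, fourier_zero, one_smul]
    push_cast
    rw [Complex.real_smul, ← integral_complex_ofReal]
    push_cast
    rfl
  have hcoef : ∀ l : ℤ, fourierCoeff (fun t => ((H t : ℝ) : ℂ)) l =
      1 / T * ∫ t in Ioc 0 T, Complex.exp (2 * Real.pi * Complex.I * (-l : ℤ) * t / T) * (h t : ℂ) := by
    intro l
    rw [fourierCoeff_eq_intervalIntegral _ _ 0, zero_add, intervalIntegral.integral_of_le hT0.le,
      Complex.real_smul]
    simp only [fourier_coe_apply, smul_eq_mul]
    push_cast
    rfl
  have h2 := h1.mul_left (T : ℂ)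
  rw [← Complex.hasSum_ofReal]
  simp only [RCLike.ofReal_eq_complex_ofReal] at h2
  rw [hint] at h2
  rw [show (∫ t in Ioc 0 T, F t * h t) = T * (1 / T * ∫ t in Ioc 0 T, F t * h t) by
    field_simp, Complex.ofReal_mul]
  refine h2.congr_fun fun n => ?_
  rw [hz, hz, hcoef, hcoef, hz.odd]
  have hi : ∀ l : ℤ, IntegrableOn (fun t : ℝ =>
      Complex.exp (2 * Real.pi * Complex.I * l * t / T) * (h t : ℂ)) (Ioc 0 T) := fun l => by
    have : Continuous fun t : ℝ =>
      Complex.exp (2 * Real.pi * Complex.I * l * t / T) * (h t : ℂ) := by fun_prop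
    exact this.integrableOn_Icc.mono_set Ioc_subset_Icc_self
  have key : (((∫ t in Ioc 0 T, Real.sin (freq T n * t) * h t : ℝ)) : ℂ) =
      -Complex.I / 2 * ((∫ t in Ioc 0 T, Complex.exp (2 * Real.pi * Complex.I *
        (-(0 - (2 * n + 1)) : ℤ) * t / T) * (h t : ℂ)) - ∫ t in Ioc 0 T,
        Complex.exp (2 * Real.pi * Complex.I * (-(0 - -(2 * n + 1)) : ℤ) * t / T) * (h t : ℂ)) := by
    rw [← integral_complex_ofReal, ← integral_sub (hi _) (hi _), ← integral_const_mul]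
    congr 1; ext t
    push_cast
    rw [Complex.sin, freq]
    push_cast
    have e1 : 2 * (Real.pi : ℂ) * Complex.I * -(0 - (2 * n + 1)) * t / T =
      2 * Real.pi * (2 * n + 1) / T * t * Complex.I := by ring
    have e2 : 2 * (Real.pi : ℂ) * Complex.I * -(0 - -(2 * n + 1)) * t / T =
      -(2 * Real.pi * (2 * n + 1) / T * t) * Complex.I := by ring
    rw [e1, e2]; ring
  rw [Complex.ofReal_mul, key]
  have : (T : ℂ) ≠ 0 := by exact_mod_cast hT0.ne'
  generalize (∫ t in Ioc 0 T, Complex.exp (2 * Real.pi * Complex.I *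
    (-(0 - (2 * n + 1)) : ℤ) * t / T) * (h t : ℂ)) = A
  generalize (∫ t in Ioc 0 T, Complex.exp (2 * Real.pi * Complex.I *
    (-(0 - -(2 * n + 1)) : ℤ) * t / T) * (h t : ℂ)) = B
  push_cast
  field_simp
  ring

end Circle

/-! ### The exponential envelope is square integrable. -/

section Envelope

theorem memLp_exp_neg_abs {ρ : ℝ} (hρ : 0 < ρ) (M : ℝ) :
    MemLp (fun x : ℝ => M * Real.exp (-ρ * |x|)) 2 volume := by
  refine MemLp.const_mul ?_ M
  have hc : Continuous fun x : ℝ => Real.exp (-ρ * |x|) := by fun_prop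
  rw [memLp_two_iff_integrable_sq hc.aestronglyMeasurable]
  have h1 : IntegrableOn (fun x : ℝ => Real.exp (-(2 * ρ) * x)) (Set.Ioi 0) :=
    exp_neg_integrableOn_Ioi 0 (by positivity)
  have h2 := h1.integrable_indicator measurableSet_Ioi
  refine (h2.add h2.comp_neg).mono (hc.pow 2).aestronglyMeasurable ?_
  filter_upwards [compl_mem_ae_iff.2 (measure_singleton (0 : ℝ))] with x hx
  have hx0 : x ≠ 0 := hx
  have e : Real.exp (-ρ * |x|) ^ 2 = Real.exp (-(2 * ρ) * |x|) := by
    rw [← Real.exp_nat_mul]; congr 1; push_cast; ring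
  rw [e, Pi.add_apply]
  rcases lt_or_gt_of_ne hx0 with h | h
  · rw [Set.indicator_of_notMem (show x ∉ Set.Ioi (0 : ℝ) from not_lt.2 h.le),
      Set.indicator_of_mem (show -x ∈ Set.Ioi (0 : ℝ) from neg_pos.2 h), abs_of_neg h, zero_add]
  · rw [Set.indicator_of_mem (show x ∈ Set.Ioi (0 : ℝ) from h),
      Set.indicator_of_notMem (show -x ∉ Set.Ioi (0 : ℝ) from by simpa using h.le), abs_of_pos h,
      add_zero]

end Envelope

/-! ### Cosine series of decaying profiles: convergence, H¹ regularity and trace. -/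

open Set

/-- The coefficients and profiles of a series `∑ₙ aₙ uₙ(x) cos(κₙ t)`; `D n` is the weak derivative
of `u n`. -/
structure IsModeFamily (T ρ M : ℝ) (a : ℕ → ℝ) (u D : ℕ → ℝ → ℝ) : Prop where
  period_pos : 0 < T
  rate_pos : 0 < ρ
  bound_pos : 0 < M
  continuous : ∀ n, Continuous (u n)
  bound : ∀ n x, |u n x| ≤ M * Real.exp (-ρ * |x|)
  summable : Summable fun n => |a n|
  summable_sq : Summable fun n => (a n * freq T n) ^ 2
  memLp_deriv : ∀ n, MemLp (D n) 2 volume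
  energy : ∃ C, ∀ n, ∫ x, D n x ^ 2 ≤ C * freq T n ^ 2
  weak : ∀ n, ∀ ψ : ℝ → ℝ, ContDiff ℝ 1 ψ → HasCompactSupport ψ →
    ∫ x, u n x * deriv ψ x = -∫ x, D n x * ψ x

/-- The function `∑ₙ aₙ uₙ(x) cos(κₙ t)`. -/
def modeSeries (T : ℝ) (a : ℕ → ℝ) (u : ℕ → ℝ → ℝ) (z : ℝ × ℝ) : ℝ :=
  ∑' n, a n * u n z.1 * Real.cos (freq T n * z.2)

namespace IsModeFamily

variable {T ρ M : ℝ} {a : ℕ → ℝ} {u D : ℕ → ℝ → ℝ}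

theorem memLp (h : IsModeFamily T ρ M a u D) (n : ℕ) : MemLp (u n) 2 volume :=
  (memLp_exp_neg_abs h.rate_pos M).mono (h.continuous n).aestronglyMeasurable
    (ae_of_all _ fun x => (h.bound n x).trans (le_abs_self _))

theorem abs_term_le (h : IsModeFamily T ρ M a u D) (n : ℕ) (z : ℝ × ℝ) :
    |a n * u n z.1 * Real.cos (freq T n * z.2)| ≤ |a n| * (M * Real.exp (-ρ * |z.1|)) := by
  rw [abs_mul, abs_mul]
  have h1 := h.bound n z.1
  have h2 := Real.abs_cos_le_one (freq T n * z.2)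
  calc |a n| * |u n z.1| * |Real.cos (freq T n * z.2)| ≤ |a n| * |u n z.1| * 1 := by gcongr
    _ ≤ _ := by rw [mul_one]; gcongr

theorem summable_term (h : IsModeFamily T ρ M a u D) (z : ℝ × ℝ) :
    Summable fun n => |a n * u n z.1 * Real.cos (freq T n * z.2)| :=
  Summable.of_nonneg_of_le (fun _ => abs_nonneg _) (fun n => h.abs_term_le n z)
    (h.summable.mul_right _)

theorem hasSum_term (h : IsModeFamily T ρ M a u D) (z : ℝ × ℝ) :
    HasSum (fun n => a n * u n z.1 * Real.cos (freq T n * z.2)) (modeSeries T a u z) :=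
  (h.summable_term z).of_abs.hasSum

theorem abs_modeSeries_le (h : IsModeFamily T ρ M a u D) (z : ℝ × ℝ) :
    |modeSeries T a u z| ≤ (∑' n, |a n|) * (M * Real.exp (-ρ * |z.1|)) := by
  rw [modeSeries, ← tsum_mul_right]
  have h1 := norm_tsum_le_tsum_norm (f := fun n => a n * u n z.1 * Real.cos (freq T n * z.2))
    (h.summable_term z)
  exact h1.trans
    (Summable.tsum_le_tsum (fun n => h.abs_term_le n z) (h.summable_term z) (h.summable.mul_right _))

theorem continuous_modeSeries (h : IsModeFamily T ρ M a u D) : Continuous (modeSeries T a u) := by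
  refine continuous_tsum (u := fun n => |a n| * M) (fun n => ?_) (h.summable.mul_right _) ?_
  · have := h.continuous n
    fun_prop
  · intro n z
    refine (h.abs_term_le n z).trans ?_
    have : Real.exp (-ρ * |z.1|) ≤ 1 := by
      rw [Real.exp_le_one_iff]
      have := mul_nonneg h.rate_pos.le (abs_nonneg z.1)
      linarith
    have hM := h.bound_pos
    calc |a n| * (M * Real.exp (-ρ * |z.1|)) ≤ |a n| * (M * 1) := by gcongr
      _ = _ := by ring

theorem periodic (h : IsModeFamily T ρ M a u D) (x t : ℝ) :
    modeSeries T a u (x, t + T) = modeSeries T a u (x, t) := by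
  unfold modeSeries
  congr 1; ext n
  obtain ⟨m, hm⟩ := freq_mul h.period_pos n
  simp only
  rw [mul_add, hm, mul_comm (2 * Real.pi), Real.cos_add_int_mul_two_pi]

theorem memLp_modeSeries (h : IsModeFamily T ρ M a u D) :
    MemLp (modeSeries T a u) 2 (volume.restrict (strip T)) := by
  have h1 : MemLp (fun z : ℝ × ℝ => (M * Real.exp (-ρ * |z.1|)) * (fun _ : ℝ => (1 : ℝ)) z.2) 2
      (volume.restrict (strip T)) :=
    memLp_mul_strip (memLp_exp_neg_abs h.rate_pos M) continuous_const (fun _ => abs_one.le)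
  refine (h1.const_mul (∑' n, |a n|)).mono h.continuous_modeSeries.aestronglyMeasurable
    (ae_of_all _ fun z => ?_)
  rw [mul_one]
  exact (h.abs_modeSeries_le z).trans (le_abs_self _)

/-- Dominated convergence with the exponential envelope; absolute summability of `a` provides the
majorant. -/
theorem hasSum_integral (h : IsModeFamily T ρ M a u D) {ψ : ℝ × ℝ → ℝ}
    (hψ : MemLp ψ 2 (volume.restrict (strip T))) :
    HasSum (fun n => ∫ z in strip T, (a n * u n z.1) * Real.cos (freq T n * z.2) * ψ z)
      (∫ z in strip T, modeSeries T a u z * ψ z) := by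
  have h1 : MemLp (fun z : ℝ × ℝ => (M * Real.exp (-ρ * |z.1|)) * (fun _ : ℝ => (1 : ℝ)) z.2) 2
      (volume.restrict (strip T)) :=
    memLp_mul_strip (memLp_exp_neg_abs h.rate_pos M) continuous_const (fun _ => abs_one.le)
  have hi := (h1.integrable_mul hψ).norm
  refine hasSum_integral_of_dominated_convergence
    (fun n z => |a n| * ‖(M * Real.exp (-ρ * |z.1|)) * (1 : ℝ) * ψ z‖) (fun n => ?_)
    (fun n => ae_of_all _ fun z => ?_) (ae_of_all _ fun z => h.summable.mul_right _) ?_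
    (ae_of_all _ fun z => (h.hasSum_term z).mul_right _)
  · have := h.continuous n
    have hc : Continuous fun z : ℝ × ℝ => a n * u n z.1 * Real.cos (freq T n * z.2) := by fun_prop
    exact hc.aestronglyMeasurable.mul hψ.1
  · rw [norm_mul, norm_mul _ (ψ z), ← mul_assoc]
    refine mul_le_mul_of_nonneg_right ((h.abs_term_le n z).trans ?_) (norm_nonneg _)
    rw [mul_one]
    exact mul_le_mul_of_nonneg_left (le_abs_self _) (abs_nonneg _)
  · simp only [tsum_mul_right]
    exact hi.const_mul _

theorem integral_sq_le (h : IsModeFamily T ρ M a u D) (n : ℕ) :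
    ∫ x, u n x ^ 2 ≤ ∫ x, (M * Real.exp (-ρ * |x|)) ^ 2 := by
  refine integral_mono (h.memLp n).integrable_sq (memLp_exp_neg_abs h.rate_pos M).integrable_sq
    fun x => ?_
  exact sq_le_sq' (by linarith [(abs_le.1 (h.bound n x)).1]) (abs_le.1 (h.bound n x)).2

/-- The weak time derivative. -/
theorem exists_wt (h : IsModeFamily T ρ M a u D) :
    ∃ wt, MemLp wt 2 (volume.restrict (strip T)) ∧ ∀ ψ, MemLp ψ 2 (volume.restrict (strip T)) →
      HasSum (fun n => ∫ z in strip T, (-(a n * freq T n) * u n z.1) *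
        Real.sin (freq T n * z.2) * ψ z) (∫ z in strip T, wt z * ψ z) := by
  refine exists_orthogonal_series (u := fun n x => -(a n * freq T n) * u n x)
    (c := fun n t => Real.sin (freq T n * t)) (fun n => (h.memLp n).const_mul _)
    (fun n => by fun_prop) (fun n t => abs_sin_mul_le _ _) (fun n m hnm => ?_) ?_
  · have p1 := freq_pos h.period_pos n
    have p2 := freq_pos h.period_pos m
    exact (integral_cos_mul_cos_and_sin_mul_sin h.period_pos.le (freq_mul h.period_pos n)
      (freq_mul h.period_pos m) (sub_ne_zero.2 (freq_ne h.period_pos hnm)) (by positivity)).2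
  · refine Summable.of_nonneg_of_le (fun n => integral_nonneg fun x => sq_nonneg _) (fun n => ?_)
      (h.summable_sq.mul_right (∫ x, (M * Real.exp (-ρ * |x|)) ^ 2))
    simp only [mul_pow, neg_sq]
    rw [integral_const_mul]
    have := h.integral_sq_le n
    simp only [mul_pow] at this
    gcongr

/-- The weak space derivative. -/
theorem exists_wx (h : IsModeFamily T ρ M a u D) :
    ∃ wx, MemLp wx 2 (volume.restrict (strip T)) ∧ ∀ ψ, MemLp ψ 2 (volume.restrict (strip T)) →
      HasSum (fun n => ∫ z in strip T, (a n * D n z.1) *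
        Real.cos (freq T n * z.2) * ψ z) (∫ z in strip T, wx z * ψ z) := by
  obtain ⟨C, hC⟩ := h.energy
  refine exists_orthogonal_series (u := fun n x => a n * D n x)
    (c := fun n t => Real.cos (freq T n * t)) (fun n => (h.memLp_deriv n).const_mul _)
    (fun n => by fun_prop) (fun n t => abs_cos_mul_le _ _) (fun n m hnm => ?_) ?_
  · have p1 := freq_pos h.period_pos n
    have p2 := freq_pos h.period_pos m
    exact (integral_cos_mul_cos_and_sin_mul_sin h.period_pos.le (freq_mul h.period_pos n)
      (freq_mul h.period_pos m) (sub_ne_zero.2 (freq_ne h.period_pos hnm)) (by positivity)).1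
  · refine Summable.of_nonneg_of_le (fun n => integral_nonneg fun x => sq_nonneg _) (fun n => ?_)
      (h.summable_sq.mul_left C)
    simp only [mul_pow]
    rw [integral_const_mul]
    calc a n ^ 2 * ∫ x, D n x ^ 2 ≤ a n ^ 2 * (C * freq T n ^ 2) := by
          have := hC n
          gcongr
      _ = _ := by ring

/-- The series has `H¹` regularity. -/
theorem isH1 (h : IsModeFamily T ρ M a u D) {wx wt : ℝ × ℝ → ℝ}
    (hx : MemLp wx 2 (volume.restrict (strip T)))
    (hx' : ∀ ψ, MemLp ψ 2 (volume.restrict (strip T)) →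
      HasSum (fun n => ∫ z in strip T, (a n * D n z.1) *
        Real.cos (freq T n * z.2) * ψ z) (∫ z in strip T, wx z * ψ z))
    (ht : MemLp wt 2 (volume.restrict (strip T)))
    (ht' : ∀ ψ, MemLp ψ 2 (volume.restrict (strip T)) →
      HasSum (fun n => ∫ z in strip T, (-(a n * freq T n) * u n z.1) *
        Real.sin (freq T n * z.2) * ψ z) (∫ z in strip T, wt z * ψ z)) :
    IsH1 T (modeSeries T a u) wx wt := by
  refine ⟨h.periodic, h.memLp_modeSeries, hx, ht, fun ψ hψ => ?_, fun ψ hψ => ?_⟩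
  · refine (h.hasSum_integral hψ.memLp_dx).unique ((hx' ψ hψ.memLp).neg.congr_fun fun n => ?_)
    have hc : Continuous fun t => Real.cos (freq T n * t) := by fun_prop
    have e1 := (integral_strip_mul ((h.memLp n).const_mul (a n)) hc (abs_cos_mul_le _)
      hψ.memLp_dx).2
    have e2 := (integral_strip_mul ((h.memLp_deriv n).const_mul (a n)) hc (abs_cos_mul_le _)
      hψ.memLp).2
    rw [e1, e2, ← integral_neg]
    congr 1; ext t
    have := h.weak n _ ((hψ.contDiff_fst t).of_le (by simp)) (hψ.hasCompactSupport_fst t)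
    simp only [mul_assoc, integral_const_mul, dx] at this ⊢
    rw [this]; ring
  · refine (h.hasSum_integral hψ.memLp_dt).unique ((ht' ψ hψ.memLp).neg.congr_fun fun n => ?_)
    rw [(integral_strip_mode_dt h.period_pos.le (freq_mul h.period_pos n)
      ((h.memLp n).const_mul (a n)) hψ).1, ← integral_const_mul, ← integral_neg]
    congr 1; ext z; ring

/-- The series is continuous, so its trace at `x = 0` is its restriction. -/
theorem isTraceZero (h : IsModeFamily T ρ M a u D) :
    IsTraceZero T (modeSeries T a u) fun t => modeSeries T a u (0, t) := by
  set w := modeSeries T a u with hw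
  have hc : Continuous w := h.continuous_modeSeries
  have hfin : IsFiniteMeasure ((volume : Measure ℝ).restrict (Ioc 0 T)) :=
    ⟨by rw [Measure.restrict_apply_univ]; exact measure_Ioc_lt_top⟩
  constructor
  · refine MemLp.of_bound (hc.comp (by fun_prop)).aestronglyMeasurable
      ((∑' n, |a n|) * (M * Real.exp (-ρ * |0|))) (ae_of_all _ fun t => ?_)
    exact h.abs_modeSeries_le (0, t)
  · rw [Metric.tendsto_nhdsWithin_nhds]
    intro η hη
    have hT := h.period_pos
    have huc : UniformContinuousOn w (Icc (-1) 1 ×ˢ Icc 0 T) :=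
      (isCompact_Icc.prod isCompact_Icc).uniformContinuousOn_of_continuous hc.continuousOn
    -- The rescaled integral will be at most `2 T σ`, which must be smaller than `η`.
    set σ := η / (4 * T + 4) with hσ
    have hσ0 : 0 < σ := by positivity
    obtain ⟨δ, hδ0, hδ⟩ := Metric.uniformContinuousOn_iff.1 huc (Real.sqrt σ) (Real.sqrt_pos.2 hσ0)
    refine ⟨min δ 1, lt_min hδ0 one_pos, fun ε hε hεd => ?_⟩
    have hε0 : 0 < ε := hε
    rw [Real.dist_eq, sub_zero, abs_of_pos hε0] at hεd
    have hεδ := hεd.trans_le (min_le_left _ _)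
    have hε1 := hεd.trans_le (min_le_right _ _)
    have hvol : volume.real (Ioo (-ε) ε ×ˢ Ioc 0 T) = 2 * ε * T := by
      rw [Measure.real, Measure.volume_eq_prod, Measure.prod_prod, Real.volume_Ioo, Real.volume_Ioc,
        ENNReal.toReal_mul, ENNReal.toReal_ofReal (by linarith), ENNReal.toReal_ofReal (by linarith)]
      ring
    have hb : ‖∫ z in Ioo (-ε) ε ×ˢ Ioc 0 T, (w z - w (0, z.2)) ^ 2‖ ≤
        σ * volume.real (Ioo (-ε) ε ×ˢ Ioc 0 T) := by
      refine norm_setIntegral_le_of_norm_le_const ?_ fun z hz => ?_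
      · rw [Measure.volume_eq_prod, Measure.prod_prod]
        exact ENNReal.mul_lt_top measure_Ioo_lt_top measure_Ioc_lt_top
      · have hz1 := hz.1
        have hz2 : z.2 ∈ Icc 0 T := ⟨hz.2.1.le, hz.2.2⟩
        have hd := hδ z ⟨⟨by linarith [hz1.1], by linarith [hz1.2]⟩, hz2⟩ (0, z.2)
          ⟨⟨by norm_num, by norm_num⟩, hz2⟩ (by
            rw [Prod.dist_eq, dist_self, Real.dist_eq, sub_zero]
            refine max_lt ?_ hδ0
            exact (abs_lt.2 ⟨hz1.1, hz1.2⟩).trans hεδ)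
        rw [Real.dist_eq] at hd
        rw [norm_pow, Real.norm_eq_abs]
        calc |w z - w (0, z.2)| ^ 2 ≤ Real.sqrt σ ^ 2 := by gcongr
          _ = σ := Real.sq_sqrt hσ0.le
    rw [hvol] at hb
    rw [dist_zero_right, norm_mul, norm_inv, Real.norm_of_nonneg hε0.le]
    calc ε⁻¹ * ‖∫ z in Ioo (-ε) ε ×ˢ Ioc 0 T, (w z - w (0, z.2)) ^ 2‖ ≤ ε⁻¹ * (σ * (2 * ε * T)) := by
          gcongr
      _ = η * (2 * T / (4 * T + 4)) := by rw [hσ]; field_simp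
      _ < η * 1 := by
          refine mul_lt_mul_of_pos_left ?_ hη
          rw [div_lt_one (by positivity)]
          linarith
      _ = η := mul_one η

end IsModeFamily

/-! ### The weak formulation, mode by mode. -/

namespace IsModeFamily

variable {T ρ M : ℝ} {a : ℕ → ℝ} {u D : ℕ → ℝ → ℝ}

/-- Both scalar fields occur: real test functions for the trace, complex exponentials for the time
Fourier coefficients. -/
theorem hasSum_integral_Ioc {𝕜 : Type*} [RCLike 𝕜] (h : IsModeFamily T ρ M a u D) (x : ℝ)
    {χ : ℝ → 𝕜} (hχ : Continuous χ) :
    HasSum (fun n => ((a n * u n x : ℝ) : 𝕜) * ∫ t in Ioc 0 T, (Real.cos (freq T n * t) : 𝕜) * χ t)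
      (∫ t in Ioc 0 T, (modeSeries T a u (x, t) : 𝕜) * χ t) := by
  have hi : IntegrableOn (fun t => ‖χ t‖) (Ioc 0 T) :=
    hχ.norm.integrableOn_Icc.mono_set Ioc_subset_Icc_self
  have := hasSum_integral_of_dominated_convergence (μ := volume.restrict (Ioc 0 T))
    (F := fun n t => ((a n * u n x * Real.cos (freq T n * t) : ℝ) : 𝕜) * χ t)
    (f := fun t => (modeSeries T a u (x, t) : 𝕜) * χ t)
    (fun n t => |a n| * (M * Real.exp (-ρ * |x|)) * ‖χ t‖) (fun n => ?_)
    (fun n => ae_of_all _ fun t => ?_)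
    (ae_of_all _ fun t => (h.summable.mul_right _).mul_right _) ?_
    (ae_of_all _ fun t => ?_)
  · refine this.congr_fun fun n => ?_
    rw [← integral_const_mul]
    congr 1; ext t
    push_cast; ring
  · have : Continuous fun t => ((a n * u n x * Real.cos (freq T n * t) : ℝ) : 𝕜) * χ t := by
      fun_prop
    exact this.aestronglyMeasurable
  · rw [norm_mul, RCLike.norm_ofReal]
    exact mul_le_mul_of_nonneg_right (h.abs_term_le n (x, t)) (norm_nonneg _)
  · simp only [tsum_mul_right]
    exact hi.const_mul _
  · have h1 := h.hasSum_term (x, t)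
    exact ((RCLike.hasSum_ofReal 𝕜).2 h1).mul_right (χ t)

/-- The time derivative of the trace. -/
theorem hasWeakDerivTorus [Fact (0 < T)] (h : IsModeFamily T ρ M a u D) (h0 : ∀ n, u n 0 = 1)
    {α : ℤ → ℝ} {F : AddCircle T → ℝ} {β : ℝ} (hα : HasSineCoeff α F)
    (hev : ∀ k, Even k → α k = 0) (hF : MemLp F 2 AddCircle.haarAddCircle)
    (ha : ∀ n, a n * freq T n = β * (2 * α (2 * n + 1))) :
    HasWeakDerivTorus T (fun t => modeSeries T a u (0, t)) fun t => -β * F t := by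
  intro φ hφ hper
  have h1 := h.hasSum_integral_Ioc (𝕜 := ℝ) 0 (hφ.continuous_deriv (by simp))
  have h2 := (hα.hasSum_integral hev hF hφ.continuous hper).mul_left β
  simp only [neg_mul, integral_neg, neg_neg, mul_assoc β, integral_const_mul]
  refine h1.unique (h2.congr_fun fun n => ?_)
  have := (integral_cos_sin_mul_deriv h.period_pos.le (freq_mul h.period_pos n)
    (hφ.of_le (by simp)) hper).1
  simp only [RCLike.ofReal_real_eq_id, id]
  rw [this, h0, ← mul_assoc β, ← ha]
  ring

/-- The variational identity for the linear part of the equation. -/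
theorem hasSum_weakForm (h : IsModeFamily T ρ M a u D) {g : ℝ → ℝ} (hg : MemLp g ∞ volume)
    {j : ℕ → ℝ} (hD : ∀ n, ∀ ψ : ℝ → ℝ, ContDiff ℝ 1 ψ → HasCompactSupport ψ →
      ∫ x, D n x * deriv ψ x = j n * ψ 0 + ∫ x, (freq T n ^ 2 * g x * u n x) * ψ x)
    {wx wt : ℝ × ℝ → ℝ}
    (hx : MemLp wx 2 (volume.restrict (strip T)))
    (hx' : ∀ ψ, MemLp ψ 2 (volume.restrict (strip T)) →
      HasSum (fun n => ∫ z in strip T, (a n * D n z.1) *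
        Real.cos (freq T n * z.2) * ψ z) (∫ z in strip T, wx z * ψ z))
    (ht : MemLp wt 2 (volume.restrict (strip T)))
    (ht' : ∀ ψ, MemLp ψ 2 (volume.restrict (strip T)) →
      HasSum (fun n => ∫ z in strip T, (-(a n * freq T n) * u n z.1) *
        Real.sin (freq T n * z.2) * ψ z) (∫ z in strip T, wt z * ψ z))
    {ψ : ℝ × ℝ → ℝ} (hψ : IsTestFunction T ψ) :
    HasSum (fun n => a n * j n * ∫ t in Ioc 0 T, Real.cos (freq T n * t) * ψ (0, t))
      (∫ z in strip T, (-g z.1 * wt z * dt ψ z + wx z * dx ψ z)) := by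
  have hgs : MemLp (fun z : ℝ × ℝ => g z.1) ∞ (volume.restrict (strip T)) := by
    rw [volume_restrict_strip]
    exact hg.comp_fst _
  have hgψ : MemLp (fun z : ℝ × ℝ => g z.1 * dt ψ z) 2 (volume.restrict (strip T)) :=
    hψ.memLp_dt.mul hgs
  have hgu : ∀ n, MemLp (fun x => g x * u n x) 2 volume := fun n => (h.memLp n).mul hg
  have e : (∫ z in strip T, (-g z.1 * wt z * dt ψ z + wx z * dx ψ z)) =
      -(∫ z in strip T, wt z * (g z.1 * dt ψ z)) + ∫ z in strip T, wx z * dx ψ z := by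
    have i1 : Integrable (fun z => -(wt z * (g z.1 * dt ψ z))) (volume.restrict (strip T)) :=
      (ht.integrable_mul hgψ).neg
    have i2 : Integrable (fun z => wx z * dx ψ z) (volume.restrict (strip T)) :=
      hx.integrable_mul hψ.memLp_dx
    rw [← integral_neg, ← integral_add i1 i2]
    congr 1; ext z; ring
  rw [e]
  refine ((ht' _ hgψ).neg.add (hx' _ hψ.memLp_dx)).congr_fun fun n => ?_
  have c1 : Continuous fun t => Real.cos (freq T n * t) := by fun_prop
  have e1 := (integral_strip_mode_dt h.period_pos.le (freq_mul h.period_pos n) (hgu n) hψ).2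
  have e2 := (integral_strip_mode_dx (h.memLp n) (h.memLp_deriv n)
    ((hgu n).const_mul (freq T n ^ 2)) c1 (abs_cos_mul_le _) hψ (h.weak n)
    (j := j n) (fun χ h1 h2 => by rw [hD n χ h1 h2]; congr 2; ext x; ring)).2
  have e3 : (∫ z in strip T, (-(a n * freq T n) * u n z.1) * Real.sin (freq T n * z.2) *
      (g z.1 * dt ψ z)) = -(a n * freq T n) *
      ∫ z in strip T, (g z.1 * u n z.1) * Real.sin (freq T n * z.2) * dt ψ z := by
    rw [← integral_const_mul]
    congr 1; ext z; ring
  have e4 : (∫ z in strip T, (a n * D n z.1) * Real.cos (freq T n * z.2) * dx ψ z) =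
      a n * ∫ z in strip T, D n z.1 * Real.cos (freq T n * z.2) * dx ψ z := by
    rw [← integral_const_mul]
    congr 1; ext z; ring
  have e5 : (∫ z in strip T, (freq T n ^ 2 * (g z.1 * u n z.1)) * Real.cos (freq T n * z.2) *
      ψ z) = freq T n ^ 2 *
      ∫ z in strip T, (g z.1 * u n z.1) * Real.cos (freq T n * z.2) * ψ z := by
    rw [← integral_const_mul]
    congr 1; ext z; ring
  -- The bulk terms `± a κ² ∫ g u cos(κt) ψ` cancel, leaving only the jump at the origin.
  rw [e3, e4, e1, e2, e5]
  ring

/-- The mode series solves the nonlinear equation. -/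
theorem isWeakSolution [Fact (0 < T)] (h : IsModeFamily T ρ M a u D) (h0 : ∀ n, u n 0 = 1)
    {g : ℝ → ℝ} (hg : MemLp g ∞ volume) {j : ℕ → ℝ}
    (hD : ∀ n, ∀ ψ : ℝ → ℝ, ContDiff ℝ 1 ψ → HasCompactSupport ψ →
      ∫ x, D n x * deriv ψ x = j n * ψ 0 + ∫ x, (freq T n ^ 2 * g x * u n x) * ψ x)
    {α b : ℤ → ℝ} {F : AddCircle T → ℝ} {β γ : ℝ}
    (hF : MemLp F 4 AddCircle.haarAddCircle) (hα : HasSineCoeff α F)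
    (hαe : ∀ k, Even k → α k = 0)
    (hF3 : MemLp (fun t => F t ^ 3) 2 AddCircle.haarAddCircle)
    (hb : HasSineCoeff b fun t => F t ^ 3) (hbe : ∀ k, Even k → b k = 0)
    (ha : ∀ n, a n * freq T n = β * (2 * α (2 * n + 1)))
    (hj : ∀ n, a n * j n = γ * β ^ 3 * (2 * b (2 * n + 1)) * freq T n) :
    IsWeakSolution g γ T (modeSeries T a u) := by
  obtain ⟨wt, ht, ht'⟩ := h.exists_wt
  obtain ⟨wx, hx, hx'⟩ := h.exists_wx
  have hfin : IsFiniteMeasure ((volume : Measure ℝ).restrict (Ioc 0 T)) :=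
    ⟨by rw [Measure.restrict_apply_univ]; exact measure_Ioc_lt_top⟩
  refine ⟨wx, wt, _, fun t => -β * F t, h.isH1 hx hx' ht ht', h.isTraceZero,
    h.hasWeakDerivTorus h0 hα hαe (memLp_two_of_four hF) ha,
    ((memLp_comp_coe hF).mono_exponent (by norm_num)).const_mul _, fun ψ hψ => ?_⟩
  have h1 := h.hasSum_weakForm hg hD hx hx' ht ht' hψ
  have hψ0 := hψ.contDiff_snd 0
  have h2 := (hb.hasSum_integral hbe hF3 (hψ0.continuous_deriv (by simp)) fun t => by
    rw [← deriv_comp_add_const]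
    simp only [hψ.periodic]).mul_left (-(γ * β ^ 3))
  have e : γ * ∫ t in Ioc 0 T, (-β * F t) ^ 3 * dt ψ (0, t) =
      -(γ * β ^ 3) * ∫ t in Ioc 0 T, F t ^ 3 * deriv (fun s => ψ (0, s)) t := by
    rw [← integral_const_mul, ← integral_const_mul]
    congr 1; ext t
    simp only [dt]; ring
  rw [e, sub_eq_zero]
  -- The linear part and the cubic term are sums of series whose terms agree for each `n`; this is
  -- the Euler-Lagrange equation in the form of `hj`.
  refine h1.unique (h2.congr_fun fun n => ?_)
  rw [(integral_cos_sin_mul_deriv h.period_pos.le (freq_mul h.period_pos n)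
    (hψ0.of_le (by simp)) (hψ.periodic 0)).2, hj]
  ring

end IsModeFamily

/-! ### Time Fourier coefficients of the cosine series. -/

section TimeCoefficients

variable {T ρ M : ℝ} {a : ℕ → ℝ} {u D : ℕ → ℝ → ℝ}

theorem integral_exp_period (hT : 0 < T) (m : ℤ) :
    ∫ t in Ioc 0 T, Complex.exp (2 * Real.pi * Complex.I * m * t / T) = if m = 0 then (T : ℂ) else 0 := by
  rw [← intervalIntegral.integral_of_le hT.le]
  have hT0 : (T : ℂ) ≠ 0 := by exact_mod_cast hT.ne'
  split_ifs with hm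
  · simp [hm]
  · have hc : (2 * Real.pi * Complex.I * m / T : ℂ) ≠ 0 := by
      have : (m : ℂ) ≠ 0 := by exact_mod_cast hm
      simp [hT0, this, Real.pi_ne_zero]
    have e : ∀ t : ℝ, Complex.exp (2 * Real.pi * Complex.I * m * t / T) =
        Complex.exp (2 * Real.pi * Complex.I * m / T * t) := fun t => by congr 1; ring
    simp only [e]
    rw [integral_exp_mul_complex hc]
    have : (2 * Real.pi * Complex.I * m / T * T : ℂ) = m * (2 * Real.pi * Complex.I) := by
      field_simp
    rw [this, Complex.exp_int_mul_two_pi_mul_I]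
    simp

theorem integral_cos_mul_exp (hT : 0 < T) (n : ℕ) (k : ℤ) :
    ∫ t in Ioc 0 T, (Real.cos (freq T n * t) : ℂ) *
      Complex.exp (-(2 * Real.pi * Complex.I * k * t / T)) =
    ((if k = 2 * n + 1 then (T : ℂ) else 0) + if k = -(2 * n + 1) then (T : ℂ) else 0) / 2 := by
  have hi : ∀ m : ℤ, IntegrableOn (fun t : ℝ =>
      Complex.exp (2 * Real.pi * Complex.I * m * t / T)) (Ioc 0 T) := fun m => by
    have : Continuous fun t : ℝ => Complex.exp (2 * Real.pi * Complex.I * m * t / T) := by fun_prop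
    exact this.integrableOn_Icc.mono_set Ioc_subset_Icc_self
  have e : ∀ t : ℝ, (Real.cos (freq T n * t) : ℂ) *
      Complex.exp (-(2 * Real.pi * Complex.I * k * t / T)) =
      (Complex.exp (2 * Real.pi * Complex.I * ((2 * n + 1 - k : ℤ)) * t / T) +
        Complex.exp (2 * Real.pi * Complex.I * ((-(2 * n + 1) - k : ℤ)) * t / T)) / 2 := by
    intro t
    rw [freq, Complex.ofReal_cos, Complex.cos, div_mul_eq_mul_div, add_mul, ← Complex.exp_add,
      ← Complex.exp_add]
    push_cast
    congr 3 <;> ring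
  simp only [e]
  rw [integral_div, integral_add (hi _) (hi _), integral_exp_period hT, integral_exp_period hT]
  congr 2
  · exact if_congr (by omega) rfl rfl
  · exact if_congr (by omega) rfl rfl

/-- The time Fourier coefficients of the mode series. -/
theorem IsModeFamily.timeCoeff_eq (h : IsModeFamily T ρ M a u D) (k : ℤ) (x : ℝ) :
    timeCoeff T (modeSeries T a u) k x =
      ((if Odd k then a (k.natAbs / 2) / 2 else 0 : ℝ) : ℂ) * (u (k.natAbs / 2) x : ℂ) := by
  have hT0 : (T : ℂ) ≠ 0 := by exact_mod_cast h.period_pos.ne'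
  have h1 := h.hasSum_integral_Ioc (𝕜 := ℂ) x
    (χ := fun t => Complex.exp (-(2 * Real.pi * Complex.I * k * t / T))) (by fun_prop)
  simp only [Complex.coe_algebraMap, integral_cos_mul_exp h.period_pos] at h1
  rw [timeCoeff]
  split_ifs with hk
  -- For odd `k` the only contributing mode is the one with `2n + 1 = |k|`, where `n` is the integer
  -- quotient `|k| / 2`.
  · have h2 := hasSum_single (f := fun n : ℕ => ((a n * u n x : ℝ) : ℂ) *
      (((if k = 2 * n + 1 then (T : ℂ) else 0) + if k = -(2 * n + 1) then (T : ℂ) else 0) / 2))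
      (k.natAbs / 2) (by
        intro n hn
        rw [if_neg (by omega), if_neg (by omega)]
        simp)
    rw [h1.unique h2]
    obtain ⟨m, hm⟩ := hk
    have : ((if k = 2 * ((k.natAbs / 2 : ℕ) : ℤ) + 1 then (T : ℂ) else 0) +
        if k = -(2 * ((k.natAbs / 2 : ℕ) : ℤ) + 1) then (T : ℂ) else 0) = T := by
      rcases le_total 0 k with h0 | h0
      · rw [if_pos (by omega), if_neg (by omega), add_zero]
      · rw [if_neg (by omega), if_pos (by omega), zero_add]
    rw [this]
    push_cast
    field_simp
  · have h2 : ∀ n : ℕ, ((a n * u n x : ℝ) : ℂ) *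
      (((if k = 2 * n + 1 then (T : ℂ) else 0) + if k = -(2 * n + 1) then (T : ℂ) else 0) / 2) = 0 := by
      intro n
      rw [if_neg (fun h' => hk ⟨n, h'⟩), if_neg (fun h' => hk ⟨-(n + 1), by omega⟩)]
      simp
    simp only [h2] at h1
    rw [h1.unique hasSum_zero]
    simp

end TimeCoefficients

/-! ### Fractional Sobolev regularity and nontriviality of the series. -/

section Regularity

variable {T ρ M : ℝ} {a : ℕ → ℝ} {u D : ℕ → ℝ → ℝ}

theorem integral_norm_sq_mul (c : ℝ) (f : ℝ → ℝ) :
    ∫ x, ‖(c : ℂ) * (f x : ℂ)‖ ^ 2 = c ^ 2 * ∫ x, f x ^ 2 := by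
  rw [← integral_const_mul]
  congr 1; ext x
  rw [norm_mul, Complex.norm_real, Complex.norm_real, mul_pow, Real.norm_eq_abs, Real.norm_eq_abs,
    sq_abs, sq_abs]

theorem IsModeFamily.memLp_timeCoeff (h : IsModeFamily T ρ M a u D) (k : ℤ) :
    MemLp (timeCoeff T (modeSeries T a u) k) 2 volume := by
  rw [funext (h.timeCoeff_eq k)]
  exact ((h.memLp _).ofReal (K := ℂ)).const_mul _

theorem IsModeFamily.memHsL2 (h : IsModeFamily T ρ M a u D) {s : ℝ}
    (hs : Summable fun k : ℤ => (1 + (k : ℝ) ^ 2) ^ s *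
      (if Odd k then a (k.natAbs / 2) / 2 else 0) ^ 2) :
    MemHsL2 T s (modeSeries T a u) := by
  refine ⟨h.periodic, h.memLp_modeSeries, h.memLp_timeCoeff, ?_⟩
  refine Summable.of_nonneg_of_le (fun k => by positivity) (fun k => ?_)
    (hs.mul_right (∫ x, (M * Real.exp (-ρ * |x|)) ^ 2))
  simp only [h.timeCoeff_eq]
  rw [integral_norm_sq_mul, mul_assoc]
  have := h.integral_sq_le (k.natAbs / 2)
  gcongr

theorem freq_sq_le {k : ℤ} (hk : Odd k) :
    freq T (k.natAbs / 2) ^ 2 ≤ (2 * Real.pi / T) ^ 2 * (1 + (k : ℝ) ^ 2) := by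
  have h1 : (2 * ((k.natAbs / 2 : ℕ) : ℝ) + 1) = |(k : ℝ)| := by
    have : 2 * (k.natAbs / 2) + 1 = k.natAbs := by
      obtain ⟨m, hm⟩ := hk
      omega
    rw [← Int.cast_abs, ← Nat.cast_natAbs]
    generalize k.natAbs / 2 = n at this ⊢
    rw [← this]
    push_cast
    ring
  rw [freq, h1, mul_div_right_comm, mul_pow, sq_abs]
  gcongr
  linarith

/-- The energy bound makes an `x`-derivative cost a factor comparable to `1 + k²`, the same as a
`t`-derivative. So one weighted sum serves both scales of spaces. -/
theorem IsModeFamily.memHsH1 (h : IsModeFamily T ρ M a u D) {s : ℝ}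
    (hs : Summable fun k : ℤ => (1 + (k : ℝ) ^ 2) ^ (1 + s) *
      (if Odd k then a (k.natAbs / 2) / 2 else 0) ^ 2) :
    MemHsH1 T s (modeSeries T a u) := by
  set c : ℤ → ℝ := fun k => if Odd k then a (k.natAbs / 2) / 2 else 0 with hc
  obtain ⟨C, hC⟩ := h.energy
  have hC0 : 0 ≤ C := by
    have h1 := (integral_nonneg fun x => sq_nonneg (D 0 x)).trans (hC 0)
    exact nonneg_of_mul_nonneg_left h1 (pow_pos (freq_pos h.period_pos 0) 2)
  set E : ℝ := ∫ x, (M * Real.exp (-ρ * |x|)) ^ 2 with hE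
  have hE0 : 0 ≤ E := integral_nonneg fun x => sq_nonneg _
  refine ⟨h.periodic, h.memLp_modeSeries, fun k x => (c k : ℂ) * (D (k.natAbs / 2) x : ℂ),
    fun k => ⟨h.memLp_timeCoeff k, ((h.memLp_deriv _).ofReal (K := ℂ)).const_mul _, ?_⟩, ?_⟩
  · intro φ hφ hφc _
    have h1 := h.weak (k.natAbs / 2) φ (hφ.of_le (by simp)) hφc
    have e1 : ∀ x, deriv φ x • timeCoeff T (modeSeries T a u) k x =
        (c k : ℂ) * ((u (k.natAbs / 2) x * deriv φ x : ℝ) : ℂ) := fun x => by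
      rw [h.timeCoeff_eq, Complex.real_smul]
      push_cast; ring
    have e2 : ∀ x, φ x • ((c k : ℂ) * (D (k.natAbs / 2) x : ℂ)) =
        (c k : ℂ) * ((D (k.natAbs / 2) x * φ x : ℝ) : ℂ) := fun x => by
      rw [Complex.real_smul]
      push_cast; ring
    simp only [e1, e2, Measure.restrict_univ]
    rw [integral_const_mul, integral_const_mul, integral_complex_ofReal, integral_complex_ofReal,
      h1]
    push_cast; ring
  · refine Summable.of_nonneg_of_le (fun k => by positivity) (fun k => ?_)
      (hs.mul_right (E + C * (2 * Real.pi / T) ^ 2))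
    simp only [h.timeCoeff_eq]
    rw [integral_norm_sq_mul, integral_norm_sq_mul]
    have hk1 : (1 : ℝ) ≤ 1 + (k : ℝ) ^ 2 := by linarith [sq_nonneg (k : ℝ)]
    rw [Real.rpow_add (by positivity), Real.rpow_one]
    have hp : 0 ≤ (1 + (k : ℝ) ^ 2) ^ s := by positivity
    rcases Int.even_or_odd k with hk | hk
    · have : c k = 0 := if_neg (Int.not_odd_iff_even.2 hk)
      rw [show (if Odd k then a (k.natAbs / 2) / 2 else 0) = c k from rfl, this]
      simp
    · have h1 := h.integral_sq_le (k.natAbs / 2)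
      have h2 := (hC (k.natAbs / 2)).trans (mul_le_mul_of_nonneg_left (freq_sq_le hk) hC0)
      have h3 : (∫ x, u (k.natAbs / 2) x ^ 2) + ∫ x, D (k.natAbs / 2) x ^ 2 ≤
          (1 + (k : ℝ) ^ 2) * (E + C * (2 * Real.pi / T) ^ 2) := by
        nlinarith [mul_le_mul_of_nonneg_right hk1 hE0]
      have h4 := mul_le_mul_of_nonneg_left h3 (mul_nonneg hp (sq_nonneg (c k)))
      calc _ = (1 + (k : ℝ) ^ 2) ^ s * c k ^ 2 * ((∫ x, u (k.natAbs / 2) x ^ 2) +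
            ∫ x, D (k.natAbs / 2) x ^ 2) := by simp only [hc]; ring
        _ ≤ _ := h4
        _ = _ := by simp only [hc]; ring

/-- A mode series with a nonzero coefficient is nonzero. -/
theorem IsModeFamily.ne_zero (h : IsModeFamily T ρ M a u D) {n : ℕ} (ha : a n ≠ 0)
    (h0 : u n 0 ≠ 0) : ¬ modeSeries T a u =ᵐ[volume.restrict (strip T)] 0 := by
  intro hw
  rw [volume_restrict_strip] at hw
  have h1 := Measure.ae_ae_of_ae_prod hw
  -- A vanishing series has vanishing time coefficients, hence a vanishing profile; continuity
  -- carries this to `x = 0`.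
  have h2 : ∀ᵐ x : ℝ, u n x = 0 := by
    filter_upwards [h1] with x hx
    have h3 : timeCoeff T (modeSeries T a u) (2 * n + 1) x = 0 := by
      rw [timeCoeff, integral_eq_zero_of_ae, mul_zero]
      filter_upwards [hx] with t ht
      rw [ht]; simp
    have hn : (2 * (n : ℤ) + 1).natAbs / 2 = n := by omega
    rw [h.timeCoeff_eq, if_pos ⟨n, rfl⟩, hn] at h3
    have := mul_eq_zero.1 h3
    simpa [ha] using this
  have h3 : u n = fun _ => 0 := (h.continuous n).ae_eq_iff_eq volume continuous_const |>.1 h2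
  exact h0 (congrFun h3 0)

end Regularity

/-! ### The mode family attached to a sequence in D(J). -/

section Construction

variable {g : ℝ → ℝ} {ω ρ M : ℝ} {Φ : ℕ → ℝ → ℝ}

/-- The coefficients `2 α_k / (k √T)`, `k = 2n + 1`, of the cosine series. -/
def modeCoeff (T : ℝ) (α : ℤ → ℝ) (n : ℕ) : ℝ := 2 * α (2 * n + 1) / ((2 * n + 1) * Real.sqrt T)

theorem freq_eq (hω : 0 < ω) (n : ℕ) : freq (2 * Real.pi / ω) n = ω * (2 * n + 1) := by
  have := Real.pi_pos
  rw [freq]; field_simp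

/-- This identifies the constant `β = ω/√T` relating the time derivative at `x = 0` to `F`. -/
theorem modeCoeff_mul_freq (hω : 0 < ω) (α : ℤ → ℝ) (n : ℕ) :
    modeCoeff (2 * Real.pi / ω) α n * freq (2 * Real.pi / ω) n =
      ω / Real.sqrt (2 * Real.pi / ω) * (2 * α (2 * n + 1)) := by
  have : 0 < Real.sqrt (2 * Real.pi / ω) := Real.sqrt_pos.2 (by positivity)
  rw [freq_eq hω, modeCoeff]
  field_simp

theorem summable_odd {f : ℤ → ℝ} (hf : Summable f) : Summable fun n : ℕ => f (2 * n + 1) :=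
  hf.comp_injective (i := fun n : ℕ => (2 * n + 1 : ℤ)) fun a b h => by simp only at h; omega

/-- The factor `1/k` is square summable, so `α_k/k` is absolutely summable by `2xy ≤ x² + y²`. -/
theorem summable_modeCoeff {α : ℤ → ℝ} (hα : Summable fun k => α k ^ 2) (T : ℝ) :
    Summable fun n => |modeCoeff T α n| := by
  have h1 : Summable fun n : ℕ => 1 / ((n : ℝ) + 1) ^ 2 := by
    have := (summable_nat_add_iff 1).2 (Real.summable_one_div_nat_pow.2 one_lt_two)
    simpa using this
  refine Summable.of_nonneg_of_le (fun _ => abs_nonneg _) (fun n => ?_)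
    (((summable_odd hα).add h1).mul_left |(Real.sqrt T)⁻¹|)
  have hn : (0 : ℝ) < 2 * n + 1 := by positivity
  have e : modeCoeff T α n = (Real.sqrt T)⁻¹ * (2 * (α (2 * n + 1) * (1 / (2 * n + 1)))) := by
    rw [modeCoeff]
    rcases eq_or_ne (Real.sqrt T) 0 with h | h
    · simp [h]
    · field_simp
  rw [e, abs_mul]
  refine mul_le_mul_of_nonneg_left ?_ (abs_nonneg _)
  have h2 : (1 / (2 * (n : ℝ) + 1)) ^ 2 ≤ 1 / ((n : ℝ) + 1) ^ 2 := by
    rw [div_pow, one_pow]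
    have : (0 : ℝ) ≤ n := n.cast_nonneg
    gcongr
    linarith
  refine le_trans ?_ (add_le_add_right h2 _)
  rw [abs_le]
  constructor <;> nlinarith [sq_nonneg (α (2 * n + 1) + 1 / (2 * n + 1)),
    sq_nonneg (α (2 * n + 1) - 1 / (2 * n + 1))]

/-- The profiles `Φ_k(|x|)` form a mode family. -/
theorem exists_isModeFamily (hg : IsAdmissiblePotential g) (hω : 0 < ω)
    (hΦ : ∀ k : ℕ, Odd k → IsDecayingSolution (potential g ω k) (Φ k)) (hρ : 0 < ρ) (hM : 0 < M)
    (hdecay : ∀ k : ℕ, Odd k → ∀ x : ℝ, 0 ≤ x → |Φ k x| ≤ M * Real.exp (-ρ * x))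
    (hgrowth : ∃ K : ℝ, ∀ k : ℕ, Odd k → |derivZero (Φ k)| ≤ K * k)
    {α : ℤ → ℝ} (hα : Summable fun k => α k ^ 2) :
    ∃ D : ℕ → ℝ → ℝ, IsModeFamily (2 * Real.pi / ω) ρ M (modeCoeff (2 * Real.pi / ω) α)
      (fun n x => Φ (2 * n + 1) |x|) D ∧
      ∀ n, ∀ ψ : ℝ → ℝ, ContDiff ℝ 1 ψ → HasCompactSupport ψ → ∫ x, D n x * deriv ψ x =
        -2 * derivZero (Φ (2 * n + 1)) * ψ 0 +
          ∫ x, (freq (2 * Real.pi / ω) n ^ 2 * g x * Φ (2 * n + 1) |x|) * ψ x := by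
  have hodd : ∀ n : ℕ, Odd (2 * n + 1) := fun n => ⟨n, rfl⟩
  have hVeq : ∀ n x, potential g ω (2 * n + 1) x = freq (2 * Real.pi / ω) n ^ 2 * g x := by
    intro n x
    rw [freq_eq hω, potential]; push_cast; ring
  have hV : ∀ n, ∀ᵐ x, potential g ω (2 * n + 1) (-x) = potential g ω (2 * n + 1) x := by
    intro n
    filter_upwards [hg.even] with x hx
    rw [potential, potential, hx]
  have hVm : ∀ n, MemLp (potential g ω (2 * n + 1)) ∞ volume := fun n => hg.memLp_top.const_mul _
  choose D hφ hD h1 h2 h3 using fun n => (hΦ _ (hodd n)).exists_extension (hV n) (hVm n)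
  have hb : ∀ (n : ℕ) (x : ℝ), |Φ (2 * n + 1) (|x|)| ≤ M * Real.exp (-ρ * |x|) := fun n x =>
    hdecay _ (hodd n) _ (abs_nonneg x)
  refine ⟨D, ⟨by positivity, hρ, hM, fun n => ?_, hb, summable_modeCoeff hα _, ?_, hD, ?_, h1⟩, ?_⟩
  · exact (hΦ _ (hodd n)).continuousOn.comp_continuous continuous_abs fun x => abs_nonneg x
  · simp only [modeCoeff_mul_freq hω, mul_pow]
    exact ((summable_odd hα).mul_left _).mul_left _
  · obtain ⟨K, hK⟩ := hgrowth
    have hK0 : 0 ≤ K := by simpa using (abs_nonneg _).trans (hK 1 odd_one)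
    set G := (eLpNorm g ∞ volume).toReal with hG
    have hgG : ∀ᵐ x, |g x| ≤ G := by
      filter_upwards [ae_le_eLpNormEssSup (f := g) (μ := volume)] with x hx
      rw [← eLpNorm_exponent_top] at hx
      have := ENNReal.toReal_mono hg.memLp_top.2.ne hx
      simpa [hG] using this
    set E : ℝ := ∫ x, (M * Real.exp (-ρ * |x|)) ^ 2 with hE
    -- The energy identity has two terms: `-2Φ_k'(0) ≤ 2Kk²` is measured against `κ² = ω²k²`, and
    -- the potential term is at most `κ²` times the sup norm of `g` times the integral of the
    -- squared envelope.
    refine ⟨2 * K / ω ^ 2 + G * E, fun n => ?_⟩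
    have hk := hK _ (hodd n)
    push_cast at hk
    have hn : (1 : ℝ) ≤ 2 * n + 1 := by
      have : (0 : ℝ) ≤ n := n.cast_nonneg
      linarith
    have hint : |∫ x, potential g ω (2 * n + 1) x * Φ (2 * n + 1) |x| ^ 2| ≤
        ∫ x, freq (2 * Real.pi / ω) n ^ 2 * G * (M * Real.exp (-ρ * |x|)) ^ 2 := by
      rw [← Real.norm_eq_abs]
      refine norm_integral_le_of_norm_le
        (g := fun x => freq (2 * Real.pi / ω) n ^ 2 * G * (M * Real.exp (-ρ * |x|)) ^ 2) ((memLp_exp_neg_abs hρ M).integrable_sq.const_mul _) ?_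
      filter_upwards [hgG] with x hx
      rw [hVeq, norm_mul, norm_mul, norm_pow, norm_pow, Real.norm_eq_abs, Real.norm_eq_abs,
        Real.norm_eq_abs, sq_abs]
      have := hb n x
      gcongr
    rw [integral_const_mul] at hint
    have hd : -2 * derivZero (Φ (2 * n + 1)) ≤ 2 * K / ω ^ 2 * freq (2 * Real.pi / ω) n ^ 2 := by
      have e : 2 * K / ω ^ 2 * freq (2 * Real.pi / ω) n ^ 2 = 2 * K * (2 * n + 1) ^ 2 := by
        rw [freq_eq hω]; field_simp
      rw [e]
      have h4 := (abs_le.1 hk).1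
      nlinarith [mul_le_mul_of_nonneg_left hn (mul_nonneg hK0 (zero_le_one.trans hn))]
    rw [h3 n]
    linarith [(abs_le.1 hint).2]
  · intro n ψ hψ hψc
    rw [h2 n ψ hψ hψc]
    simp only [hVeq]

end Construction

/-! ### The cosine series as the series over all odd integers. -/

section Series

variable {T ρ M : ℝ} {a : ℕ → ℝ} {u D : ℕ → ℝ → ℝ}

/-- Positive and negative frequencies must converge separately for an unconditional sum over the odd
integers. -/
theorem IsModeFamily.hasSum_exp (h : IsModeFamily T ρ M a u D) (x t : ℝ) :
    ∃ s s' : ℂ, HasSum (fun n => ((a n / 2 * u n x : ℝ) : ℂ) *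
        Complex.exp (freq T n * t * Complex.I)) s ∧
      HasSum (fun n => ((a n / 2 * u n x : ℝ) : ℂ) *
        Complex.exp (-(freq T n * t) * Complex.I)) s' ∧ s + s' = modeSeries T a u (x, t) := by
  have hs : ∀ θ : ℕ → ℝ, Summable fun n => ((a n / 2 * u n x : ℝ) : ℂ) *
      Complex.exp (θ n * Complex.I) := by
    intro θ
    refine Summable.of_norm_bounded (h.summable.mul_right (M * Real.exp (-ρ * |x|))) fun n => ?_
    rw [norm_mul, Complex.norm_exp_ofReal_mul_I, mul_one, Complex.norm_real, norm_mul, norm_div,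
      Real.norm_two, Real.norm_eq_abs, Real.norm_eq_abs]
    have := h.bound n x
    have h0 := abs_nonneg (a n)
    calc |a n| / 2 * |u n x| ≤ |a n| * |u n x| := by
          refine mul_le_mul_of_nonneg_right ?_ (abs_nonneg _)
          linarith
      _ ≤ _ := by gcongr
  have h1 := (hs fun n => freq T n * t).hasSum
  have h2 := (hs fun n => -(freq T n * t)).hasSum
  simp only [Complex.ofReal_neg, Complex.ofReal_mul (freq T _)] at h1 h2
  refine ⟨_, _, h1, h2, ?_⟩
  refine (h1.add h2).unique ?_
  refine (Complex.hasSum_ofReal.2 (h.hasSum_term (x, t))).congr_fun fun n => ?_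
  push_cast
  rw [Complex.cos]
  ring

theorem isSeriesOf_modeSeries {T : ℝ} {Φ : ℕ → ℝ → ℝ} {α : ℤ → ℝ} (hα : ∀ k, α (-k) = -α k)
    (h : IsModeFamily T ρ M (modeCoeff T α) (fun n x => Φ (2 * n + 1) |x|) D) :
    IsSeriesOf T Φ α (modeSeries T (modeCoeff T α) fun n x => Φ (2 * n + 1) |x|) := by
  intro x t
  obtain ⟨s, s', h1, h2, h3⟩ := h.hasSum_exp x t
  have hT := h.period_pos
  have hT0 : (T : ℂ) ≠ 0 := by exact_mod_cast hT.ne'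
  have hsq : (Real.sqrt T : ℂ) ≠ 0 := by exact_mod_cast (Real.sqrt_pos.2 hT).ne'
  rw [← h3]
  have hn : ∀ n : ℕ, (2 * (n : ℂ) + 1) ≠ 0 := fun n => by exact_mod_cast (2 * n).succ_ne_zero
  refine hasSum_subtype_odd (f := fun k : ℤ =>
    ((α k / (k : ℤ) * Φ (k : ℤ).natAbs |x| : ℝ) : ℂ) * e T k t)
    (h1.congr_fun fun n => ?_) (h2.congr_fun fun n => ?_)
  · have e1 : (2 * (n : ℤ) + 1).natAbs = 2 * n + 1 := by omega
    have e2 : 2 * (Real.pi : ℂ) * Complex.I * ((2 * n + 1 : ℤ) : ℂ) * t / T =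
        (freq T n : ℂ) * t * Complex.I := by
      rw [freq]; push_cast; ring
    simp only [e1]
    rw [e, e2, modeCoeff]
    have := hn n
    push_cast
    field_simp
  · have e1 : (-(2 * (n : ℤ) + 1)).natAbs = 2 * n + 1 := by omega
    have e2 : 2 * (Real.pi : ℂ) * Complex.I * ((-(2 * n + 1) : ℤ) : ℂ) * t / T =
        -((freq T n : ℂ) * t) * Complex.I := by
      rw [freq]; push_cast; ring
    simp only [e1, hα]
    rw [e, e2, modeCoeff]
    have := hn n
    push_cast
    rw [neg_div_neg_eq]
    field_simp

end Series

/-- Dividing `α_k` by `k` raises the weight by one order, as `(1 + k²)/k² ≤ 2` for `k ≠ 0`. -/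
theorem summable_modeCoeff_weighted {T : ℝ} (hT : 0 < T) {α : ℤ → ℝ} (hodd : ∀ k, α (-k) = -α k)
    {ν : ℝ} (hs : Summable fun k : ℤ => (1 + (k : ℝ) ^ 2) ^ ν * α k ^ 2) :
    Summable fun k : ℤ => (1 + (k : ℝ) ^ 2) ^ (1 + ν) *
      (if Odd k then modeCoeff T α (k.natAbs / 2) / 2 else 0) ^ 2 := by
  refine Summable.of_nonneg_of_le (fun k => by positivity) (fun k => ?_) (hs.mul_left (2 / T))
  split_ifs with hk
  · have hk0 : k ≠ 0 := by rintro rfl; simp at hk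
    have hk1 : (1 : ℝ) ≤ (k : ℝ) ^ 2 := by
      have : (1 : ℤ) ≤ k ^ 2 := Int.one_le_abs (pow_ne_zero 2 hk0) |>.trans_eq (abs_of_nonneg (sq_nonneg k))
      exact_mod_cast this
    have e : (modeCoeff T α (k.natAbs / 2) / 2) ^ 2 = α k ^ 2 / (k ^ 2 * T) := by
      have hsq : Real.sqrt T ^ 2 = T := Real.sq_sqrt hT.le
      obtain ⟨m, hm⟩ := hk
      rw [modeCoeff]
      rcases le_total 0 k with h0 | h0
      · have h1 : (2 * ((k.natAbs / 2 : ℕ) : ℤ) + 1) = k := by omega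
        generalize k.natAbs / 2 = n at h1 ⊢
        have h2 : (2 * (n : ℝ) + 1) = k := by exact_mod_cast h1
        rw [h1, h2, div_pow, div_pow, mul_pow, mul_pow, hsq]
        ring
      · have h1 : (2 * ((k.natAbs / 2 : ℕ) : ℤ) + 1) = -k := by omega
        generalize k.natAbs / 2 = n at h1 ⊢
        have h2 : (2 * (n : ℝ) + 1) = -k := by exact_mod_cast h1
        rw [h1, h2, hodd, div_pow, div_pow, mul_pow, mul_pow, hsq]
        ring
    rw [e, Real.rpow_add (by positivity), Real.rpow_one]
    have hp : 0 ≤ (1 + (k : ℝ) ^ 2) ^ ν * α k ^ 2 := by positivity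
    have h3 : (1 + (k : ℝ) ^ 2) / (k ^ 2 * T) ≤ 2 / T := by
      rw [div_le_div_iff₀ (by positivity) hT]
      nlinarith
    calc _ = (1 + (k : ℝ) ^ 2) / (k ^ 2 * T) * ((1 + (k : ℝ) ^ 2) ^ ν * α k ^ 2) := by ring
      _ ≤ _ := mul_le_mul_of_nonneg_right h3 hp
  · have : 0 ≤ 2 / T * ((1 + (k : ℝ) ^ 2) ^ ν * α k ^ 2) := by positivity
    simpa using this

theorem exists_pos_coeff_ne_zero {α : ℤ → ℝ} (hα : MemDomJ α) (h : α ≠ 0) :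
    ∃ n : ℕ, α (2 * n + 1) ≠ 0 := by
  obtain ⟨k, hk⟩ := Function.ne_iff.1 h
  have hodd : Odd k := by
    by_contra hcon
    exact hk (hα.support_odd k (Int.not_odd_iff_even.1 hcon))
  obtain ⟨m, rfl⟩ := hodd
  rcases le_total 0 m with hm | hm
  · exact ⟨m.toNat, by rwa [Int.toNat_of_nonneg hm]⟩
  · refine ⟨(-m - 1).toNat, ?_⟩
    have hm1 : m ≠ 0 ∨ m = 0 := (eq_or_ne m 0).symm
    rcases hm1 with hm1 | rfl
    · rw [Int.toNat_of_nonneg (by omega), show 2 * (-m - 1) + 1 = -(2 * m + 1) by ring, hα.odd]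
      exact neg_ne_zero.2 hk
    · simpa using hk

/-- Critical points of `J` yield weak solutions. -/
theorem IsCriticalPoint.exists_solution {g : ℝ → ℝ} (hg : IsAdmissiblePotential g) {γ ω : ℝ}
    (hγ : γ ≠ 0) (hω : 0 < ω) {Φ : ℕ → ℝ → ℝ}
    (hΦ : ∀ k : ℕ, Odd k → IsDecayingSolution (potential g ω k) (Φ k))
    {ρ M : ℝ} (hρ : 0 < ρ) (hM : 0 < M)
    (hdecay : ∀ k : ℕ, Odd k → ∀ x : ℝ, 0 ≤ x → |Φ k x| ≤ M * Real.exp (-ρ * x))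
    (hgrowth : ∃ K : ℝ, ∀ k : ℕ, Odd k → |derivZero (Φ k)| ≤ K * k)
    {α : ℤ → ℝ} (hcrit : IsCriticalPoint γ ω Φ α) :
    ∃ w : ℝ × ℝ → ℝ, IsSeriesOf (2 * Real.pi / ω) Φ α w ∧
      IsWeakSolution g γ (2 * Real.pi / ω) w ∧
      (α ≠ 0 → ¬ w =ᵐ[volume.restrict (strip (2 * Real.pi / ω))] 0) ∧
      (∃ C > 0, ∀ x t : ℝ, |w (x, t)| ≤ C * Real.exp (-ρ * |x|)) ∧
      ∀ ν : ℝ, 0 < ν → ν < 1 / 4 →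
        MemHsL2 (2 * Real.pi / ω) (1 + ν) w ∧ MemHsH1 (2 * Real.pi / ω) ν w := by
  have hT : 0 < 2 * Real.pi / ω := by positivity
  have : Fact (0 < 2 * Real.pi / ω) := ⟨hT⟩
  have hα := hcrit.1
  obtain ⟨F, hF, hFα, hFb, hbs, hreg⟩ := hcrit.exists_function (T := 2 * Real.pi / ω) hgrowth
  obtain ⟨D, h, hD⟩ := exists_isModeFamily hg hω hΦ hρ hM hdecay hgrowth hα.summable_sq
  have h0 : ∀ n : ℕ, Φ (2 * n + 1) |(0 : ℝ)| = 1 := fun n => by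
    rw [abs_zero]; exact (hΦ _ ⟨n, rfl⟩).at_zero
  have hF3 : MemLp (fun t => F t ^ 3) 2 AddCircle.haarAddCircle := by
    refine memLp_two_of_summable ?_ (hbs.congr fun k => ?_)
    · simpa using (integrable_mul_of_memLp_four hF (memLp_const 1)).1
    · rw [hFb k, norm_mul, norm_neg, Complex.norm_I, one_mul, Complex.norm_real,
        Real.norm_eq_abs, sq_abs]
  refine ⟨modeSeries (2 * Real.pi / ω) (modeCoeff (2 * Real.pi / ω) α)
    (fun n x => Φ (2 * n + 1) |x|), isSeriesOf_modeSeries hα.odd h, ?_, ?_, ?_, ?_⟩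
  · refine h.isWeakSolution h0 hg.memLp_top hD hF hFα hα.support_odd hF3 hFb
      (fun k hk => by simp [hα.support_odd k hk]) (modeCoeff_mul_freq hω α) fun n => ?_
    have hodd : Odd (2 * (n : ℤ) + 1) := ⟨n, rfl⟩
    have e1 : (2 * (n : ℤ) + 1).natAbs = 2 * n + 1 := by omega
    have hn : (2 * (n : ℝ) + 1) ≠ 0 := by positivity
    have hs : Real.sqrt (2 * Real.pi / ω) ≠ 0 := (Real.sqrt_pos.2 hT).ne'
    have hsq : 2 * Real.pi / ω = Real.sqrt (2 * Real.pi / ω) ^ 2 := (Real.sq_sqrt hT.le).symm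
    -- Here the prefactor `T/(γω⁴)` of J is matched: it is exactly what balances `γ β³` against the
    -- jump `-2Φ_k'(0)`.
    rw [freq_eq hω, modeCoeff, coupling, if_pos hodd, e1]
    set S := Real.sqrt (2 * Real.pi / ω) with hS
    rw [hsq]
    push_cast
    field_simp
  · intro hne
    obtain ⟨n, hn⟩ := exists_pos_coeff_ne_zero hα hne
    refine h.ne_zero (n := n) ?_ (by rw [h0]; exact one_ne_zero)
    have : (2 * (n : ℝ) + 1) ≠ 0 := by positivity
    exact div_ne_zero (mul_ne_zero two_ne_zero hn)
      (mul_ne_zero this (Real.sqrt_pos.2 hT).ne')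
  · have hA : 0 ≤ ∑' n, |modeCoeff (2 * Real.pi / ω) α n| := tsum_nonneg fun n => abs_nonneg _
    refine ⟨((∑' n, |modeCoeff (2 * Real.pi / ω) α n|) + 1) * M, by positivity, fun x t => ?_⟩
    refine (h.abs_modeSeries_le (x, t)).trans ?_
    rw [mul_assoc]
    have : 0 ≤ M * Real.exp (-ρ * |x|) := by positivity
    exact mul_le_mul_of_nonneg_right (by linarith) this
  · intro ν hν0 hν
    have hs := summable_modeCoeff_weighted hT hα.odd (hreg ν hν0 hν)
    exact ⟨h.memHsL2 hs, h.memHsH1 hs⟩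

end Breather

end

theorem mainTheorem6
    (g : ℝ → ℝ) (hg : IsAdmissiblePotential g)
    (γ : ℝ) (hγ : γ ≠ 0) (ω : ℝ) (hω : 0 < ω)
    (hspec : SpectralCondition g ω)
    (Φ : ℕ → ℝ → ℝ)
    (hΦ : ∀ k : ℕ, Odd k → IsDecayingSolution (potential g ω k) (Φ k))
    (ρ M : ℝ) (hρ : 0 < ρ) (hM : 0 < M)
    (hdecay : ∀ k : ℕ, Odd k → ∀ x : ℝ, 0 ≤ x → |Φ k x| ≤ M * Real.exp (-ρ * x))
    (hgrowth : ∃ K : ℝ, ∀ k : ℕ, Odd k → |derivZero (Φ k)| ≤ K * k) :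
    (∀ α : ℤ → ℝ, IsCriticalPoint γ ω Φ α →
      ∃ w : ℝ × ℝ → ℝ, IsSeriesOf (2 * Real.pi / ω) Φ α w ∧
        IsWeakSolution g γ (2 * Real.pi / ω) w ∧
        (α ≠ 0 → ¬ w =ᵐ[volume.restrict (strip (2 * Real.pi / ω))] 0) ∧
        (∃ C > 0, ∀ x t : ℝ, |w (x, t)| ≤ C * Real.exp (-ρ * |x|)) ∧
        ∀ ν : ℝ, 0 < ν → ν < 1 / 4 →
          MemHsL2 (2 * Real.pi / ω) (1 + ν) w ∧ MemHsH1 (2 * Real.pi / ω) ν w) ∧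
    (((γ < 0 ∧ ∃ k : ℕ, Odd k ∧ 0 < derivZero (Φ k)) ∨
        (0 < γ ∧ ∃ k : ℕ, Odd k ∧ derivZero (Φ k) < 0)) →
      ∃ α : ℤ → ℝ, IsCriticalPoint γ ω Φ α ∧ α ≠ 0 ∧
        ∀ z : ℤ → ℝ, MemDomJ z → J γ ω Φ α ≤ J γ ω Φ z) := by
  exact ⟨fun α hα => hα.exists_solution hg hγ hω hΦ hρ hM hdecay hgrowth,
    exists_isCriticalPoint_min hω hgrowth⟩
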